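/- All manifolds are smooth, finite-dimensional, Hausdorff, second countable and without boundary. Let $M$ be a manifold. On $TM\oplus T^*M$ consider the pairing $\langle (X,\xi),(X',\xi')\rangle=\xi'(X)+\xi(X')$ and the Courant bracket $$[(X,\xi),(X',\xi')]=\bigl([X,X'],\ \iota_X d\xi'-\iota_{X'}d\xi+\tfrac12 d(\iota_X\xi'-\iota_{X'}\xi)\bigr).$$ A Dirac structure is a smooth subbundle $D\subset TM\oplus T^*M$ that is maximally isotropic and whose sections close under the Courant bracket. It is called Poisson if it is the graph $\{(\Pi^\sharp\xi,\xi)\}$ of a Poisson bivector field $\Pi$, with bracket $\{f,g\}=dg(\Pi^\sharp df)$. An integrable distribution is a regular smooth distribution that is closed under the Lie bracket; for a distribution $\Phi$ let $\Phi^0\subset T^*M$ be its annihilator. For an isotropic family $S\subset TM\oplus T^*M$ put $D^S=(D\cap S^\perp)+S$. Let $D$ be a Dirac structure on $M$. **I (Dirac bracket).** Let $\Phi\subset TM$ be an integrable distribution such that $D^{\Phi^0}$ is a smooth subbundle. Then: 1. $D^{\Phi^0}$ is a Dirac structure on $M$, and its projection to $TM$ is contained in $\Phi$. It is Poisson if and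 only if $(D+\Phi^0)\cap\Phi=\{0\}$ at every point of $M$. 2. If $D$ and $D^{\Phi^0}$ are Poisson, with brackets $\{\cdot,\cdot\}$ and $\{\cdot,\cdot\}'$, and if $\phi^1,\dots,\phi^k$ are functions, smooth near $x$, whose differentials span $\Phi^0_x$ and for which $C^{ab}=\{\phi^a,\phi^b\}(x)$ is invertible, then at $x$, for all smooth $f,g$, $\{f,g\}'=\{f,g\}-\sum_{a,b}\{f,\phi^a\}(C^{-1})_{ab}\{\phi^b,g\}$. 3. For every leaf $i:N\to M$ of $\Phi$ (more generally, every injectively immersed integral manifold) the set $D_N=\{(u,i^*\xi): (i_*u,\xi)\in D^{\Phi^0}\}$ is a Dirac structure on $N$. It is Poisson if and only if $(D|_N+TN^0)\cap TN=\{0\}$ at every point of $N$; if $D$ is the graph of $\Pi^\sharp$, this is equivalent to $\Pi^\sharp(TN^0)\cap TN=\{0\}$ on $N$. **II (Projection).** Let $S\subset TM$ be an integrable distribution such that $D\cap S^\perp$ and $D^S$ are smooth subbundles. A section $(X,\xi)$ of $D^S$ is called projectable along $S$ if $\xi\in\Gamma(S^0)$ and, for every section $Z$ of $S$, $[Z,X]\in\Gamma(S)$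 and $\mathcal L_Z\xi=0$. Then: 1. The Courant bracket of two projectable sections of $D^S$ is a projectable section of $D^S$ (over $M$ and over any open subset). 2. If through every element of $D^S$ there passes a local projectable section of $D^S$, then $S$ is a symmetry of $D^S$, that is, $(\mathcal L_ZX,\mathcal L_Z\xi)\in\Gamma(D^S)$ for all $Z\in\Gamma(S)$ and $(X,\xi)\in\Gamma(D^S)$. 3. If $S$ is a symmetry of $D^S$ and the space of leaves $B=M/S$ is a manifold with submersion $\tau:M\to B$, then there is a Dirac structure $D_B$ on $B$ with $(D_B)_{\tau(p)}=\{(\tau_*X,\eta):(X,\tau^*\eta)\in D^S_p\}$ for every $p\in M$. **III (Generalized Marsden–Ratiu reduction).** In the situation of II.3 let $i:N\to M$ be a leaf (or other integral manifold) of an integrable distribution $\Phi$, and suppose that the leaf space $Q=N/(S\cap TN)$ is a manifold with submersion $\rho:N\to Q$. Then there is a smooth immersion $j:Q\to B$ with $j\circ\rho=\tau\circ i$. Let $\hat D=\{(u,j^*\eta):(j_*u,\eta)\in D_B\}$. If $(D^S)^{\Phi^0}$ is a smooth subbundle of $TM\oplus T^*M$, or if $\hat D$ is a smooth subbundle of $TQ\oplus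 T^*Q$, then: 1. $\hat D$ is a Dirac structure on $Q$. 2. The following are equivalent: $\hat D$ is Poisson; $\hat D\cap TQ=\{0\}$; for every $p\in N$ and every $(X,\xi)\in D_p$ with $\xi\in S^0_p\cap (T_pN)^0$ and $X\in S_p+T_pN$, one has $X\in S_p$. 3. If $D$ is Poisson and $TM\cap(D+S^0)\subset S+TN$ at every point of $N$, then $\hat D$ is Poisson. -/

import Mathlib

open Set Topology
open scoped Manifold ContDiff Bundle

noncomputable section

namespace DiracGeometry

section Bundles

/-! Throughout, a manifold `M` is modelled on a finite-dimensional real vector space `E` through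
the model with corners `𝓘(ℝ, E)`, so it has no boundary, and smooth means `C^∞`. -/

/-- The tangent space `T_x M`. -/
abbrev Tan (E : Type*) [NormedAddCommGroup E] [NormedSpace ℝ E]
    {M : Type*} [TopologicalSpace M] [ChartedSpace E M] (x : M) : Type _ :=
  TangentSpace 𝓘(ℝ, E) x

/-- The cotangent space `T*_x M`. -/
abbrev Cot (E : Type*) [NormedAddCommGroup E] [NormedSpace ℝ E]
    {M : Type*} [TopologicalSpace M] [ChartedSpace E M] (x : M) : Type _ :=
  TangentSpace 𝓘(ℝ, E) x →L[ℝ] ℝ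

/-- The fibre `T_x M ⊕ T*_x M`. -/
abbrev GenTan (E : Type*) [NormedAddCommGroup E] [NormedSpace ℝ E]
    {M : Type*} [TopologicalSpace M] [ChartedSpace E M] (x : M) : Type _ :=
  Tan E x × Cot E x

variable {E : Type*} [NormedAddCommGroup E] [NormedSpace ℝ E]
  {M : Type*} [TopologicalSpace M] [ChartedSpace E M]

/-! ### Linear algebra in a fibre -/

/-- The symmetric pairing `⟨(X, ξ), (X', ξ')⟩ = ξ'(X) + ξ(X')`. -/
def pairing {x : M} (v w : GenTan E x) : ℝ := w.2 v.1 + v.2 w.1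

/-- The orthogonal `L^⊥` for the symmetric pairing. -/
def orth {x : M} (L : Submodule ℝ (GenTan E x)) : Submodule ℝ (GenTan E x) where
  carrier := {v | ∀ w ∈ L, pairing v w = 0}
  zero_mem' := by
    intro w _
    simp [pairing]
  add_mem' := by
    intro a b ha hb w hw
    have h1 := ha w hw
    have h2 := hb w hw
    simp only [pairing, Prod.fst_add, Prod.snd_add, map_add, _root_.add_apply]
      at h1 h2 ⊢
    linarith
  smul_mem' := by
    intro c a ha w hw
    have h1 := ha w hw
    simp only [pairing, Prod.smul_fst, Prod.smul_snd, map_smul, smul_eq_mul,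
      _root_.smul_apply] at h1 ⊢
    rw [← mul_add, h1, mul_zero]

/-- `L` is isotropic: the pairing vanishes on `L`. -/
def IsIsotropic {x : M} (L : Submodule ℝ (GenTan E x)) : Prop :=
  ∀ v ∈ L, ∀ w ∈ L, pairing v w = 0

/-- The annihilator `V⁰ ⊆ T*_x M` of `V ⊆ T_x M`. -/
def ann {x : M} (V : Submodule ℝ (Tan E x)) : Submodule ℝ (Cot E x) where
  carrier := {ξ | ∀ v ∈ V, ξ v = 0}
  zero_mem' := by
    intro v _
    simp
  add_mem' := by
    intro a b ha hb v hv
    simp [ha v hv, hb v hv]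
  smul_mem' := by
    intro c a ha v hv
    simp [ha v hv]

/-- `V ⊆ T_x M` as the subspace `V ⊕ 0` of `T_x M ⊕ T*_x M`. -/
def tanPart {x : M} (V : Submodule ℝ (Tan E x)) : Submodule ℝ (GenTan E x) := V.prod ⊥

/-- `V⁰ ⊆ T*_x M` as the subspace `0 ⊕ V⁰` of `T_x M ⊕ T*_x M`. -/
def annPart {x : M} (V : Submodule ℝ (Tan E x)) : Submodule ℝ (GenTan E x) :=
  (⊥ : Submodule ℝ (Tan E x)).prod (ann V)

/-- The family `D^S = (D ∩ S^⊥) + S`. -/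
def induced (D S : ∀ x : M, Submodule ℝ (GenTan E x)) (x : M) : Submodule ℝ (GenTan E x) :=
  (D x ⊓ orth (S x)) ⊔ S x

/-! ### Smooth sections and smooth subbundles -/

variable [IsManifold 𝓘(ℝ, E) ∞ M]

/-- The vector field `X` is smooth on `U`. -/
def SmoothFieldOn (X : ∀ x : M, Tan E x) (U : Set M) : Prop :=
  ContMDiffOn 𝓘(ℝ, E) (𝓘(ℝ, E).prod 𝓘(ℝ, E)) ∞
    (fun x => Bundle.TotalSpace.mk' E (E := fun x : M => TangentSpace 𝓘(ℝ, E) x) x (X x)) U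

/-- The one-form `ξ` is smooth on `U`, as a section of the cotangent bundle. -/
def SmoothFormOn (ξ : ∀ x : M, Cot E x) (U : Set M) : Prop :=
  ContMDiffOn 𝓘(ℝ, E) (𝓘(ℝ, E).prod 𝓘(ℝ, E →L[ℝ] ℝ)) ∞
    (fun x => Bundle.TotalSpace.mk' (E →L[ℝ] ℝ)
      (E := fun x : M => TangentSpace 𝓘(ℝ, E) x →L[ℝ] ℝ) x (ξ x)) U

/-- The section `σ = (X, ξ)` of `TM ⊕ T*M` is smooth on `U`. -/
def SmoothGenOn (σ : ∀ x : M, GenTan E x) (U : Set M) : Prop :=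
  SmoothFieldOn (fun x => (σ x).1) U ∧ SmoothFormOn (fun x => (σ x).2) U

/-- `D` is a smooth vector subbundle of `TM ⊕ T*M`: locally it has a smooth frame. -/
def IsSubbundle (D : ∀ x : M, Submodule ℝ (GenTan E x)) : Prop :=
  ∀ p : M, ∃ (k : ℕ) (U : Set M) (σ : Fin k → ∀ x : M, GenTan E x),
    IsOpen U ∧ p ∈ U ∧ (∀ i, SmoothGenOn (σ i) U) ∧
    ∀ x ∈ U, LinearIndependent ℝ (fun i => σ i x) ∧
      Submodule.span ℝ (range fun i => σ i x) = D x

/-- `Φ` is a smooth (regular) distribution: locally it has a smooth frame of vector fields. -/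
def IsDistribution (Φ : ∀ x : M, Submodule ℝ (Tan E x)) : Prop :=
  ∀ p : M, ∃ (k : ℕ) (U : Set M) (X : Fin k → ∀ x : M, Tan E x),
    IsOpen U ∧ p ∈ U ∧ (∀ i, SmoothFieldOn (X i) U) ∧
    ∀ x ∈ U, LinearIndependent ℝ (fun i => X i x) ∧
      Submodule.span ℝ (range fun i => X i x) = Φ x

/-- `Z` is a smooth section over `U` of the distribution `S`. -/
def IsFieldIn (S : ∀ x : M, Submodule ℝ (Tan E x)) (Z : ∀ x : M, Tan E x) (U : Set M) : Prop :=
  SmoothFieldOn Z U ∧ ∀ x ∈ U, Z x ∈ S x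

/-- `σ` is a smooth section over `U` of `D ⊆ TM ⊕ T*M`. -/
def IsSectionOn (D : ∀ x : M, Submodule ℝ (GenTan E x)) (σ : ∀ x : M, GenTan E x)
    (U : Set M) : Prop :=
  SmoothGenOn σ U ∧ ∀ x ∈ U, σ x ∈ D x

/-- `Φ` is an integrable distribution: it is regular, and the Lie bracket of two sections of `Φ`
(over any open set) is a section of `Φ`. -/
def IsIntegrable (Φ : ∀ x : M, Submodule ℝ (Tan E x)) : Prop :=
  IsDistribution Φ ∧
    ∀ (U : Set M) (X Y : ∀ x : M, Tan E x), IsOpen U → IsFieldIn Φ X U → IsFieldIn Φ Y U →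
      ∀ x ∈ U, VectorField.mlieBracket 𝓘(ℝ, E) X Y x ∈ Φ x

/-! ### Cartan calculus of one-forms and the Courant bracket -/

/-- The one-form `ξ` read in the preferred chart at `p`, as a one-form on the model space. -/
def formInChart (ξ : ∀ x : M, Cot E x) (p : M) (y : E) : E →L[ℝ] ℝ :=
  (ξ ((extChartAt 𝓘(ℝ, E) p).symm y)).comp
    (mfderiv 𝓘(ℝ, E) 𝓘(ℝ, E) (extChartAt 𝓘(ℝ, E) p).symm y)

/-- The exterior derivative `dξ` of a one-form, as a bilinear form on `T_p M`: in a chart,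
`dξ(u, v) = (∂_u ξ)(v) - (∂_v ξ)(u)`. -/
def extD (ξ : ∀ x : M, Cot E x) (p : M) : Tan E p →L[ℝ] Tan E p →L[ℝ] ℝ :=
  let A : E →L[ℝ] E →L[ℝ] ℝ := fderiv ℝ (formInChart ξ p) (extChartAt 𝓘(ℝ, E) p p)
  let L : Tan E p →L[ℝ] E := mfderiv 𝓘(ℝ, E) 𝓘(ℝ, E) (extChartAt 𝓘(ℝ, E) p) p
  (ContinuousLinearMap.precomp ℝ L).comp ((A - A.flip).comp L)

/-- The Lie derivative of a one-form, `L_Z ξ = ι(Z) dξ + d(ι(Z) ξ)`. -/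
def lieForm (Z : ∀ x : M, Tan E x) (ξ : ∀ x : M, Cot E x) (p : M) : Cot E p :=
  extD ξ p (Z p) + mvfderiv 𝓘(ℝ, E) (fun x => ξ x (Z x)) p

/-- The Courant bracket
`[(X,ξ),(X',ξ')] = ([X,X'], ι(X)dξ' - ι(X')dξ + ½ d(ι(X)ξ' - ι(X')ξ))`. -/
def courant (σ σ' : ∀ x : M, GenTan E x) (p : M) : GenTan E p :=
  (VectorField.mlieBracket 𝓘(ℝ, E) (fun x => (σ x).1) (fun x => (σ' x).1) p,
    extD (fun x => (σ' x).2) p (σ p).1 - extD (fun x => (σ x).2) p (σ' p).1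
      + (1 / 2 : ℝ) •
        mvfderiv 𝓘(ℝ, E) (fun x => (σ' x).2 (σ x).1 - (σ x).2 (σ' x).1) p)

/-! ### Dirac and Poisson structures -/

/-- A Dirac structure: a smooth subbundle `D ⊆ TM ⊕ T*M` which is maximally isotropic and whose
sections (over any open set) close under the Courant bracket. -/
structure IsDirac (D : ∀ x : M, Submodule ℝ (GenTan E x)) : Prop where
  subbundle : IsSubbundle D
  maximal : ∀ x, Maximal IsIsotropic (D x)
  closed : ∀ (U : Set M) (σ σ' : ∀ x : M, GenTan E x), IsOpen U →
    IsSectionOn D σ U → IsSectionOn D σ' U → ∀ x ∈ U, courant σ σ' x ∈ D x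

/-- The bracket `{f, g} = dg(Π^♯ df)` of a bivector field given by its map `Π^♯ : T*M → TM`. -/
def bracket (P : ∀ x : M, Cot E x →ₗ[ℝ] Tan E x) (f g : M → ℝ) (x : M) : ℝ :=
  mvfderiv 𝓘(ℝ, E) g x (P x (mvfderiv 𝓘(ℝ, E) f x))

/-- `P = Π^♯` for a Poisson bivector field `Π`: it is skew-symmetric, smooth (it maps smooth
one-forms to smooth vector fields), and its bracket on `C^∞(M)` satisfies the Jacobi identity. -/
structure IsPoissonTensor (P : ∀ x : M, Cot E x →ₗ[ℝ] Tan E x) : Prop where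
  skew : ∀ (x : M) (α β : Cot E x), β (P x α) = -α (P x β)
  smooth : ∀ (U : Set M) (ξ : ∀ x : M, Cot E x), IsOpen U → SmoothFormOn ξ U →
    SmoothFieldOn (fun x => P x (ξ x)) U
  jacobi : ∀ f g h : M → ℝ, ContMDiff 𝓘(ℝ, E) 𝓘(ℝ, ℝ) ∞ f → ContMDiff 𝓘(ℝ, E) 𝓘(ℝ, ℝ) ∞ g →
    ContMDiff 𝓘(ℝ, E) 𝓘(ℝ, ℝ) ∞ h → ∀ x,
      bracket P f (bracket P g h) x + bracket P g (bracket P h f) x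
        + bracket P h (bracket P f g) x = 0

/-- `D` is the graph of `P : T*M → TM`. -/
def IsGraph (D : ∀ x : M, Submodule ℝ (GenTan E x)) (P : ∀ x : M, Cot E x →ₗ[ℝ] Tan E x) :
    Prop :=
  ∀ (x : M) (v : GenTan E x), v ∈ D x ↔ v.1 = P x v.2

/-- `D` is (the graph of) a Poisson structure. -/
def IsPoisson (D : ∀ x : M, Submodule ℝ (GenTan E x)) : Prop :=
  ∃ P : ∀ x : M, Cot E x →ₗ[ℝ] Tan E x, IsPoissonTensor P ∧ IsGraph D P

/-! ### Symmetries and projectable sections -/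

/-- Every section `Z` of `S` is a symmetry of `D`: `(L_Z X, L_Z ξ)` is a section of `D` for all
sections `(X, ξ)` of `D`. -/
def IsSymmetry (S : ∀ x : M, Submodule ℝ (Tan E x)) (D : ∀ x : M, Submodule ℝ (GenTan E x)) :
    Prop :=
  ∀ (U : Set M) (Z : ∀ x : M, Tan E x) (σ : ∀ x : M, GenTan E x), IsOpen U →
    IsFieldIn S Z U → IsSectionOn D σ U → ∀ x ∈ U,
      ((VectorField.mlieBracket 𝓘(ℝ, E) Z (fun y => (σ y).1) x,
        lieForm Z (fun y => (σ y).2) x) : GenTan E x) ∈ D x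

/-- `σ = (X, ξ)` is a section of `D` over `U` which is projectable along `S`: `ξ` is a section of
`S⁰`, and `L_Z X` is a section of `S` and `L_Z ξ = 0` for all (local) sections `Z` of `S`. -/
def IsProjectableOn (S : ∀ x : M, Submodule ℝ (Tan E x))
    (D : ∀ x : M, Submodule ℝ (GenTan E x)) (σ : ∀ x : M, GenTan E x) (U : Set M) : Prop :=
  IsSectionOn D σ U ∧ (∀ x ∈ U, (σ x).2 ∈ ann (S x)) ∧
    ∀ (V : Set M) (Z : ∀ x : M, Tan E x), IsOpen V → V ⊆ U → IsFieldIn S Z V → ∀ x ∈ V,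
      VectorField.mlieBracket 𝓘(ℝ, E) Z (fun y => (σ y).1) x ∈ S x ∧
        lieForm Z (fun y => (σ y).2) x = 0

end Bundles

section Maps

variable {E : Type*} [NormedAddCommGroup E] [NormedSpace ℝ E]
  {M : Type*} [TopologicalSpace M] [ChartedSpace E M]
  {F : Type*} [NormedAddCommGroup F] [NormedSpace ℝ F]
  {N : Type*} [TopologicalSpace N] [ChartedSpace F N]

/-- The differential `T_y N → T_{f y} M`. -/
abbrev tanMap (E F : Type*) [NormedAddCommGroup E] [NormedSpace ℝ E]
    [NormedAddCommGroup F] [NormedSpace ℝ F]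
    {M : Type*} [TopologicalSpace M] [ChartedSpace E M]
    {N : Type*} [TopologicalSpace N] [ChartedSpace F N] (f : N → M) (y : N) :
    Tan F y →L[ℝ] Tan E (f y) :=
  mfderiv 𝓘(ℝ, F) 𝓘(ℝ, E) f y

/-- The tangent space of the image, `f_*(T_y N) ⊆ T_{f y} M`. -/
def tanRange (E F : Type*) [NormedAddCommGroup E] [NormedSpace ℝ E]
    [NormedAddCommGroup F] [NormedSpace ℝ F]
    {M : Type*} [TopologicalSpace M] [ChartedSpace E M]
    {N : Type*} [TopologicalSpace N] [ChartedSpace F N] (f : N → M) (y : N) :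
    Submodule ℝ (Tan E (f y)) :=
  LinearMap.range (tanMap E F f y).toLinearMap

/-- For an immersion `f`, the image of `D` under `f_*⁻¹ ⊕ f^*`:
at `y ∈ N` it is the set of all `(u, f^*ξ)` with `(f_* u, ξ) ∈ D_{f y}`. -/
def pullback (f : N → M) (D : ∀ x : M, Submodule ℝ (GenTan E x)) (y : N) :
    Submodule ℝ (GenTan F y) where
  carrier := {w | ∃ ξ : Cot E (f y),
    ((tanMap E F f y w.1, ξ) : GenTan E (f y)) ∈ D (f y) ∧ w.2 = ξ.comp (tanMap E F f y)}
  zero_mem' := by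
    refine ⟨0, ?_, ?_⟩
    · have h : ((tanMap E F f y (0 : GenTan F y).1, 0) : GenTan E (f y)) = 0 := by
        ext <;> simp
      rw [h]
      exact (D (f y)).zero_mem
    · simp
  add_mem' := by
    rintro a b ⟨ξ, h1, h2⟩ ⟨η, h3, h4⟩
    refine ⟨ξ + η, ?_, ?_⟩
    · have h := (D (f y)).add_mem h1 h3
      rwa [Prod.mk_add_mk, ← map_add] at h
    · rw [Prod.snd_add, h2, h4, ContinuousLinearMap.add_comp]
  smul_mem' := by
    rintro c a ⟨ξ, h1, h2⟩
    refine ⟨c • ξ, ?_, ?_⟩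
    · have h := (D (f y)).smul_mem c h1
      rwa [Prod.smul_mk, ← map_smul] at h
    · rw [Prod.smul_snd, h2, ContinuousLinearMap.smul_comp]

/-- For a submersion `τ`, the image of `D_x` under `τ_* ⊕ (τ^*)⁻¹`:
the set of all `(τ_* X, η)` with `(X, τ^* η) ∈ D_x`. -/
def pushforwardAt (τ : N → M) (D : ∀ y : N, Submodule ℝ (GenTan F y)) (y : N) :
    Submodule ℝ (GenTan E (τ y)) where
  carrier := {w | ∃ X : Tan F y,
    ((X, w.2.comp (tanMap E F τ y)) : GenTan F y) ∈ D y ∧ w.1 = tanMap E F τ y X}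
  zero_mem' := by
    refine ⟨0, ?_, ?_⟩
    · have h : ((0, (0 : GenTan E (τ y)).2.comp (tanMap E F τ y)) : GenTan F y) = 0 := by
        ext <;> simp
      rw [h]
      exact (D y).zero_mem
    · simp
  add_mem' := by
    rintro a b ⟨X, h1, h2⟩ ⟨Y, h3, h4⟩
    refine ⟨X + Y, ?_, ?_⟩
    · have h := (D y).add_mem h1 h3
      rwa [Prod.mk_add_mk, ← ContinuousLinearMap.add_comp] at h
    · rw [Prod.fst_add, h2, h4, map_add]
  smul_mem' := by
    rintro c a ⟨X, h1, h2⟩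
    refine ⟨c • X, ?_, ?_⟩
    · have h := (D y).smul_mem c h1
      rwa [Prod.smul_mk, ← ContinuousLinearMap.smul_comp] at h
    · rw [Prod.smul_fst, h2, map_smul]

/-- `i : N → M` is an injectively immersed integral manifold of `Φ`. The leaves of `Φ` are its
maximal connected integral manifolds. -/
structure IsIntegralManifold (Φ : ∀ x : M, Submodule ℝ (Tan E x)) (i : N → M) : Prop where
  smooth : ContMDiff 𝓘(ℝ, F) 𝓘(ℝ, E) ∞ i
  injective : Function.Injective i
  immersion : ∀ y, Function.Injective (tanMap E F i y)
  tangent : ∀ y, tanRange E F i y = Φ (i y)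

/-- `p` and `q` lie on the same leaf of `S`: a smooth curve tangent to `S` joins them. -/
def SameLeaf (S : ∀ x : M, Submodule ℝ (Tan E x)) (p q : M) : Prop :=
  ∃ γ : ℝ → M, ContMDiff 𝓘(ℝ, ℝ) 𝓘(ℝ, E) ∞ γ ∧ γ 0 = p ∧ γ 1 = q ∧
    ∀ t, tanRange E ℝ γ t ≤ S (γ t)

/-- `τ : N → M` exhibits the manifold `M` as the space of leaves `N/S` of the distribution `S`:
it is a surjective submersion with vertical distribution `S` whose fibres are the leaves. -/
structure IsLeafSpace (S : ∀ y : N, Submodule ℝ (Tan F y)) (τ : N → M) : Prop where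
  smooth : ContMDiff 𝓘(ℝ, F) 𝓘(ℝ, E) ∞ τ
  surjective : Function.Surjective τ
  submersion : ∀ y, Function.Surjective (tanMap E F τ y)
  vertical : ∀ y, LinearMap.ker (tanMap E F τ y).toLinearMap = S y
  fibre : ∀ y y' : N, τ y = τ y' ↔ SameLeaf S y y'

/-- The distribution `S ∩ TN` on an immersed manifold `i : N → M`. -/
def restrictDist (i : N → M) (S : ∀ x : M, Submodule ℝ (Tan E x)) (y : N) :
    Submodule ℝ (Tan F y) :=
  (S (i y)).comap (tanMap E F i y).toLinearMap

end Maps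

end DiracGeometry

end

open DiracGeometry

/-! The main tool is the trilinear form T(σ₁, σ₂, σ₃) = ⟨[σ₁, σ₂], σ₃⟩. On sections of an isotropic
family it is a sum over cyclic permutations (`pairing_courant`). Being cyclic, and pointwise in its
last slot, it is a tensor (`pairing_courant_congr`). The pairing has split signature, so a maximal
isotropic L satisfies L = L^⊥ (`orth_eq_of_maximal`). Hence L is Courant closed as soon as T
vanishes on it, and this may be tested on a dense set of points, with any convenient sections
through given values.

Linear algebra: ⊥ exchanges sums and intersections, so by the modular law D^S is again equal to its
orthogonal (`orth_induced`); the same holds for the pullback and the pushforward of such a space by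
a linear map (`orth_pullback`, `orth_pushforwardAt`). All ranks are then automatically half the
dimension, and two such spaces coincide once one contains the other.

Closure of D^S (`courant_mem_induced`): the rank of D + S may jump, but in every open set it is
maximal somewhere, and near such a point sections of D^S split smoothly as d + z with d in D and z
in S. T vanishes on the d's because D is closed; the terms containing some z vanish if brackets with
sections of S stay in D^S. For S = Φ⁰ this is the integrability of Φ. For S ⊂ TM the bracket with Z
is the Lie derivative, so it is the symmetry condition, and a projectable section satisfies it
individually. A Dirac structure containing no nonzero tangent vector is a graph, and T on the
sections (Π^♯df, df) is its Jacobiator (`isPoisson_iff`).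

Leaf space: if σ is related to a section on B, its pairings with a frame of L = D^S satisfy a
homogeneous linear differential equation along curves in a leaf, because S is a symmetry
(`exists_ball_mem`). So membership in L propagates along leaves and D_B is well defined. It is
smooth because τ has local sections, and closed because T is natural for related sections
(`Related.pairing_courant`). For pullbacks by immersions the density argument recurs: generically
every element extends to a section related to one of D (`exists_related_section`).

Reduction: the structure on Q is the pullback of D_B by j, and also the image under ρ of the
restriction of (D^S)^{Φ⁰} to N (`pullback_reducedMap_eq`). The first description gives closure, the
second smoothness. The Poisson criteria are then pointwise linear algebra, the last one using the
skewness of Π (`fst_mem_of_isPoisson`). -/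

namespace DiracGeometry

noncomputable section

/-! ### Smooth fields and forms in local trivializations. -/

section Coordinates

variable {E : Type*} [NormedAddCommGroup E] [NormedSpace ℝ E]
  {M : Type*} [TopologicalSpace M] [ChartedSpace E M] [IsManifold 𝓘(ℝ, E) ∞ M]

/-- The trivialization of the tangent bundle over the chart at `p`. -/
def toCoord (p x : M) : Tan E x →L[ℝ] E :=
  (trivializationAt E (TangentSpace 𝓘(ℝ, E)) p).continuousLinearMapAt ℝ x

/-- The inverse of the trivialization of the tangent bundle over the chart at `p`. -/
def ofCoord (p x : M) : E →L[ℝ] Tan E x :=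
  (trivializationAt E (TangentSpace 𝓘(ℝ, E)) p).symmL ℝ x

theorem toCoord_ofCoord {p x : M} (hx : x ∈ (chartAt E p).source) (v : E) :
    toCoord p x (ofCoord p x v) = v :=
  (trivializationAt E (TangentSpace 𝓘(ℝ, E)) p).continuousLinearMapAt_symmL
    (R := ℝ) (b := x) (by simpa using hx) v

theorem ofCoord_toCoord {p x : M} (hx : x ∈ (chartAt E p).source) (X : Tan E x) :
    ofCoord p x (toCoord p x X) = X :=
  (trivializationAt E (TangentSpace 𝓘(ℝ, E)) p).symmL_continuousLinearMapAt
    (R := ℝ) (b := x) (by simpa using hx) X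

/-- Together with its counterpart for forms this turns questions of smoothness into questions about
functions with values in a fixed vector space. -/
theorem smoothFieldOn_iff {p : M} {U : Set M} (hO : IsOpen U) (hU : U ⊆ (chartAt E p).source)
    (X : ∀ x : M, Tan E x) :
    SmoothFieldOn X U ↔
      ContMDiffOn 𝓘(ℝ, E) 𝓘(ℝ, E) ∞ (fun x => toCoord p x (X x)) U := by
  have hU' : U ⊆ (trivializationAt E (TangentSpace 𝓘(ℝ, E)) p).baseSet := by simpa using hU
  unfold SmoothFieldOn
  rw [Bundle.Trivialization.contMDiffOn_section_iff _ hO hU']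
  refine contMDiffOn_congr fun x hx => ?_
  simp only [toCoord]
  rw [Bundle.Trivialization.continuousLinearMapAt_apply_of_mem _ _ (hU' hx)]

theorem smoothFormOn_iff {p : M} {U : Set M} (hO : IsOpen U) (hU : U ⊆ (chartAt E p).source)
    (ξ : ∀ x : M, Cot E x) :
    SmoothFormOn ξ U ↔
      ContMDiffOn 𝓘(ℝ, E) 𝓘(ℝ, E →L[ℝ] ℝ) ∞ (fun x => (ξ x).comp (ofCoord p x)) U := by
  unfold SmoothFormOn
  have hU' : U ⊆ (trivializationAt (E →L[ℝ] ℝ)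
      (fun x : M => TangentSpace 𝓘(ℝ, E) x →L[ℝ] ℝ) p).baseSet := by
    simpa using hU
  rw [Bundle.Trivialization.contMDiffOn_section_iff _ hO hU']
  refine contMDiffOn_congr fun x hx => ?_
  rw [hom_trivializationAt_apply]
  ext v
  simp [ofCoord, ContinuousLinearMap.inCoordinates]

theorem SmoothFieldOn.mono {X : ∀ x : M, Tan E x} {U V : Set M} (h : SmoothFieldOn X U)
    (hV : V ⊆ U) : SmoothFieldOn X V := ContMDiffOn.mono h hV

theorem SmoothFormOn.mono {ξ : ∀ x : M, Cot E x} {U V : Set M} (h : SmoothFormOn ξ U)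
    (hV : V ⊆ U) : SmoothFormOn ξ V := ContMDiffOn.mono h hV

theorem SmoothGenOn.mono {σ : ∀ x : M, GenTan E x} {U V : Set M} (h : SmoothGenOn σ U)
    (hV : V ⊆ U) : SmoothGenOn σ V := ⟨h.1.mono hV, h.2.mono hV⟩

theorem SmoothFieldOn.congr {X Y : ∀ x : M, Tan E x} {U : Set M} (h : SmoothFieldOn X U)
    (hXY : ∀ x ∈ U, Y x = X x) : SmoothFieldOn Y U :=
  ContMDiffOn.congr h fun x hx => by rw [hXY x hx]

theorem SmoothFormOn.congr {ξ η : ∀ x : M, Cot E x} {U : Set M} (h : SmoothFormOn ξ U)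
    (hξ : ∀ x ∈ U, η x = ξ x) : SmoothFormOn η U :=
  ContMDiffOn.congr h fun x hx => by rw [hξ x hx]

theorem SmoothFieldOn.add {X Y : ∀ x : M, Tan E x} {U : Set M} (hX : SmoothFieldOn X U)
    (hY : SmoothFieldOn Y U) : SmoothFieldOn (fun x => X x + Y x) U :=
  ContMDiffOn.add_section hX hY

theorem SmoothFieldOn.sum {ι : Type*} (s : Finset ι) {X : ι → ∀ x : M, Tan E x} {U : Set M}
    (hX : ∀ i, SmoothFieldOn (X i) U) : SmoothFieldOn (fun x => ∑ i ∈ s, X i x) U :=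
  ContMDiffOn.sum_section fun i _ => hX i

theorem SmoothFieldOn.smul {X : ∀ x : M, Tan E x} {f : M → ℝ} {U : Set M}
    (hf : ContMDiffOn 𝓘(ℝ, E) 𝓘(ℝ, ℝ) ∞ f U) (hX : SmoothFieldOn X U) :
    SmoothFieldOn (fun x => f x • X x) U :=
  ContMDiffOn.smul_section hf hX

theorem smoothFieldOn_zero (U : Set M) : SmoothFieldOn (fun x : M => (0 : Tan E x)) U :=
  (Bundle.contMDiff_zeroSection ℝ (TangentSpace 𝓘(ℝ, E) (M := M))).contMDiffOn

theorem SmoothFormOn.add {ξ η : ∀ x : M, Cot E x} {U : Set M} (hξ : SmoothFormOn ξ U)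
    (hη : SmoothFormOn η U) : SmoothFormOn (fun x => ξ x + η x) U :=
  ContMDiffOn.add_section hξ hη

theorem SmoothFormOn.sub {ξ η : ∀ x : M, Cot E x} {U : Set M} (hξ : SmoothFormOn ξ U)
    (hη : SmoothFormOn η U) : SmoothFormOn (fun x => ξ x - η x) U :=
  ContMDiffOn.sub_section hξ hη

theorem SmoothFormOn.sum {ι : Type*} (s : Finset ι) {ξ : ι → ∀ x : M, Cot E x} {U : Set M}
    (hξ : ∀ i, SmoothFormOn (ξ i) U) : SmoothFormOn (fun x => ∑ i ∈ s, ξ i x) U :=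
  ContMDiffOn.sum_section fun i _ => hξ i

theorem SmoothFormOn.smul {ξ : ∀ x : M, Cot E x} {f : M → ℝ} {U : Set M}
    (hf : ContMDiffOn 𝓘(ℝ, E) 𝓘(ℝ, ℝ) ∞ f U) (hξ : SmoothFormOn ξ U) :
    SmoothFormOn (fun x => f x • ξ x) U :=
  ContMDiffOn.smul_section hf hξ

theorem smoothFormOn_zero (U : Set M) : SmoothFormOn (fun x : M => (0 : Cot E x)) U :=
  (Bundle.contMDiff_zeroSection ℝ (fun x : M => TangentSpace 𝓘(ℝ, E) x →L[ℝ] ℝ)).contMDiffOn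

theorem SmoothGenOn.smul {σ : ∀ x : M, GenTan E x} {f : M → ℝ} {U : Set M}
    (hf : ContMDiffOn 𝓘(ℝ, E) 𝓘(ℝ, ℝ) ∞ f U) (hσ : SmoothGenOn σ U) :
    SmoothGenOn (fun x => f x • σ x) U :=
  ⟨hσ.1.smul hf, hσ.2.smul hf⟩

theorem SmoothGenOn.sum {ι : Type*} (s : Finset ι) {σ : ι → ∀ x : M, GenTan E x} {U : Set M}
    (hσ : ∀ i, SmoothGenOn (σ i) U) : SmoothGenOn (fun x => ∑ i ∈ s, σ i x) U :=
  ⟨(SmoothFieldOn.sum s fun i => (hσ i).1).congr fun _ _ => Prod.fst_sum,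
    (SmoothFormOn.sum s fun i => (hσ i).2).congr fun _ _ => Prod.snd_sum⟩

theorem SmoothFormOn.apply {ξ : ∀ x : M, Cot E x} {X : ∀ x : M, Tan E x} {U : Set M}
    (hξ : SmoothFormOn ξ U) (hX : SmoothFieldOn X U) :
    ContMDiffOn 𝓘(ℝ, E) 𝓘(ℝ, ℝ) ∞ (fun x => ξ x (X x)) U := by
  intro x hx
  have h := ContMDiffWithinAt.clm_bundle_apply (F₂ := ℝ) (E₂ := fun _ : M => ℝ)
    (b := fun x : M => x)
    (hξ x hx) (hX x hx)
  exact (Bundle.contMDiffWithinAt_totalSpace.1 h).2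

theorem smoothFieldOn_ofCoord (p : M) (v : E) :
    SmoothFieldOn (fun x : M => ofCoord p x v) (chartAt E p).source := by
  rw [smoothFieldOn_iff (p := p) (chartAt E p).open_source subset_rfl]
  exact (contMDiffOn_const (c := v)).congr fun x hx => toCoord_ofCoord hx v

theorem exists_smoothFieldOn (p : M) (v : Tan E p) :
    ∃ X : ∀ x : M, Tan E x, SmoothFieldOn X (chartAt E p).source ∧ X p = v :=
  ⟨fun x => ofCoord p x (toCoord p p v), smoothFieldOn_ofCoord p _,
    ofCoord_toCoord (mem_chart_source E p) v⟩

theorem smoothFormOn_mvfderiv {f : M → ℝ} {U : Set M} (hO : IsOpen U)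
    (hf : ContMDiffOn 𝓘(ℝ, E) 𝓘(ℝ, ℝ) ∞ f U) :
    SmoothFormOn (fun x => mvfderiv 𝓘(ℝ, E) f x) U := by
  intro x hx
  have h := ContMDiffAt.mfderiv_const (m := ∞) (hf.contMDiffAt (hO.mem_nhds hx)) (by simp)
  refine ContMDiffAt.contMDiffWithinAt ?_
  rw [Bundle.contMDiffAt_section]
  refine h.congr_of_eventuallyEq ?_
  filter_upwards [(chartAt E x).open_source.mem_nhds (mem_chart_source E x)] with y hy
  ext v
  simp [hom_trivializationAt_apply, ContinuousLinearMap.inCoordinates,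
    inTangentCoordinates, mvfderiv]
  rfl

section Complete
variable [CompleteSpace E]

theorem SmoothFieldOn.mlieBracket {X Y : ∀ x : M, Tan E x} {U : Set M} (hO : IsOpen U)
    (hX : SmoothFieldOn X U) (hY : SmoothFieldOn Y U) :
    SmoothFieldOn (VectorField.mlieBracket 𝓘(ℝ, E) X Y) U := fun x hx =>
  haveI : IsManifold 𝓘(ℝ, E) (((⊤ : ℕ∞) : WithTop ℕ∞) + 1) M :=
    inferInstanceAs (IsManifold 𝓘(ℝ, E) ∞ M)
  haveI : IsManifold 𝓘(ℝ, E) (minSmoothness ℝ 2) M :=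
    IsManifold.of_le (n := ∞) (by simpa using ENat.LEInfty.out)
  (ContMDiffAt.mlieBracket_vectorField (m := ⊤) (n := ⊤)
    (ContMDiffOn.contMDiffAt hX (hO.mem_nhds hx))
    (ContMDiffOn.contMDiffAt hY (hO.mem_nhds hx)) (by simp)).contMDiffWithinAt

end Complete

end Coordinates
end
end DiracGeometry

namespace DiracGeometry

noncomputable section

/-! ### Cartan calculus in a chart: exterior derivative and Lie bracket. -/

section Calculus

variable {E : Type*} [NormedAddCommGroup E] [NormedSpace ℝ E]
  {M : Type*} [TopologicalSpace M] [ChartedSpace E M] [IsManifold 𝓘(ℝ, E) ∞ M]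

/-- A vector field read in the chart at `p`. -/
def fieldInChart (X : ∀ x : M, Tan E x) (p : M) (y : E) : E :=
  toCoord p ((extChartAt 𝓘(ℝ, E) p).symm y) (X ((extChartAt 𝓘(ℝ, E) p).symm y))

theorem inverse_ofCoord {p x : M} (hx : x ∈ (chartAt E p).source) :
    (ofCoord (E := E) p x).inverse = toCoord p x :=
  ContinuousLinearMap.inverse_eq (ContinuousLinearMap.ext (ofCoord_toCoord hx))
    (ContinuousLinearMap.ext (toCoord_ofCoord hx))

/-- Links the derivative of the inverse chart, which defines `formInChart`, with the trivialization,
in which smoothness is tested. -/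
theorem mfderiv_extChartAt_symm_eq {p : M} {y : E} (hy : y ∈ (extChartAt 𝓘(ℝ, E) p).target) :
    (mfderiv 𝓘(ℝ, E) 𝓘(ℝ, E) (extChartAt 𝓘(ℝ, E) p).symm y : E →L[ℝ] _) =
      ofCoord (E := E) p ((extChartAt 𝓘(ℝ, E) p).symm y) := by
  have hs : (extChartAt 𝓘(ℝ, E) p).symm y ∈ (chartAt E p).source := by
    simpa using (extChartAt 𝓘(ℝ, E) p).map_target hy
  have h := TangentBundle.symmL_trivializationAt (I := 𝓘(ℝ, E)) (x₀ := p)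
    (x := (extChartAt 𝓘(ℝ, E) p).symm y) hs
  unfold ofCoord
  rw [h, (extChartAt 𝓘(ℝ, E) p).right_inv hy]
  simp
  rfl

theorem toCoord_self (p : M) (v : Tan E p) : toCoord p p v = v := by
  unfold toCoord
  rw [TangentBundle.continuousLinearMapAt_trivializationAt (mem_chart_source E p),
    mfderiv_extChartAt_self]
  rfl

theorem ofCoord_self (p : M) (v : E) : ofCoord p p v = v := by
  rw [← toCoord_self p (ofCoord p p v), toCoord_ofCoord (mem_chart_source E p)]

theorem contDiffAt_of_contMDiffOn {W : Type*} [NormedAddCommGroup W] [NormedSpace ℝ W]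
    {f : M → W} {U : Set M} (hO : IsOpen U) {p : M} (hp : p ∈ U)
    (hf : ContMDiffOn 𝓘(ℝ, E) 𝓘(ℝ, W) ∞ f U) :
    ContDiffAt ℝ ∞ (f ∘ (extChartAt 𝓘(ℝ, E) p).symm) (extChartAt 𝓘(ℝ, E) p p) := by
  rw [← contMDiffAt_iff_contDiffAt]
  refine ContMDiffAt.comp (I' := 𝓘(ℝ, E)) _ ?_ ?_
  · rw [extChartAt_to_inv]
    exact hf.contMDiffAt (hO.mem_nhds hp)
  · exact (contMDiffOn_extChartAt_symm p).contMDiffAt (extChartAt_target_mem_nhds p)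

omit [IsManifold 𝓘(ℝ, E) ∞ M] in
theorem mvfderiv_eq_fderiv {W : Type*} [NormedAddCommGroup W] [NormedSpace ℝ W]
    {f : M → W} {p : M} (hf : MDifferentiableAt 𝓘(ℝ, E) 𝓘(ℝ, W) f p) (v : Tan E p) :
    mvfderiv 𝓘(ℝ, E) f p v =
      fderiv ℝ (f ∘ (extChartAt 𝓘(ℝ, E) p).symm) (extChartAt 𝓘(ℝ, E) p p) v := by
  rw [hf.mvfderiv]
  simp [writtenInExtChartAt]
  rfl

omit [IsManifold 𝓘(ℝ, E) ∞ M] in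
theorem eventually_symm_mem {U : Set M} (hO : IsOpen U) {p : M} (hp : p ∈ U) :
    ∀ᶠ y in 𝓝 (extChartAt 𝓘(ℝ, E) p p), y ∈ (extChartAt 𝓘(ℝ, E) p).target ∧
      (extChartAt 𝓘(ℝ, E) p).symm y ∈ U ∩ (chartAt E p).source := by
  have hc : ContinuousAt (extChartAt 𝓘(ℝ, E) p).symm (extChartAt 𝓘(ℝ, E) p p) :=
    continuousAt_extChartAt_symm p
  have h := hc.preimage_mem_nhds (t := U) (by
    rw [extChartAt_to_inv]; exact hO.mem_nhds hp)
  filter_upwards [extChartAt_target_mem_nhds p, h] with y hy hyU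
  exact ⟨hy, hyU, by simpa using (extChartAt 𝓘(ℝ, E) p).map_target hy⟩

theorem SmoothFieldOn.contDiffAt_fieldInChart {X : ∀ x : M, Tan E x} {U : Set M}
    (hO : IsOpen U) (hX : SmoothFieldOn X U) {p : M} (hp : p ∈ U) :
    ContDiffAt ℝ ∞ (fieldInChart X p) (extChartAt 𝓘(ℝ, E) p p) := by
  have hO' := hO.inter (chartAt E p).open_source
  exact contDiffAt_of_contMDiffOn hO' ⟨hp, mem_chart_source E p⟩
    ((smoothFieldOn_iff hO' inter_subset_right X).1 (hX.mono inter_subset_left))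

theorem formInChart_eq (ξ : ∀ x : M, Cot E x) {p : M} {y : E}
    (hy : y ∈ (extChartAt 𝓘(ℝ, E) p).target) :
    formInChart ξ p y = (ξ ((extChartAt 𝓘(ℝ, E) p).symm y)).comp
      (ofCoord p ((extChartAt 𝓘(ℝ, E) p).symm y)) := by
  exact congrArg (ContinuousLinearMap.comp (ξ ((extChartAt 𝓘(ℝ, E) p).symm y)))
    (mfderiv_extChartAt_symm_eq hy)

theorem SmoothFormOn.contDiffAt_formInChart {ξ : ∀ x : M, Cot E x} {U : Set M}
    (hO : IsOpen U) (hξ : SmoothFormOn ξ U) {p : M} (hp : p ∈ U) :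
    ContDiffAt ℝ ∞ (formInChart ξ p) (extChartAt 𝓘(ℝ, E) p p) := by
  have hO' := hO.inter (chartAt E p).open_source
  refine (contDiffAt_of_contMDiffOn hO' ⟨hp, mem_chart_source E p⟩
    ((smoothFormOn_iff hO' inter_subset_right ξ).1
      (hξ.mono inter_subset_left))).congr_of_eventuallyEq ?_
  filter_upwards [extChartAt_target_mem_nhds p] with y hy
  exact formInChart_eq ξ hy

theorem formInChart_fieldInChart (ξ : ∀ x : M, Cot E x) (X : ∀ x : M, Tan E x) {p : M} {y : E}
    (hy : y ∈ (extChartAt 𝓘(ℝ, E) p).target) :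
    formInChart ξ p y (fieldInChart X p y) =
      ξ ((extChartAt 𝓘(ℝ, E) p).symm y) (X ((extChartAt 𝓘(ℝ, E) p).symm y)) := by
  have hs : (extChartAt 𝓘(ℝ, E) p).symm y ∈ (chartAt E p).source := by
    simpa using (extChartAt 𝓘(ℝ, E) p).map_target hy
  rw [formInChart_eq ξ hy]
  exact congrArg _ (ofCoord_toCoord hs _)

theorem fieldInChart_self (X : ∀ x : M, Tan E x) (p : M) :
    fieldInChart X p (extChartAt 𝓘(ℝ, E) p p) = X p := by
  rw [fieldInChart, extChartAt_to_inv, toCoord_self]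

theorem formInChart_self (ξ : ∀ x : M, Cot E x) (p : M) (v : Tan E p) :
    formInChart ξ p (extChartAt 𝓘(ℝ, E) p p) v = ξ p v := by
  rw [formInChart_eq ξ (mem_extChartAt_target p)]
  change ξ _ (ofCoord p _ v) = _
  rw [extChartAt_to_inv]
  exact congrArg (ξ p) (ofCoord_self (E := E) p v)

theorem extD_apply_eq (ξ : ∀ x : M, Cot E x) (p : M) (u v : Tan E p) :
    extD ξ p u v =
      (fderiv ℝ (formInChart ξ p) (extChartAt 𝓘(ℝ, E) p p) u : E →L[ℝ] ℝ) v -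
        (fderiv ℝ (formInChart ξ p) (extChartAt 𝓘(ℝ, E) p p) v : E →L[ℝ] ℝ) u := by
  let L : E →L[ℝ] E := mfderiv 𝓘(ℝ, E) 𝓘(ℝ, E) (extChartAt 𝓘(ℝ, E) p) p
  have hL : L = ContinuousLinearMap.id ℝ E := mfderiv_extChartAt_self
  change (fderiv ℝ (formInChart ξ p) (extChartAt 𝓘(ℝ, E) p p) (L u) : E →L[ℝ] ℝ) (L v) -
    (fderiv ℝ (formInChart ξ p) (extChartAt 𝓘(ℝ, E) p p) (L v) : E →L[ℝ] ℝ) (L u) = _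
  rw [hL]
  rfl

/-- The chart at `p` has identity derivative at `p`, and the pulled-back fields agree near the base
point with `fieldInChart`. So the bracket is the vector space bracket and can be compared with
`extD`, which is defined in the same chart. -/
theorem mlieBracket_eq_chart (X Y : ∀ x : M, Tan E x) (p : M) :
    VectorField.mlieBracket 𝓘(ℝ, E) X Y p =
      VectorField.lieBracket ℝ (fieldInChart X p) (fieldInChart Y p)
        (extChartAt 𝓘(ℝ, E) p p) := by
  have h : ∀ Z : ∀ x : M, Tan E x,
      (VectorField.mpullbackWithin 𝓘(ℝ, E) 𝓘(ℝ, E) (extChartAt 𝓘(ℝ, E) p).symm Z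
        (range 𝓘(ℝ, E)) : E → E) =ᶠ[𝓝 (extChartAt 𝓘(ℝ, E) p p)] fieldInChart Z p := by
    intro Z
    filter_upwards [extChartAt_target_mem_nhds p] with y hy
    have hs : (extChartAt 𝓘(ℝ, E) p).symm y ∈ (chartAt E p).source := by
      simpa using (extChartAt 𝓘(ℝ, E) p).map_target hy
    have hk := mfderiv_extChartAt_symm_eq hy
    rw [← mfderivWithin_univ, ← ModelWithCorners.range_eq_univ 𝓘(ℝ, E)] at hk
    let A : E →L[ℝ] Tan E ((extChartAt 𝓘(ℝ, E) p).symm y) :=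
      mfderivWithin 𝓘(ℝ, E) 𝓘(ℝ, E) (extChartAt 𝓘(ℝ, E) p).symm (range 𝓘(ℝ, E)) y
    have hA : A = ofCoord (E := E) p _ := hk
    have h1 : A.inverse (Z _) = toCoord p _ (Z ((extChartAt 𝓘(ℝ, E) p).symm y)) := by
      rw [hA, inverse_ofCoord hs]
    exact h1
  let L : E →L[ℝ] E := mfderiv 𝓘(ℝ, E) 𝓘(ℝ, E) (extChartAt 𝓘(ℝ, E) p) p
  have hL : L = ContinuousLinearMap.id ℝ E := mfderiv_extChartAt_self
  let V : E → E := VectorField.mpullbackWithin 𝓘(ℝ, E) 𝓘(ℝ, E) (extChartAt 𝓘(ℝ, E) p).symm X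
    (range 𝓘(ℝ, E))
  let W : E → E := VectorField.mpullbackWithin 𝓘(ℝ, E) 𝓘(ℝ, E) (extChartAt 𝓘(ℝ, E) p).symm Y
    (range 𝓘(ℝ, E))
  have h1 : VectorField.mlieBracket 𝓘(ℝ, E) X Y p =
      L.inverse (VectorField.lieBracketWithin ℝ V W
        ((extChartAt 𝓘(ℝ, E) p).symm ⁻¹' univ ∩ range 𝓘(ℝ, E)) (extChartAt 𝓘(ℝ, E) p p)) := rfl
  refine Eq.trans ?_ (Filter.EventuallyEq.lieBracket_vectorField_eq (h X) (h Y) :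
    VectorField.lieBracket ℝ V W _ = _)
  rw [h1, hL, ContinuousLinearMap.inverse_id, preimage_univ, univ_inter,
    ModelWithCorners.range_eq_univ, VectorField.lieBracketWithin_univ]
  rfl

/-- The invariant formula for the exterior derivative of a one-form. -/
theorem extD_apply {ξ : ∀ x : M, Cot E x} {X Y : ∀ x : M, Tan E x} {U : Set M} (hO : IsOpen U)
    (hξ : SmoothFormOn ξ U) (hX : SmoothFieldOn X U) (hY : SmoothFieldOn Y U) {p : M}
    (hp : p ∈ U) :
    extD ξ p (X p) (Y p) = mvfderiv 𝓘(ℝ, E) (fun x => ξ x (Y x)) p (X p) -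
      mvfderiv 𝓘(ℝ, E) (fun x => ξ x (X x)) p (Y p) -
      ξ p (VectorField.mlieBracket 𝓘(ℝ, E) X Y p) := by
  -- Product rule in the chart: the derivative of `ξ(Z)` splits into a derivative of `ξ` and one of
  -- `Z`. The derivatives of `X` and `Y` recombine into the Lie bracket.
  have key : ∀ Z : ∀ x : M, Tan E x, SmoothFieldOn Z U → ∀ v : Tan E p,
      mvfderiv 𝓘(ℝ, E) (fun x => ξ x (Z x)) p v =
      (fderiv ℝ (formInChart ξ p) (extChartAt 𝓘(ℝ, E) p p) v : E →L[ℝ] ℝ) (Z p) +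
      ξ p (fderiv ℝ (fieldInChart Z p) (extChartAt 𝓘(ℝ, E) p p) v : E) := by
    intro Z hZ v
    have hd := (hZ.contDiffAt_fieldInChart hO hp).differentiableAt (by simp)
    have hd' := (hξ.contDiffAt_formInChart hO hp).differentiableAt (by simp)
    rw [mvfderiv_eq_fderiv
      (((hξ.apply hZ).contMDiffAt (hO.mem_nhds hp)).mdifferentiableAt (by simp))]
    have he : (fun x => ξ x (Z x)) ∘ (extChartAt 𝓘(ℝ, E) p).symm
        =ᶠ[𝓝 (extChartAt 𝓘(ℝ, E) p p)] fun y => formInChart ξ p y (fieldInChart Z p y) := by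
      filter_upwards [extChartAt_target_mem_nhds p] with y hy
      exact (formInChart_fieldInChart ξ Z hy).symm
    rw [he.fderiv_eq, fderiv_clm_apply hd' hd]
    change formInChart ξ p _ _ + (fderiv ℝ (formInChart ξ p) _ v : E →L[ℝ] ℝ) _ = _
    rw [fieldInChart_self, add_comm]
    exact congrArg _ (formInChart_self ξ p _)
  rw [key Y hY, key X hX, mlieBracket_eq_chart, extD_apply_eq]
  have hb0 : VectorField.lieBracket ℝ (fieldInChart X p) (fieldInChart Y p)
        (extChartAt 𝓘(ℝ, E) p p) =
      (fderiv ℝ (fieldInChart Y p) (extChartAt 𝓘(ℝ, E) p p) (X p) : E) -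
      (fderiv ℝ (fieldInChart X p) (extChartAt 𝓘(ℝ, E) p p) (Y p) : E) := by
    rw [VectorField.lieBracket, fieldInChart_self, fieldInChart_self]
  have hb := (congrArg (ξ p) hb0).trans ((ξ p).map_sub _ _)
  rw [hb]
  ring

/-- In the chart the form `df` is the ordinary derivative of `f`, so this is the symmetry of second
derivatives. -/
theorem extD_mvfderiv {f : M → ℝ} {U : Set M} (hO : IsOpen U)
    (hf : ContMDiffOn 𝓘(ℝ, E) 𝓘(ℝ, ℝ) ∞ f U) {p : M} (hp : p ∈ U) (u v : Tan E p) :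
    extD (fun x => mvfderiv 𝓘(ℝ, E) f x) p u v = 0 := by
  have he : formInChart (fun x => mvfderiv 𝓘(ℝ, E) f x) p =ᶠ[𝓝 (extChartAt 𝓘(ℝ, E) p p)]
      fderiv ℝ (f ∘ (extChartAt 𝓘(ℝ, E) p).symm) := by
    filter_upwards [eventually_symm_mem hO hp] with y ⟨hy, hyU, hs⟩
    have h1 : MDifferentiableAt 𝓘(ℝ, E) 𝓘(ℝ, ℝ) f ((extChartAt 𝓘(ℝ, E) p).symm y) :=
      (hf.contMDiffAt (hO.mem_nhds hyU)).mdifferentiableAt (by simp)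
    have h2 : MDifferentiableAt 𝓘(ℝ, E) 𝓘(ℝ, E) (extChartAt 𝓘(ℝ, E) p).symm y :=
      ((contMDiffOn_extChartAt_symm (n := ∞) p).contMDiffAt
        ((isOpen_extChartAt_target p).mem_nhds hy)).mdifferentiableAt (by simp)
    have h3 := mfderiv_comp y h1 h2
    rw [mfderiv_eq_fderiv] at h3
    exact h3.symm
  rw [extD_apply_eq, he.fderiv_eq, sub_eq_zero]
  exact ((contDiffAt_of_contMDiffOn hO hp hf).isSymmSndFDerivAt
    (by simpa using ENat.LEInfty.out)).eq u v

/-- The Lie bracket of vector fields is the commutator of derivations. -/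
theorem mvfderiv_mlieBracket {f : M → ℝ} {X Y : ∀ x : M, Tan E x} {U : Set M} (hO : IsOpen U)
    (hf : ContMDiffOn 𝓘(ℝ, E) 𝓘(ℝ, ℝ) ∞ f U) (hX : SmoothFieldOn X U) (hY : SmoothFieldOn Y U)
    {p : M} (hp : p ∈ U) :
    mvfderiv 𝓘(ℝ, E) f p (VectorField.mlieBracket 𝓘(ℝ, E) X Y p) =
      mvfderiv 𝓘(ℝ, E) (fun x => mvfderiv 𝓘(ℝ, E) f x (Y x)) p (X p) -
      mvfderiv 𝓘(ℝ, E) (fun x => mvfderiv 𝓘(ℝ, E) f x (X x)) p (Y p) := by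
  -- The invariant formula for `ξ = df`; its left side is zero because `d ∘ d = 0`.
  have h := extD_apply hO (smoothFormOn_mvfderiv hO hf) hX hY hp
  rw [extD_mvfderiv hO hf hp] at h
  linarith

end Calculus
end
end DiracGeometry

namespace DiracGeometry

noncomputable section

/-! ### Orthogonals and maximal isotropic subspaces. -/

section LinearAlgebra

variable {E : Type*} [NormedAddCommGroup E] [NormedSpace ℝ E]
  {M : Type*} [TopologicalSpace M] [ChartedSpace E M]

theorem pairing_comm {x : M} (v w : GenTan E x) : pairing v w = pairing w v := by
  simp [pairing, add_comm]

/-- The symmetric pairing as a bilinear form. -/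
def pairingForm (x : M) : LinearMap.BilinForm ℝ (GenTan E x) :=
  LinearMap.mk₂ ℝ pairing (fun _ _ _ => by simp [pairing]; ring)
    (fun _ _ _ => by simp [pairing]; ring) (fun _ _ _ => by simp [pairing]; ring)
    (fun _ _ _ => by simp [pairing]; ring)

theorem pairingForm_apply {x : M} (v w : GenTan E x) : pairingForm x v w = pairing v w := rfl

theorem pairing_add_left {x : M} (u v w : GenTan E x) :
    pairing (u + v) w = pairing u w + pairing v w :=
  LinearMap.map_add₂ (pairingForm x) u v w

theorem pairing_add_right {x : M} (u v w : GenTan E x) :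
    pairing u (v + w) = pairing u v + pairing u w :=
  (pairingForm x u).map_add v w

theorem pairing_smul_left {x : M} (c : ℝ) (v w : GenTan E x) :
    pairing (c • v) w = c * pairing v w :=
  LinearMap.map_smul₂ (pairingForm x) c v w

theorem pairing_smul_right {x : M} (c : ℝ) (v w : GenTan E x) :
    pairing v (c • w) = c * pairing v w :=
  (pairingForm x v).map_smul c w

theorem pairingForm_isRefl (x : M) : (pairingForm (E := E) x).IsRefl := fun v w h => by
  rw [pairingForm_apply] at h ⊢
  rw [pairing_comm, h]

theorem orth_eq_orthogonal {x : M} (L : Submodule ℝ (GenTan E x)) :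
    orth L = (pairingForm x).orthogonal L := by
  ext v
  rw [LinearMap.BilinForm.mem_orthogonal_iff]
  refine forall₂_congr fun w _ => ?_
  rw [pairingForm_apply, pairing_comm]

theorem orth_anti {x : M} {L L' : Submodule ℝ (GenTan E x)} (h : L ≤ L') : orth L' ≤ orth L :=
  fun _ hv w hw => hv w (h hw)

theorem orth_sup {x : M} (L L' : Submodule ℝ (GenTan E x)) :
    orth (L ⊔ L') = orth L ⊓ orth L' := by
  refine le_antisymm (le_inf (orth_anti le_sup_left) (orth_anti le_sup_right)) ?_
  rintro v ⟨h1, h2⟩ w hw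
  obtain ⟨a, ha, b, hb, rfl⟩ := Submodule.mem_sup.1 hw
  rw [pairing_add_right, h1 a ha, h2 b hb, add_zero]

theorem isIsotropic_iff {x : M} {L : Submodule ℝ (GenTan E x)} : IsIsotropic L ↔ L ≤ orth L :=
  Iff.rfl

section FiniteDim
variable [FiniteDimensional ℝ E]

instance (x : M) : FiniteDimensional ℝ (TangentSpace 𝓘(ℝ, E) x) :=
  inferInstanceAs (FiniteDimensional ℝ E)

instance (x : M) : T2Space (TangentSpace 𝓘(ℝ, E) x) :=
  inferInstanceAs (T2Space E)

instance (x : M) : FiniteDimensional ℝ (TangentSpace 𝓘(ℝ, E) x →L[ℝ] ℝ) :=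
  inferInstanceAs (FiniteDimensional ℝ (E →L[ℝ] ℝ))

omit [FiniteDimensional ℝ E] in
theorem finrank_tan (x : M) : Module.finrank ℝ (Tan E x) = Module.finrank ℝ E := rfl

theorem finrank_cot (x : M) : Module.finrank ℝ (Cot E x) = Module.finrank ℝ E := by
  rw [← finrank_tan x, ← Subspace.dual_finrank_eq (K := ℝ) (V := Tan E x)]
  exact (LinearMap.toContinuousLinearMap (𝕜 := ℝ) (E := Tan E x) (F' := ℝ)).symm.finrank_eq

theorem finrank_genTan (x : M) :
    Module.finrank ℝ (GenTan E x) = 2 * Module.finrank ℝ E := by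
  rw [Module.finrank_prod, finrank_cot, finrank_tan, two_mul]

theorem exists_cot_ne_zero {x : M} {V : Submodule ℝ (Tan E x)} {v : Tan E x} (hv : v ∉ V) :
    ∃ ξ ∈ ann V, ξ v ≠ 0 := by
  obtain ⟨f, hf, hfV⟩ := Submodule.exists_le_ker_of_notMem hv
  exact ⟨LinearMap.toContinuousLinearMap f, fun w hw => hfV hw, hf⟩

theorem pairingForm_nondegenerate (x : M) : (pairingForm (E := E) x).Nondegenerate := by
  refine (LinearMap.IsRefl.nondegenerate_iff_separatingLeft (pairingForm_isRefl x)).2 ?_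
  intro v hv
  refine Prod.ext ?_ ?_
  · by_contra h
    obtain ⟨ξ, -, hξ⟩ := exists_cot_ne_zero (V := ⊥) (v := v.1) (by simpa using h)
    exact hξ (by simpa [pairingForm_apply, pairing] using hv (0, ξ))
  · ext w
    simpa [pairingForm_apply, pairing] using hv (w, 0)

theorem orth_orth {x : M} (L : Submodule ℝ (GenTan E x)) : orth (orth L) = L := by
  rw [orth_eq_orthogonal, orth_eq_orthogonal,
    LinearMap.BilinForm.orthogonal_orthogonal (pairingForm_nondegenerate x) (pairingForm_isRefl x)]

theorem finrank_orth {x : M} (L : Submodule ℝ (GenTan E x)) :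
    Module.finrank ℝ (orth L) = 2 * Module.finrank ℝ E - Module.finrank ℝ L := by
  rw [orth_eq_orthogonal, LinearMap.BilinForm.finrank_orthogonal (pairingForm_nondegenerate x),
    finrank_genTan]

theorem orth_inf {x : M} (L L' : Submodule ℝ (GenTan E x)) :
    orth (L ⊓ L') = orth L ⊔ orth L' := by
  rw [← orth_orth (orth L ⊔ orth L'), orth_sup, orth_orth, orth_orth]

/-- Source of the constant rank statements: to show that a family with L = L^⊥ is a subbundle, it
remains only to extend elements to smooth sections. -/
theorem finrank_of_orth_eq {x : M} {L : Submodule ℝ (GenTan E x)} (h : orth L = L) :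
    Module.finrank ℝ L = Module.finrank ℝ E := by
  have h1 := finrank_orth L
  have h2 := Submodule.finrank_le L
  rw [finrank_genTan] at h2
  rw [h] at h1
  omega

omit [FiniteDimensional ℝ E] in
theorem maximal_of_orth_eq {x : M} {L : Submodule ℝ (GenTan E x)} (h : orth L = L) :
    Maximal IsIsotropic L := by
  refine ⟨isIsotropic_iff.2 h.ge, fun L' hL' hle => ?_⟩
  calc L' ≤ orth L' := hL'
    _ ≤ orth L := orth_anti hle
    _ = L := h

/-- There is a linear map `T_x M → T*_x M` whose bilinear form is positive definite. -/
theorem exists_definite (x : M) : ∃ J : Tan E x →ₗ[ℝ] Cot E x, ∀ v, v ≠ 0 → 0 < J v v := by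
  let b := Module.finBasis ℝ (Tan E x)
  let φ : Fin (Module.finrank ℝ (Tan E x)) → Cot E x := fun i =>
    LinearMap.toContinuousLinearMap (b.coord i)
  refine ⟨∑ i, (b.coord i).smulRight (φ i), fun v hv => ?_⟩
  have h : (∑ i, (b.coord i).smulRight (φ i)) v v = ∑ i, b.coord i v * b.coord i v := by
    simp [φ, LinearMap.sum_apply]
  rw [h]
  refine lt_of_le_of_ne (Finset.sum_nonneg fun i _ => mul_self_nonneg _) fun h0 => hv ?_
  have h1 := (Finset.sum_eq_zero_iff_of_nonneg fun i _ => mul_self_nonneg (b.coord i v)).1 h0.symm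
  exact b.ext_elem fun i => by simpa using h1 i (Finset.mem_univ i)

/-- By maximality every null vector of L^⊥ lies in L, so the pairing is semidefinite on L^⊥. In
split signature (n, n) a semidefinite subspace has dimension at most n, whereas dim L + dim L^⊥ =
2n. -/
theorem orth_eq_of_maximal {x : M} {L : Submodule ℝ (GenTan E x)} (h : Maximal IsIsotropic L) :
    orth L = L := by
  have hL : L ≤ orth L := h.1
  -- null vectors of the orthogonal lie in `L`
  have key : ∀ v ∈ orth L, pairing v v = 0 → v ∈ L := by
    intro v hv h0
    have hiso : IsIsotropic (L ⊔ Submodule.span ℝ {v}) := by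
      intro a ha b hb
      obtain ⟨a1, ha1, a2, ha2, rfl⟩ := Submodule.mem_sup.1 ha
      obtain ⟨b1, hb1, b2, hb2, rfl⟩ := Submodule.mem_sup.1 hb
      obtain ⟨c, rfl⟩ := Submodule.mem_span_singleton.1 ha2
      obtain ⟨d, rfl⟩ := Submodule.mem_span_singleton.1 hb2
      have h1 := h.1 a1 ha1 b1 hb1
      have h2 := hv b1 hb1
      have h3 := hv a1 ha1
      rw [pairing_comm] at h3
      simp only [pairing_add_left, pairing_add_right, pairing_smul_left, pairing_smul_right,
        h1, h2, h3, h0, mul_zero, add_zero]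
    exact h.2 hiso le_sup_left (Submodule.mem_sup_right (Submodule.mem_span_singleton_self v))
  -- the pairing is semidefinite on the orthogonal
  have hdef : (∀ v ∈ orth L, 0 ≤ pairing v v) ∨ (∀ v ∈ orth L, pairing v v ≤ 0) := by
    by_contra hcon
    push Not at hcon
    obtain ⟨⟨v, hv, hv0⟩, w, hw, hw0⟩ := hcon
    -- a null vector `v + t w`
    set a := pairing w w with ha
    set b := pairing v w with hb
    set c := pairing v v with hc
    have hdisc : 0 ≤ b ^ 2 - a * c := by nlinarith
    set t := (-b + Real.sqrt (b ^ 2 - a * c)) / a with ht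
    have hroot : a * t ^ 2 + 2 * b * t + c = 0 := by
      have hs := Real.sq_sqrt hdisc
      have ha0 : a ≠ 0 := hw0.ne'
      rw [ht]
      field_simp
      nlinarith
    have hnull : pairing (v + t • w) (v + t • w) = 0 := by
      simp only [pairing_add_left, pairing_add_right, pairing_smul_left, pairing_smul_right]
      rw [pairing_comm w v]
      linarith
    have hmem := key _ ((orth L).add_mem hv ((orth L).smul_mem t hw)) hnull
    -- `v` and `w` are orthogonal to L, which contains `v + t • w`. The two equations give `c = t² a
    -- ≥ 0`, against `c < 0`.
    have e1 := hv _ hmem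
    have e2 := hw _ hmem
    simp only [pairing_add_right, pairing_smul_right] at e1 e2
    rw [pairing_comm w v] at e2
    rw [← hb, ← hc] at e1
    rw [← hb, ← ha] at e2
    have hb' : b = -(t * a) := by linarith
    have : c = t ^ 2 * a := by rw [hb'] at e1; nlinarith
    nlinarith [mul_nonneg (sq_nonneg t) hw0.le]
  -- The graph of `-ε J` is an n-dimensional subspace on which `ε` times the pairing is negative
  -- definite. A subspace on which that form is nonnegative meets it trivially, so the map `g` with
  -- this kernel embeds it in T*M.
  obtain ⟨J, hJ⟩ := exists_definite (E := E) x
  have hdim : Module.finrank ℝ (orth L) ≤ Module.finrank ℝ E := by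
    have hinj : ∀ ε : ℝ, ε * ε = 1 → (∀ v ∈ orth L, 0 ≤ ε * pairing v v) →
        Module.finrank ℝ (orth L) ≤ Module.finrank ℝ E := by
      intro ε hε hpos
      let g : GenTan E x →ₗ[ℝ] Cot E x :=
        LinearMap.snd ℝ (Tan E x) (Cot E x) + ε • J.comp (LinearMap.fst ℝ (Tan E x) (Cot E x))
      have hg : Function.Injective (g.comp (orth L).subtype) := by
        refine (injective_iff_map_eq_zero _).2 ?_
        rintro ⟨v, hv⟩ h0
        have h0' : v.2 = -(ε • J v.1) := by
          have : v.2 + ε • J v.1 = 0 := h0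
          exact eq_neg_of_add_eq_zero_left this
        have hp := hpos v hv
        have hv1 : v.1 = 0 := by
          by_contra hne
          have := hJ _ hne
          simp only [pairing, h0', neg_apply, smul_apply,
            smul_eq_mul] at hp
          nlinarith
        have hv2 : v.2 = 0 := by rw [h0', hv1]; simp
        exact Subtype.ext (Prod.ext hv1 hv2)
      have := LinearMap.finrank_le_finrank_of_injective hg
      rwa [finrank_cot] at this
    rcases hdef with h1 | h1
    · exact hinj 1 (by norm_num) fun v hv => by simpa using h1 v hv
    · exact hinj (-1) (by norm_num) fun v hv => by simpa using h1 v hv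
  refine (Submodule.eq_of_le_of_finrank_le hL ?_).symm
  have h1 := finrank_orth L
  omega

theorem maximal_iff_orth_eq {x : M} {L : Submodule ℝ (GenTan E x)} :
    Maximal IsIsotropic L ↔ orth L = L := ⟨orth_eq_of_maximal, maximal_of_orth_eq⟩

/-- A functional on `K` which vanishes on `B⁻¹ D` is represented by an element of `D`. -/
theorem exists_pairing_eq {K : Type*} [AddCommGroup K] [Module ℝ K] [FiniteDimensional ℝ K]
    {x : M} {D : Submodule ℝ (GenTan E x)} (hD : orth D = D) (B : K →ₗ[ℝ] GenTan E x)
    (l : K →ₗ[ℝ] ℝ) (hl : ∀ k, B k ∈ D → l k = 0) :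
    ∃ d ∈ D, ∀ k, l k = pairing d (B k) := by
  let T : GenTan E x →ₗ[ℝ] Module.Dual ℝ K := LinearMap.compl₁₂ (pairingForm x) LinearMap.id B
  -- Biduality: a functional lies in the image of `D` if it kills every `k` on which that image
  -- vanishes. For such `k`, `B k` is orthogonal to `D`, hence in `D`.
  have h : l ∈ (D.map T).dualCoannihilator.dualAnnihilator := by
    rw [Submodule.mem_dualAnnihilator]
    intro k hk
    refine hl k ?_
    rw [← hD]
    intro d hd
    rw [Submodule.mem_dualCoannihilator] at hk
    rw [pairing_comm]
    exact hk (T d) (Submodule.mem_map_of_mem hd)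
  rw [Subspace.dualCoannihilator_dualAnnihilator_eq] at h
  obtain ⟨d, hd, rfl⟩ := h
  exact ⟨d, hd, fun k => rfl⟩

end FiniteDim
end LinearAlgebra
end
end DiracGeometry

namespace DiracGeometry

noncomputable section

/-! ### The subspaces D^S pointwise, and graphs. -/

section Induced

variable {E : Type*} [NormedAddCommGroup E] [NormedSpace ℝ E]
  {M : Type*} [TopologicalSpace M] [ChartedSpace E M]

theorem mem_tanPart {x : M} {V : Submodule ℝ (Tan E x)} {v : GenTan E x} :
    v ∈ tanPart V ↔ v.1 ∈ V ∧ v.2 = 0 := by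
  simp [tanPart, Submodule.mem_prod]

theorem mem_annPart {x : M} {V : Submodule ℝ (Tan E x)} {v : GenTan E x} :
    v ∈ annPart V ↔ v.1 = 0 ∧ v.2 ∈ ann V := by
  simp [annPart, Submodule.mem_prod]

theorem mem_orth_tanPart {x : M} {V : Submodule ℝ (Tan E x)} {v : GenTan E x} :
    v ∈ orth (tanPart V) ↔ v.2 ∈ ann V := by
  constructor
  · intro h u hu
    simpa [pairing] using h (u, 0) (mem_tanPart.2 ⟨hu, rfl⟩)
  · intro h w hw
    obtain ⟨h1, h2⟩ := mem_tanPart.1 hw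
    simp [pairing, h2, h w.1 h1]

theorem isIsotropic_tanPart {x : M} (V : Submodule ℝ (Tan E x)) : IsIsotropic (tanPart V) := by
  intro v hv
  rw [mem_tanPart] at hv
  exact mem_orth_tanPart.2 (by rw [hv.2]; exact (ann V).zero_mem)

theorem le_induced (D S : ∀ x : M, Submodule ℝ (GenTan E x)) (x : M) : S x ≤ induced D S x :=
  le_sup_right

/-- The modular law, applicable because S ⊂ S^⊥. The second form shows at once which half of each
element is constrained. -/
theorem induced_eq (D : ∀ x : M, Submodule ℝ (GenTan E x)) {S : ∀ x : M, Submodule ℝ (GenTan E x)}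
    {x : M} (hS : IsIsotropic (S x)) : induced D S x = (D x ⊔ S x) ⊓ orth (S x) := by
  rw [induced, sup_comm (D x ⊓ _), sup_comm (D x), sup_inf_assoc_of_le _ (isIsotropic_iff.1 hS)]

/-- Evaluation of covectors at a tangent vector. -/
def evalAt {x : M} (v : Tan E x) : Cot E x →ₗ[ℝ] ℝ where
  toFun ξ := ξ v
  map_add' _ _ := rfl
  map_smul' _ _ := rfl

variable [FiniteDimensional ℝ E]

theorem mem_of_forall_ann {x : M} {V : Submodule ℝ (Tan E x)} {v : Tan E x}
    (h : ∀ ξ ∈ ann V, ξ v = 0) : v ∈ V := by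
  by_contra hv
  obtain ⟨ξ, hξ, h0⟩ := exists_cot_ne_zero hv
  exact h0 (h ξ hξ)

theorem mem_orth_annPart {x : M} {V : Submodule ℝ (Tan E x)} {v : GenTan E x} :
    v ∈ orth (annPart V) ↔ v.1 ∈ V := by
  constructor
  · intro h
    refine mem_of_forall_ann fun ξ hξ => ?_
    simpa [pairing] using h (0, ξ) (mem_annPart.2 ⟨rfl, hξ⟩)
  · intro h w hw
    obtain ⟨h1, h2⟩ := mem_annPart.1 hw
    simp [pairing, h1, h2 v.1 h]

theorem isIsotropic_annPart {x : M} (V : Submodule ℝ (Tan E x)) : IsIsotropic (annPart V) := by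
  intro v hv
  rw [mem_annPart] at hv
  exact mem_orth_annPart.2 (by rw [hv.1]; exact V.zero_mem)

/-- The orthogonal of (D ∩ S^⊥) + S is (D + S) ∩ S^⊥, which is the same space by the modular law. -/
theorem orth_induced {D S : ∀ x : M, Submodule ℝ (GenTan E x)} {x : M} (hD : orth (D x) = D x)
    (hS : IsIsotropic (S x)) : orth (induced D S x) = induced D S x := by
  conv_rhs => rw [induced_eq D hS]
  rw [induced, orth_sup, orth_inf, orth_orth, hD]

theorem fst_mem_of_mem_induced {D : ∀ x : M, Submodule ℝ (GenTan E x)}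
    {Φ : ∀ x : M, Submodule ℝ (Tan E x)} {x : M} {v : GenTan E x}
    (hv : v ∈ induced D (fun x => annPart (Φ x)) x) : v.1 ∈ Φ x := by
  rw [induced_eq D (isIsotropic_annPart (Φ x))] at hv
  exact mem_orth_annPart.1 hv.2

omit [FiniteDimensional ℝ E] in
theorem snd_mem_of_mem_induced {D : ∀ x : M, Submodule ℝ (GenTan E x)}
    {S : ∀ x : M, Submodule ℝ (Tan E x)} {x : M} {v : GenTan E x}
    (hv : v ∈ induced D (fun x => tanPart (S x)) x) : v.2 ∈ ann (S x) := by
  rw [induced_eq D (isIsotropic_tanPart (S x))] at hv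
  exact mem_orth_tanPart.1 hv.2

/-- In (D + Φ⁰) ∩ (Φ⁰)^⊥ the second factor only asks the vector component to lie in Φ. -/
theorem induced_inf_tanPart (D : ∀ x : M, Submodule ℝ (GenTan E x))
    (Φ : ∀ x : M, Submodule ℝ (Tan E x)) (x : M) :
    induced D (fun x => annPart (Φ x)) x ⊓ tanPart ⊤ =
      (D x ⊔ annPart (Φ x)) ⊓ tanPart (Φ x) := by
  rw [induced_eq D (isIsotropic_annPart (Φ x))]
  ext v
  simp only [Submodule.mem_inf, mem_orth_annPart, mem_tanPart, Submodule.mem_top, true_and]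
  tauto

/-- A Lagrangian subspace which meets the tangent space trivially is a graph. -/
theorem exists_graph {x : M} {L : Submodule ℝ (GenTan E x)} (hL : orth L = L)
    (h : L ⊓ tanPart ⊤ = ⊥) :
    ∃ P : Cot E x →ₗ[ℝ] Tan E x, ∀ v : GenTan E x, v ∈ L ↔ v.1 = P v.2 := by
  let g : L →ₗ[ℝ] Cot E x := (LinearMap.snd ℝ (Tan E x) (Cot E x)).comp L.subtype
  have hg : Function.Injective g := by
    refine (injective_iff_map_eq_zero _).2 ?_
    rintro ⟨v, hv⟩ h0
    have : v ∈ L ⊓ tanPart ⊤ := ⟨hv, mem_tanPart.2 ⟨trivial, h0⟩⟩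
    rw [h] at this
    exact Subtype.ext ((Submodule.mem_bot ℝ).1 this)
  have hdim : Module.finrank ℝ L = Module.finrank ℝ (Cot E x) := by
    rw [finrank_of_orth_eq hL, finrank_cot]
  let e := LinearEquiv.ofBijective g
    ⟨hg, LinearMap.range_eq_top.1 (Submodule.eq_top_of_finrank_eq
      ((LinearMap.finrank_range_of_inj hg).trans hdim))⟩
  have he : ∀ v : L, e v = v.1.2 := fun v => rfl
  refine ⟨(LinearMap.fst ℝ (Tan E x) (Cot E x)).comp (L.subtype.comp e.symm.toLinearMap),
    fun v => ⟨fun hv => ?_, fun hv => ?_⟩⟩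
  · have : e.symm v.2 = ⟨v, hv⟩ := by rw [LinearEquiv.symm_apply_eq, he]
    change v.1 = (e.symm v.2).1.1
    rw [this]
  · have h1 : (e.symm v.2).1 = v := by
      refine Prod.ext hv.symm ?_
      rw [← he, LinearEquiv.apply_symm_apply]
    rw [← h1]
    exact (e.symm v.2).2

omit [FiniteDimensional ℝ E] in
theorem inf_tanPart_eq_bot_iff {x : M} {L : Submodule ℝ (GenTan E x)} :
    L ⊓ tanPart ⊤ = ⊥ ↔ ∀ X : Tan E x, ((X, 0) : GenTan E x) ∈ L → X = 0 := by
  rw [Submodule.eq_bot_iff]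
  constructor
  · intro h X hX
    exact congrArg Prod.fst (h (X, 0) ⟨hX, mem_tanPart.2 ⟨trivial, rfl⟩⟩)
  · rintro h ⟨X, ξ⟩ ⟨h1, h2⟩
    obtain ⟨-, h2 : ξ = 0⟩ := mem_tanPart.1 h2
    subst h2
    rw [h X h1]
    rfl

omit [FiniteDimensional ℝ E] in
theorem IsGraph.inf_tanPart {D : ∀ x : M, Submodule ℝ (GenTan E x)}
    {P : ∀ x : M, Cot E x →ₗ[ℝ] Tan E x} (h : IsGraph D P) (x : M) : D x ⊓ tanPart ⊤ = ⊥ := by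
  rw [inf_tanPart_eq_bot_iff]
  intro X hX
  simpa using (h x _).1 hX

end Induced

/-! ### Pullback and pushforward by a linear map preserve L = L^⊥. -/

section Relations

variable {E : Type*} [NormedAddCommGroup E] [NormedSpace ℝ E] [FiniteDimensional ℝ E]
  {M : Type*} [TopologicalSpace M] [ChartedSpace E M]
  {F : Type*} [NormedAddCommGroup F] [NormedSpace ℝ F] [FiniteDimensional ℝ F]
  {N : Type*} [TopologicalSpace N] [ChartedSpace F N]

omit [FiniteDimensional ℝ E] [FiniteDimensional ℝ F] in
theorem mem_pullback {f : N → M} {D : ∀ x : M, Submodule ℝ (GenTan E x)} {y : N}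
    {w : GenTan F y} : w ∈ pullback f D y ↔ ∃ ξ : Cot E (f y),
      ((tanMap E F f y w.1, ξ) : GenTan E (f y)) ∈ D (f y) ∧ w.2 = ξ.comp (tanMap E F f y) :=
  Iff.rfl

/-- For `w` in the orthogonal, the functional `(u, η) ↦ w.2 u + η (f_* w.1)` kills the pairs whose
image lies in `D`, so an element `d` of `D` represents it. Testing on each factor gives `d.1 = f_*
w.1` and `f^* d.2 = w.2`, with no condition on the rank of `f_*`. -/
theorem orth_pullback (f : N → M) {D : ∀ x : M, Submodule ℝ (GenTan E x)} {y : N}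
    (hD : orth (D (f y)) = D (f y)) : orth (pullback f D y) = pullback (F := F) f D y := by
  refine le_antisymm ?_ ?_
  · intro w hw
    let B : (Tan F y × Cot E (f y)) →ₗ[ℝ] GenTan E (f y) :=
      (tanMap E F f y).toLinearMap.prodMap LinearMap.id
    let l : (Tan F y × Cot E (f y)) →ₗ[ℝ] ℝ :=
      w.2.toLinearMap.comp (LinearMap.fst ℝ _ _) +
        (evalAt (tanMap E F f y w.1)).comp (LinearMap.snd ℝ _ _)
    obtain ⟨d, hd, hl⟩ := exists_pairing_eq hD B l fun k hk => by
      have := hw (k.1, k.2.comp (tanMap E F f y)) ⟨k.2, hk, rfl⟩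
      simp only [pairing, ContinuousLinearMap.comp_apply] at this
      change w.2 k.1 + k.2 (tanMap E F f y w.1) = 0
      rw [add_comm]
      exact this
    have h1 : tanMap E F f y w.1 = d.1 := by
      by_contra hne
      obtain ⟨ξ, -, hξ⟩ := exists_cot_ne_zero (V := (⊥ : Submodule ℝ (Tan E (f y))))
        (v := tanMap E F f y w.1 - d.1) (by simpa [sub_eq_zero] using hne)
      have := hl (0, ξ)
      change w.2 0 + ξ (tanMap E F f y w.1) = ξ d.1 + d.2 (tanMap E F f y 0) at this
      rw [map_zero, map_zero, map_zero, zero_add, add_zero] at this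
      exact hξ (by rw [map_sub, this, sub_self])
    refine ⟨d.2, by rw [h1]; exact hd, ?_⟩
    ext u
    have := hl (u, 0)
    change w.2 u + 0 = 0 + d.2 (tanMap E F f y u) at this
    simpa using this
  · rintro v ⟨ξ, h1, h2⟩ w ⟨η, h3, h4⟩
    have := hD.ge h1 _ h3
    simp only [pairing] at this ⊢
    rw [h2, h4]
    exact this

/-- The argument for pullbacks with the roles of vectors and covectors exchanged. -/
theorem orth_pushforwardAt (τ : N → M) {D : ∀ y : N, Submodule ℝ (GenTan F y)} {y : N}
    (hD : orth (D y) = D y) : orth (pushforwardAt τ D y) = pushforwardAt (E := E) τ D y := by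
  refine le_antisymm ?_ ?_
  · intro w hw
    let B : (Tan F y × Cot E (τ y)) →ₗ[ℝ] GenTan F y :=
      LinearMap.id.prodMap (ContinuousLinearMap.precomp ℝ (tanMap E F τ y)).toLinearMap
    let l : (Tan F y × Cot E (τ y)) →ₗ[ℝ] ℝ :=
      (w.2.comp (tanMap E F τ y)).toLinearMap.comp (LinearMap.fst ℝ _ _) +
        (evalAt w.1).comp (LinearMap.snd ℝ _ _)
    obtain ⟨d, hd, hl⟩ := exists_pairing_eq hD B l fun k hk => by
      have := hw (tanMap E F τ y k.1, k.2) ⟨k.1, hk, rfl⟩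
      simp only [pairing] at this
      change w.2 (tanMap E F τ y k.1) + k.2 w.1 = 0
      rw [add_comm]
      exact this
    have h1 : w.1 = tanMap E F τ y d.1 := by
      by_contra hne
      obtain ⟨ξ, -, hξ⟩ := exists_cot_ne_zero (V := (⊥ : Submodule ℝ (Tan E (τ y))))
        (v := w.1 - tanMap E F τ y d.1) (by simpa [sub_eq_zero] using hne)
      have := hl (0, ξ)
      change w.2 (tanMap E F τ y 0) + ξ w.1 = ξ (tanMap E F τ y d.1) + d.2 0 at this
      rw [map_zero, map_zero, map_zero, zero_add, add_zero] at this
      exact hξ (by rw [map_sub, this, sub_self])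
    have h2 : w.2.comp (tanMap E F τ y) = d.2 := by
      ext u
      have := hl (u, 0)
      change w.2 (tanMap E F τ y u) + 0 = 0 + d.2 u at this
      simpa using this
    exact ⟨d.1, by rw [h2]; exact hd, h1⟩
  · rintro v ⟨X, h1, h2⟩ w ⟨Y, h3, h4⟩
    have := hD.ge h1 _ h3
    simp only [pairing] at this ⊢
    rw [h2, h4]
    exact this

end Relations
end
end DiracGeometry

namespace DiracGeometry

noncomputable section

/-! ### Smooth solutions of linear equations at points of maximal rank. -/

section GeneralizedInverse

variable {E : Type*} [NormedAddCommGroup E] [NormedSpace ℝ E]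
  {M : Type*} [TopologicalSpace M] [ChartedSpace E M]
  {V : Type*} [NormedAddCommGroup V] [NormedSpace ℝ V] [FiniteDimensional ℝ V]
  {W : Type*} [NormedAddCommGroup W] [NormedSpace ℝ W] [FiniteDimensional ℝ W]

/-- Near a point of maximal rank, a smooth family of linear maps has a smooth generalized
inverse. -/
theorem exists_generalizedInverse {A : M → V →L[ℝ] W} {O : Set M} (hO : IsOpen O)
    (hA : ContMDiffOn 𝓘(ℝ, E) 𝓘(ℝ, V →L[ℝ] W) ∞ A O) {x₀ : M} (hx₀ : x₀ ∈ O)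
    (hmax : ∀ x ∈ O, Module.finrank ℝ (LinearMap.range (A x).toLinearMap) ≤
      Module.finrank ℝ (LinearMap.range (A x₀).toLinearMap)) :
    ∃ O' ⊆ O, IsOpen O' ∧ x₀ ∈ O' ∧ ∃ G : M → W →L[ℝ] V,
      ContMDiffOn 𝓘(ℝ, E) 𝓘(ℝ, W →L[ℝ] V) ∞ G O' ∧
        ∀ x ∈ O', ∀ v, A x (G x (A x v)) = A x v := by
  let R := LinearMap.range (A x₀).toLinearMap
  obtain ⟨ι₀, hι₀⟩ := (A x₀).toLinearMap.rangeRestrict.exists_rightInverse_of_surjective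
    (LinearMap.range_rangeRestrict _)
  obtain ⟨pr₀, hpr₀⟩ := R.subtype.exists_leftInverse_of_injective (Submodule.ker_subtype R)
  let ι : R →L[ℝ] V := LinearMap.toContinuousLinearMap ι₀
  let pr : W →L[ℝ] R := LinearMap.toContinuousLinearMap pr₀
  -- `A x` compressed to the range of `A x₀`. It is the identity at `x₀`, hence invertible nearby,
  -- and `ι B⁻¹ pr` is the generalized inverse.
  let B : M → R →L[ℝ] R := fun x => (pr.comp (A x)).comp ι
  have hB0 : B x₀ = 1 := by
    ext r
    have h1 : A x₀ (ι r) = r := congrArg Subtype.val (LinearMap.congr_fun hι₀ r)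
    have h2 : pr (r : W) = r := LinearMap.congr_fun hpr₀ r
    change ((pr (A x₀ (ι r)) : R) : W) = r
    rw [h1, h2]
  have hB : ContMDiffOn 𝓘(ℝ, E) 𝓘(ℝ, R →L[ℝ] R) ∞ B O :=
    (contMDiffOn_const.clm_comp hA).clm_comp contMDiffOn_const
  let O' := O ∩ B ⁻¹' {u | IsUnit u}
  have hO' : IsOpen O' := hB.continuousOn.isOpen_inter_preimage hO (Units.isOpen (R := R →L[ℝ] R))
  refine ⟨O', inter_subset_left, hO', ⟨hx₀, ?_⟩,
    fun x => (ι.comp (Ring.inverse (B x))).comp pr, ?_, ?_⟩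
  · rw [mem_preimage, hB0]
    exact isUnit_one
  · refine (contMDiffOn_const.clm_comp ?_).clm_comp contMDiffOn_const
    rintro x ⟨hx, u, hu⟩
    have hi : ContDiffAt ℝ ∞ Ring.inverse (B x) := by
      rw [← hu]
      exact contDiffAt_ringInverse ℝ (R := R →L[ℝ] R) u
    exact (hi.comp_contMDiffAt (hB.contMDiffAt (hO.mem_nhds hx))).contMDiffWithinAt
  · rintro x ⟨hx, hu⟩ v
    have hinv : ∀ r, Ring.inverse (B x) (B x r) = r := fun r => by
      have := Ring.inverse_mul_cancel _ hu
      exact DFunLike.congr_fun this r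
    have hinj : Function.Injective ((A x).toLinearMap.comp ι.toLinearMap) := by
      intro r s hrs
      rw [← hinv r, ← hinv s]
      exact congrArg (fun w => Ring.inverse (B x) (pr w)) hrs
    -- Since `A x ∘ ι` is injective, its range already has the dimension of `R`. The rank of `A x`
    -- is no larger, so the two ranges agree.
    have hle : LinearMap.range ((A x).toLinearMap.comp ι.toLinearMap) ≤
        LinearMap.range (A x).toLinearMap := LinearMap.range_comp_le_range _ _
    have heq := Submodule.eq_of_le_of_finrank_le hle (by
      rw [LinearMap.finrank_range_of_inj hinj]
      exact hmax x hx)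
    have hv : A x v ∈ LinearMap.range ((A x).toLinearMap.comp ι.toLinearMap) := by
      rw [heq]
      exact ⟨v, rfl⟩
    obtain ⟨r, hr⟩ := hv
    have hr' : A x (ι r) = A x v := hr
    rw [← hr']
    change A x (ι (Ring.inverse (B x) (B x r))) = _
    rw [hinv]

/-- The linear map `c ↦ ∑ cᵢ σᵢ`. -/
def combo {ι : Type*} [Fintype ι] (σ : ι → W) : (ι → ℝ) →L[ℝ] W :=
  ∑ i, (ContinuousLinearMap.proj (R := ℝ) (φ := fun _ : ι => ℝ) i).smulRight (σ i)

omit [FiniteDimensional ℝ W] in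
theorem combo_apply {ι : Type*} [Fintype ι] (σ : ι → W) (c : ι → ℝ) :
    combo σ c = ∑ i, c i • σ i := by
  simp [combo]

omit [FiniteDimensional ℝ W] in
theorem range_combo {ι : Type*} [Fintype ι] (σ : ι → W) :
    LinearMap.range (combo σ).toLinearMap = Submodule.span ℝ (range σ) := by
  ext w
  rw [Submodule.mem_span_range_iff_exists_fun]
  refine exists_congr fun c => ?_
  rw [← combo_apply]
  rfl

omit [FiniteDimensional ℝ W] in
theorem contMDiffOn_combo {ι : Type*} [Fintype ι] {σ : ι → M → W} {O : Set M}
    (hσ : ∀ i, ContMDiffOn 𝓘(ℝ, E) 𝓘(ℝ, W) ∞ (σ i) O) :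
    ContMDiffOn 𝓘(ℝ, E) 𝓘(ℝ, (ι → ℝ) →L[ℝ] W) ∞ (fun x => combo fun i => σ i x) O := by
  unfold combo
  refine contMDiffOn_finsetSum fun i _ => ?_
  exact ((ContinuousLinearMap.smulRightL ℝ (ι → ℝ) W
    (ContinuousLinearMap.proj (R := ℝ) (φ := fun _ : ι => ℝ)
      i)).contDiff.contMDiff).comp_contMDiffOn
    (hσ i)

/-- A function valued in `W` which is a pointwise combination of smooth functions `σᵢ` is a smooth
combination of them, near a point where the rank is maximal. -/
theorem exists_smooth_coeff {ι : Type*} [Fintype ι] {σ : ι → M → W} {O : Set M}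
    (hO : IsOpen O) (hσ : ∀ i, ContMDiffOn 𝓘(ℝ, E) 𝓘(ℝ, W) ∞ (σ i) O) {x₀ : M} (hx₀ : x₀ ∈ O)
    (hmax : ∀ x ∈ O, Module.finrank ℝ (Submodule.span ℝ (range fun i => σ i x)) ≤
      Module.finrank ℝ (Submodule.span ℝ (range fun i => σ i x₀))) :
    ∃ O' ⊆ O, IsOpen O' ∧ x₀ ∈ O' ∧ ∃ G : M → W →L[ℝ] (ι → ℝ),
      ContMDiffOn 𝓘(ℝ, E) 𝓘(ℝ, W →L[ℝ] (ι → ℝ)) ∞ G O' ∧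
        ∀ x ∈ O', ∀ w ∈ Submodule.span ℝ (range fun i => σ i x), ∑ i, G x w i • σ i x = w := by
  obtain ⟨O', hsub, hO', hx, G, hG, h⟩ := exists_generalizedInverse hO (contMDiffOn_combo hσ) hx₀
    (fun x hx => by rw [range_combo, range_combo]; exact hmax x hx)
  refine ⟨O', hsub, hO', hx, G, hG, fun x hx w hw => ?_⟩
  rw [← range_combo] at hw
  obtain ⟨c, rfl⟩ := hw
  rw [← combo_apply]
  exact h x hx c

/-- The rank of a smooth family need not be locally constant, but every nonempty open set contains a
point of maximal rank on it. This supplies the dense set on which the closure arguments run. -/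
theorem exists_max_on {X : Type*} (f : X → ℕ) {b : ℕ} (hb : ∀ x, f x ≤ b) {O : Set X}
    (hne : O.Nonempty) : ∃ x₀ ∈ O, ∀ x ∈ O, f x ≤ f x₀ := by
  obtain ⟨x₀, hx₀, h⟩ := Nat.sSup_mem (hne.image f) ⟨b, by
    rintro _ ⟨x, -, rfl⟩
    exact hb x⟩
  exact ⟨x₀, hx₀, fun x hx => h ▸ le_csSup ⟨b, by
    rintro _ ⟨x, -, rfl⟩
    exact hb x⟩ ⟨x, hx, rfl⟩⟩

end GeneralizedInverse

/-! ### Smooth coefficients for sections of TM ⊕ T*M. -/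

section Sections

variable {E : Type*} [NormedAddCommGroup E] [NormedSpace ℝ E]
  {M : Type*} [TopologicalSpace M] [ChartedSpace E M] [IsManifold 𝓘(ℝ, E) ∞ M]

/-- The trivialization of `TM ⊕ T*M` over the chart at `p`. -/
def genCoord (p x : M) : GenTan E x →ₗ[ℝ] E × (E →L[ℝ] ℝ) :=
  (toCoord p x).toLinearMap.prodMap
    { toFun := fun ξ => ξ.comp (ofCoord p x)
      map_add' := fun _ _ => rfl
      map_smul' := fun _ _ => rfl }

theorem genCoord_apply (p x : M) (v : GenTan E x) :
    genCoord p x v = (toCoord p x v.1, v.2.comp (ofCoord p x)) := rfl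

theorem genCoord_injective {p x : M} (hx : x ∈ (chartAt E p).source) :
    Function.Injective (genCoord (E := E) p x) := by
  refine (injective_iff_map_eq_zero _).2 fun v hv => ?_
  rw [genCoord_apply, Prod.mk_eq_zero] at hv
  refine Prod.ext ?_ ?_
  · rw [← ofCoord_toCoord hx v.1, hv.1]
    simp
  · ext w
    rw [← ofCoord_toCoord hx w]
    exact DFunLike.congr_fun hv.2 _

theorem smoothGenOn_iff {p : M} {U : Set M} (hO : IsOpen U) (hU : U ⊆ (chartAt E p).source)
    (σ : ∀ x : M, GenTan E x) :
    SmoothGenOn σ U ↔ ContMDiffOn 𝓘(ℝ, E) 𝓘(ℝ, E × (E →L[ℝ] ℝ)) ∞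
      (fun x => genCoord p x (σ x)) U := by
  rw [SmoothGenOn, smoothFieldOn_iff hO hU, smoothFormOn_iff hO hU]
  exact contMDiffOn_prod_module_iff (fun x => genCoord p x (σ x)) |>.symm

variable [FiniteDimensional ℝ E]

/-- The neighbourhood is fixed before the section `τ`, so one choice serves several sections at
once. The generators may be dependent, and the coefficients then are not unique. -/
theorem exists_smooth_coeff_gen {ι : Type*} [Fintype ι] {σ : ι → ∀ x : M, GenTan E x} {O : Set M}
    (hO : IsOpen O) (hσ : ∀ i, SmoothGenOn (σ i) O) {x₀ : M} (hx₀ : x₀ ∈ O)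
    (hmax : ∀ x ∈ O, Module.finrank ℝ (Submodule.span ℝ (range fun i => σ i x)) ≤
      Module.finrank ℝ (Submodule.span ℝ (range fun i => σ i x₀))) :
    ∃ O' ⊆ O, IsOpen O' ∧ x₀ ∈ O' ∧ ∀ τ : ∀ x : M, GenTan E x, SmoothGenOn τ O' →
      (∀ x ∈ O', τ x ∈ Submodule.span ℝ (range fun i => σ i x)) →
      ∃ c : ι → M → ℝ, (∀ i, ContMDiffOn 𝓘(ℝ, E) 𝓘(ℝ, ℝ) ∞ (c i) O') ∧
        ∀ x ∈ O', τ x = ∑ i, c i x • σ i x := by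
  have hO1 := hO.inter (chartAt E x₀).open_source
  have hspan : ∀ x, Submodule.span ℝ (range fun i => genCoord x₀ x (σ i x)) =
      (Submodule.span ℝ (range fun i => σ i x)).map (genCoord x₀ x) := fun x => by
    rw [Submodule.map_span, ← range_comp]
    rfl
  have hrank : ∀ x ∈ O ∩ (chartAt E x₀).source,
      Module.finrank ℝ (Submodule.span ℝ (range fun i => genCoord x₀ x (σ i x))) =
      Module.finrank ℝ (Submodule.span ℝ (range fun i => σ i x)) := fun x hx => by
    rw [hspan]
    exact (Submodule.equivMapOfInjective _ (genCoord_injective hx.2) _).finrank_eq.symm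
  have hx1 : x₀ ∈ O ∩ (chartAt E x₀).source := ⟨hx₀, mem_chart_source E x₀⟩
  obtain ⟨O', hsub, hO', hx', G, hG, h⟩ := exists_smooth_coeff
    (σ := fun i x => genCoord x₀ x (σ i x)) hO1
    (fun i => (smoothGenOn_iff hO1 inter_subset_right _).1 ((hσ i).mono inter_subset_left)) hx1
    (fun x hx => by rw [hrank x hx, hrank x₀ hx1]; exact hmax x hx.1)
  refine ⟨O', hsub.trans inter_subset_left, hO', hx', fun τ hτ hmem => ?_⟩
  have hτ' := (smoothGenOn_iff hO' (hsub.trans inter_subset_right) τ).1 hτ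
  have hc := hG.clm_apply hτ'
  refine ⟨fun i x => G x (genCoord x₀ x (τ x)) i, fun i => ?_, fun x hx => ?_⟩
  · exact (contMDiffOn_pi_space.1 hc) i
  · apply genCoord_injective (hsub hx).2
    rw [map_sum]
    simp only [map_smul]
    refine (h x hx _ ?_).symm
    rw [hspan]
    exact Submodule.mem_map_of_mem (hmem x hx)

end Sections
end
end DiracGeometry

namespace DiracGeometry

noncomputable section

/-! ### Subbundles, local generators and smoothness criteria. -/

section Subbundles

variable {E : Type*} [NormedAddCommGroup E] [NormedSpace ℝ E]
  {M : Type*} [TopologicalSpace M] [ChartedSpace E M] [IsManifold 𝓘(ℝ, E) ∞ M]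

/-- Locally `D` is spanned by finitely many smooth sections. -/
def HasLocalGenerators (D : ∀ x : M, Submodule ℝ (GenTan E x)) : Prop :=
  ∀ p : M, ∃ (k : ℕ) (U : Set M) (σ : Fin k → ∀ x : M, GenTan E x),
    IsOpen U ∧ p ∈ U ∧ (∀ i, SmoothGenOn (σ i) U) ∧
    ∀ x ∈ U, Submodule.span ℝ (range fun i => σ i x) = D x

theorem IsSubbundle.hasLocalGenerators {D : ∀ x : M, Submodule ℝ (GenTan E x)}
    (hD : IsSubbundle D) : HasLocalGenerators D := fun p => by
  obtain ⟨k, U, σ, hU, hp, hσ, h⟩ := hD p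
  exact ⟨k, U, σ, hU, hp, hσ, fun x hx => (h x hx).2⟩

omit [IsManifold 𝓘(ℝ, E) ∞ M] in
theorem smoothFunOn_const (c : ℝ) (U : Set M) :
    ContMDiffOn 𝓘(ℝ, E) 𝓘(ℝ, ℝ) ∞ (fun _ => c) U := contMDiffOn_const

theorem HasLocalGenerators.exists_section {D : ∀ x : M, Submodule ℝ (GenTan E x)}
    (hD : HasLocalGenerators D) {p : M} {v : GenTan E p} (hv : v ∈ D p) :
    ∃ (U : Set M) (σ : ∀ x : M, GenTan E x), IsOpen U ∧ p ∈ U ∧ IsSectionOn D σ U ∧ σ p = v := by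
  obtain ⟨k, U, σ, hU, hp, hσ, h⟩ := hD p
  rw [← h p hp, Submodule.mem_span_range_iff_exists_fun] at hv
  obtain ⟨c, hc⟩ := hv
  refine ⟨U, fun x => ∑ i, c i • σ i x, hU, hp,
    ⟨SmoothGenOn.sum _ fun i => (hσ i).smul (smoothFunOn_const (c i) U), fun x hx => ?_⟩, hc⟩
  rw [← h x hx]
  exact Submodule.sum_mem _ fun i _ =>
    Submodule.smul_mem _ _ (Submodule.subset_span (mem_range_self i))

theorem IsSubbundle.exists_section {D : ∀ x : M, Submodule ℝ (GenTan E x)}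
    (hD : IsSubbundle D) {p : M} {v : GenTan E p} (hv : v ∈ D p) :
    ∃ (U : Set M) (σ : ∀ x : M, GenTan E x), IsOpen U ∧ p ∈ U ∧ IsSectionOn D σ U ∧ σ p = v :=
  hD.hasLocalGenerators.exists_section hv

theorem IsSectionOn.mono {D : ∀ x : M, Submodule ℝ (GenTan E x)} {σ : ∀ x : M, GenTan E x}
    {U V : Set M} (h : IsSectionOn D σ U) (hV : V ⊆ U) : IsSectionOn D σ V :=
  ⟨h.1.mono hV, fun x hx => h.2 x (hV hx)⟩

theorem IsFieldIn.mono {S : ∀ x : M, Submodule ℝ (Tan E x)} {Z : ∀ x : M, Tan E x}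
    {U V : Set M} (h : IsFieldIn S Z U) (hV : V ⊆ U) : IsFieldIn S Z V :=
  ⟨h.1.mono hV, fun x hx => h.2 x (hV hx)⟩

theorem isOpen_linearIndependent [FiniteDimensional ℝ E] {ι : Type*} [Finite ι]
    {σ : ι → ∀ x : M, GenTan E x} {U : Set M} (hU : IsOpen U) (hσ : ∀ i, SmoothGenOn (σ i) U) :
    IsOpen {x ∈ U | LinearIndependent ℝ fun i => σ i x} := by
  rw [isOpen_iff_mem_nhds]
  rintro p ⟨hp, hind⟩
  have hO := hU.inter (chartAt E p).open_source
  let g : M → ι → E × (E →L[ℝ] ℝ) := fun x i => genCoord p x (σ i x)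
  have hg : ContinuousOn g (U ∩ (chartAt E p).source) := continuousOn_pi.2 fun i =>
    ((smoothGenOn_iff hO inter_subset_right _).1 ((hσ i).mono inter_subset_left)).continuousOn
  have hiff : ∀ x ∈ (chartAt E p).source,
      (LinearIndependent ℝ (g x) ↔ LinearIndependent ℝ fun i => σ i x) := fun x hx =>
    LinearMap.linearIndependent_iff_of_injOn (v := fun i => σ i x) _
      (genCoord_injective hx).injOn
  have hopen := hg.isOpen_inter_preimage hO (isOpen_setOfPred_linearIndependent (𝕜 := ℝ))
  refine Filter.mem_of_superset (hopen.mem_nhds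
    ⟨⟨hp, mem_chart_source E p⟩, (hiff p (mem_chart_source E p)).2 hind⟩) ?_
  rintro x ⟨⟨h1, h2⟩, h3⟩
  exact ⟨h1, (hiff x h2).1 h3⟩

theorem exists_linearIndependent_of_finrank_eq {V : Type*} [AddCommGroup V] [Module ℝ V]
    [FiniteDimensional ℝ V] {L : Submodule ℝ V} {k : ℕ} (hk : Module.finrank ℝ L = k) :
    ∃ b : Fin k → V, LinearIndependent ℝ b ∧ ∀ i, b i ∈ L :=
  let b := Module.finBasisOfFinrankEq ℝ L hk
  ⟨fun i => b i, b.linearIndependent.map' L.subtype (Submodule.ker_subtype _), fun i => (b i).2⟩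

theorem span_eq_of_finrank_eq {V : Type*} [AddCommGroup V] [Module ℝ V]
    [FiniteDimensional ℝ V] {L : Submodule ℝ V} {k : ℕ} (hk : Module.finrank ℝ L = k)
    {b : Fin k → V} (hb : LinearIndependent ℝ b) (hbL : ∀ i, b i ∈ L) :
    Submodule.span ℝ (range b) = L := by
  refine Submodule.eq_of_le_of_finrank_eq (Submodule.span_le.2 ?_) ?_
  · rintro _ ⟨i, rfl⟩
    exact hbL i
  · rw [finrank_span_eq_card hb, hk, Fintype.card_fin]

/-- A family of constant rank is a subbundle if each of its elements extends to a smooth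
section. -/
theorem isSubbundle_of_exists_section [FiniteDimensional ℝ E]
    {D : ∀ x : M, Submodule ℝ (GenTan E x)} {k : ℕ}
    (hk : ∀ x, Module.finrank ℝ (D x) = k)
    (h : ∀ (p : M), ∀ v ∈ D p, ∃ (U : Set M) (σ : ∀ x : M, GenTan E x), IsOpen U ∧ p ∈ U ∧
      IsSectionOn D σ U ∧ σ p = v) : IsSubbundle D := by
  intro p
  obtain ⟨b, hb, hbD⟩ := exists_linearIndependent_of_finrank_eq (hk p)
  choose U σ hU hp hσ hσp using fun i => h p (b i) (hbD i)
  let O := ⋂ i, U i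
  have hO : IsOpen O := isOpen_iInter_of_finite hU
  have hσO : ∀ i, IsSectionOn D (σ i) O := fun i => (hσ i).mono (iInter_subset _ i)
  refine ⟨k, {x ∈ O | LinearIndependent ℝ fun i => σ i x}, σ,
    isOpen_linearIndependent hO fun i => (hσO i).1, ⟨mem_iInter.2 hp, ?_⟩,
    fun i => (hσO i).1.mono fun x hx => hx.1, fun x hx => ⟨hx.2, ?_⟩⟩
  · simpa only [hσp] using hb
  · exact span_eq_of_finrank_eq (hk x) hx.2 fun i => (hσO i).2 x hx.1

theorem IsDistribution.hasLocalGenerators_tanPart {S : ∀ x : M, Submodule ℝ (Tan E x)}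
    (hS : IsDistribution S) : HasLocalGenerators fun x => tanPart (S x) := fun p => by
  obtain ⟨k, U, X, hU, hp, hX, h⟩ := hS p
  refine ⟨k, U, fun i x => (X i x, 0), hU, hp, fun i => ⟨hX i, smoothFormOn_zero U⟩,
    fun x hx => ?_⟩
  have := congrArg (Submodule.map (LinearMap.inl ℝ (Tan E x) (Cot E x))) (h x hx).2
  rw [Submodule.map_span, ← range_comp, Submodule.map_inl] at this
  exact this

section FormCriterion
variable [FiniteDimensional ℝ E]

omit [IsManifold 𝓘(ℝ, E) ∞ M] in
theorem contMDiffOn_clm_of_apply {W : Type*} [NormedAddCommGroup W] [NormedSpace ℝ W]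
    {f : M → E →L[ℝ] W} {U : Set M}
    (h : ∀ v : E, ContMDiffOn 𝓘(ℝ, E) 𝓘(ℝ, W) ∞ (fun x => f x v) U) :
    ContMDiffOn 𝓘(ℝ, E) 𝓘(ℝ, E →L[ℝ] W) ∞ f U := by
  let b := Module.finBasis ℝ E
  let β : Fin (Module.finrank ℝ E) → E →L[ℝ] ℝ := fun i =>
    LinearMap.toContinuousLinearMap (b.coord i)
  have hf : ∀ x, f x = ∑ i, ContinuousLinearMap.smulRightL ℝ E W (β i) (f x (b i)) := fun x => by
    ext v
    conv_lhs => rw [← b.sum_repr v, map_sum]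
    simp [β]
  have hs : ContMDiffOn 𝓘(ℝ, E) 𝓘(ℝ, E →L[ℝ] W) ∞
      (fun x => ∑ i, ContinuousLinearMap.smulRightL ℝ E W (β i) (f x (b i))) U :=
    contMDiffOn_finsetSum fun i _ =>
      ((ContinuousLinearMap.smulRightL ℝ E W (β i)).contDiff.contMDiff).comp_contMDiffOn (h (b i))
  exact hs.congr fun x _ => hf x

theorem smoothFormOn_of_apply {ξ : ∀ x : M, Cot E x} {p : M} {U : Set M} (hO : IsOpen U)
    (hU : U ⊆ (chartAt E p).source)
    (h : ∀ v : E, ContMDiffOn 𝓘(ℝ, E) 𝓘(ℝ, ℝ) ∞ (fun x => ξ x (ofCoord p x v)) U) :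
    SmoothFormOn ξ U :=
  (smoothFormOn_iff hO hU ξ).2 (contMDiffOn_clm_of_apply h)

/-- The test fields are those constant in a chart. They exist only over the chart domain, hence the
quantification over open subsets of `U`. -/
theorem smoothFormOn_of_forall_field {ξ : ∀ x : M, Cot E x} {U : Set M} (hO : IsOpen U)
    (h : ∀ V ⊆ U, IsOpen V → ∀ X : ∀ x : M, Tan E x, SmoothFieldOn X V →
      ContMDiffOn 𝓘(ℝ, E) 𝓘(ℝ, ℝ) ∞ (fun x => ξ x (X x)) V) :
    SmoothFormOn ξ U := fun p hp => by
  have hV := hO.inter (chartAt E p).open_source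
  have := smoothFormOn_of_apply (ξ := ξ) hV inter_subset_right fun v =>
    h _ inter_subset_left hV _ ((smoothFieldOn_ofCoord p v).mono inter_subset_right)
  exact (ContMDiffOn.contMDiffAt this (hV.mem_nhds ⟨hp, mem_chart_source E p⟩)).contMDiffWithinAt

/-- A generalized inverse `G` for a frame of Φ makes `id - combo ∘ G` a smooth family of maps that
kills Φ and differs from the identity only by values in Φ. Composing it with the coordinate
functionals of a basis gives forms in Φ⁰, and a covector in Φ⁰ is unchanged by this composition, so
they span. -/
theorem IsDistribution.hasLocalGenerators_annPart {Φ : ∀ x : M, Submodule ℝ (Tan E x)}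
    (hΦ : IsDistribution Φ) : HasLocalGenerators fun x => annPart (Φ x) := fun p => by
  obtain ⟨k, U, X, hU, hp, hX, h⟩ := hΦ p
  have hO := hU.inter (chartAt E p).open_source
  have hX' := fun i =>
    (smoothFieldOn_iff hO inter_subset_right _).1 ((hX i).mono inter_subset_left)
  have hinj : ∀ x ∈ (chartAt E p).source, Function.Injective (toCoord (E := E) p x) :=
    fun x hx => Function.LeftInverse.injective (ofCoord_toCoord hx)
  have hrank : ∀ x ∈ U ∩ (chartAt E p).source,
      Module.finrank ℝ (Submodule.span ℝ (range fun i => toCoord p x (X i x))) = k := by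
    intro x hx
    have := (h x hx.1).1.map' (toCoord (E := E) p x).toLinearMap
      (LinearMap.ker_eq_bot.2 (hinj x hx.2))
    exact (finrank_span_eq_card this).trans (Fintype.card_fin k)
  have hp' : p ∈ U ∩ (chartAt E p).source := ⟨hp, mem_chart_source E p⟩
  obtain ⟨O, hOU, hO', hpO, G, hG, hGX⟩ := exists_smooth_coeff
    (σ := fun i x => toCoord p x (X i x)) hO hX' hp'
    fun x hx => by rw [hrank x hx, hrank p hp']
  let b := Module.finBasis ℝ E
  let α : Fin (Module.finrank ℝ E) → ∀ x : M, Cot E x := fun j x =>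
    (LinearMap.toContinuousLinearMap (b.coord j)).comp
      ((ContinuousLinearMap.id ℝ E - (combo fun i => toCoord p x (X i x)).comp (G x)).comp
        (toCoord p x))
  have hα : ∀ j x v, α j x v = b.coord j (toCoord p x v -
      ∑ i, G x (toCoord p x v) i • toCoord p x (X i x)) := by
    intro j x v
    rw [← combo_apply]
    rfl
  refine ⟨_, O, fun j x => (0, α j x), hO', hpO, fun j => ⟨smoothFieldOn_zero O, ?_⟩, ?_⟩
  · refine smoothFormOn_of_apply hO' (hOU.trans inter_subset_right) fun v => ?_
    have hc : ContMDiffOn 𝓘(ℝ, E) 𝓘(ℝ, Fin k → ℝ) ∞ (fun x => G x v) O :=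
      hG.clm_apply contMDiffOn_const
    have h1 : ContMDiffOn 𝓘(ℝ, E) 𝓘(ℝ, E) ∞
        (fun x => v - ∑ i, G x v i • toCoord p x (X i x)) O :=
      contMDiffOn_const.sub (contMDiffOn_finsetSum fun i _ =>
        ((contMDiffOn_pi_space.1 hc) i).smul ((hX' i).mono hOU))
    have h2 := ((LinearMap.toContinuousLinearMap (b.coord j)).contDiff.contMDiff
      (n := ∞)).comp_contMDiffOn h1
    refine h2.congr fun x hx => ?_
    change α j x (ofCoord p x v) = _
    rw [hα, toCoord_ofCoord (hOU hx).2]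
    rfl
  · intro x hx
    refine le_antisymm (Submodule.span_le.2 ?_) ?_
    · rintro _ ⟨j, rfl⟩
      refine mem_annPart.2 ⟨rfl, fun v hv => ?_⟩
      have hv' : toCoord p x v ∈ Submodule.span ℝ (range fun i => toCoord p x (X i x)) := by
        rw [← (h x (hOU hx).1).2] at hv
        have := Submodule.mem_map_of_mem (f := (toCoord (E := E) p x).toLinearMap) hv
        rw [Submodule.map_span, ← range_comp] at this
        exact this
      change α j x v = 0
      rw [hα, hGX x hx _ hv', sub_self, map_zero]
    · rintro ⟨w, β⟩ hβ
      obtain ⟨h0 : w = 0, hβΦ : ∀ v ∈ Φ x, β v = 0⟩ := mem_annPart.1 hβ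
      subst h0
      rw [Submodule.mem_span_range_iff_exists_fun]
      refine ⟨fun j => β (ofCoord p x (b j)), ?_⟩
      have hβX : ∀ v, β (ofCoord p x (v - ∑ i, G x v i • toCoord p x (X i x))) =
          β (ofCoord p x v) := by
        intro v
        rw [map_sub, map_sub, sub_eq_self, map_sum, map_sum]
        refine Finset.sum_eq_zero fun i _ => ?_
        rw [map_smul, map_smul, ofCoord_toCoord (hOU hx).2,
          hβΦ _ (by rw [← (h x (hOU hx).1).2]; exact Submodule.subset_span (mem_range_self i)),
          smul_zero]
      refine Prod.ext ?_ ?_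
      · rw [Prod.fst_sum]
        simp
      · rw [Prod.snd_sum]
        ext v
        rw [sum_apply]
        change ∑ j, β (ofCoord p x (b j)) • α j x v = β v
        simp only [hα]
        conv_rhs => rw [← ofCoord_toCoord (hOU hx).2 v, ← hβX,
          ← b.sum_repr (toCoord p x v - ∑ i, G x (toCoord p x v) i • toCoord p x (X i x)),
          map_sum, map_sum]
        refine Finset.sum_congr rfl fun j _ => ?_
        rw [map_smul, map_smul, smul_eq_mul, smul_eq_mul, mul_comm]
        rfl

end FormCriterion
end Subbundles
end
end DiracGeometry

namespace DiracGeometry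

noncomputable section

/-! ### The Courant bracket and the tensor ⟨[σ₁, σ₂], σ₃⟩. -/

section Courant

variable {E : Type*} [NormedAddCommGroup E] [NormedSpace ℝ E]
  {M : Type*} [TopologicalSpace M] [ChartedSpace E M]

theorem mdifferentiableAt_of_smoothOn {f : M → ℝ} {U : Set M} (hO : IsOpen U)
    (hf : ContMDiffOn 𝓘(ℝ, E) 𝓘(ℝ, ℝ) ∞ f U) {p : M} (hp : p ∈ U) :
    MDifferentiableAt 𝓘(ℝ, E) 𝓘(ℝ, ℝ) f p :=
  (hf.contMDiffAt (hO.mem_nhds hp)).mdifferentiableAt (by simp)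

theorem mvfderiv_congr {f g : M → ℝ} {U : Set M} (hO : IsOpen U) (h : ∀ x ∈ U, f x = g x) {p : M}
    (hp : p ∈ U) : mvfderiv 𝓘(ℝ, E) f p = mvfderiv 𝓘(ℝ, E) g p := by
  have hfg : f =ᶠ[𝓝 p] g := Filter.eventually_of_mem (hO.mem_nhds hp) h
  ext v
  exact DFunLike.congr_fun hfg.mfderiv_eq v

variable [IsManifold 𝓘(ℝ, E) ∞ M]

theorem smoothOn_mvfderiv {f : M → ℝ} {X : ∀ x : M, Tan E x} {U : Set M} (hO : IsOpen U)
    (hf : ContMDiffOn 𝓘(ℝ, E) 𝓘(ℝ, ℝ) ∞ f U) (hX : SmoothFieldOn X U) :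
    ContMDiffOn 𝓘(ℝ, E) 𝓘(ℝ, ℝ) ∞ (fun x => mvfderiv 𝓘(ℝ, E) f x (X x)) U :=
  (smoothFormOn_mvfderiv hO hf).apply hX

theorem SmoothGenOn.pairing {σ τ : ∀ x : M, GenTan E x} {U : Set M} (hσ : SmoothGenOn σ U)
    (hτ : SmoothGenOn τ U) :
    ContMDiffOn 𝓘(ℝ, E) 𝓘(ℝ, ℝ) ∞ (fun x => pairing (σ x) (τ x)) U :=
  (hτ.2.apply hσ.1).add (hσ.2.apply hτ.1)

omit [IsManifold 𝓘(ℝ, E) ∞ M] in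
theorem courant_antisymm (σ τ : ∀ x : M, GenTan E x) (p : M) :
    courant σ τ p = -courant τ σ p := by
  refine Prod.ext VectorField.mlieBracket_swap_apply ?_
  have h : (fun x => (τ x).2 (σ x).1 - (σ x).2 (τ x).1) =
      -(fun x => (σ x).2 (τ x).1 - (τ x).2 (σ x).1) := by
    ext x
    simp
  simp only [courant, Prod.snd_neg]
  rw [h, mvfderiv_neg]
  module

theorem extD_apply' {ξ : ∀ x : M, Cot E x} {U : Set M} (hO : IsOpen U)
    (hξ : SmoothFormOn ξ U) {X Y : ∀ x : M, Tan E x} {V : Set M} (hV : IsOpen V)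
    (hX : SmoothFieldOn X V) (hY : SmoothFieldOn Y V) {p : M} (hp : p ∈ U) (hpV : p ∈ V) :
    extD ξ p (X p) (Y p) = mvfderiv 𝓘(ℝ, E) (fun x => ξ x (Y x)) p (X p) -
      mvfderiv 𝓘(ℝ, E) (fun x => ξ x (X x)) p (Y p) -
      ξ p (VectorField.mlieBracket 𝓘(ℝ, E) X Y p) :=
  extD_apply (hO.inter hV) (hξ.mono inter_subset_left) (hX.mono inter_subset_right)
    (hY.mono inter_subset_right) ⟨hp, hpV⟩

/-- The value of the Courant bracket of two isotropic sections on a third section. -/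
theorem pairing_courant {σ₁ σ₂ σ₃ : ∀ x : M, GenTan E x} {U : Set M} (hO : IsOpen U)
    (h₁ : SmoothGenOn σ₁ U) (h₂ : SmoothGenOn σ₂ U) (h₃ : SmoothGenOn σ₃ U)
    (h₁₂ : ∀ x ∈ U, pairing (σ₁ x) (σ₂ x) = 0) (h₁₃ : ∀ x ∈ U, pairing (σ₁ x) (σ₃ x) = 0)
    {p : M} (hp : p ∈ U) :
    pairing (courant σ₁ σ₂ p) (σ₃ p) =
      (σ₁ p).2 (VectorField.mlieBracket 𝓘(ℝ, E) (fun x => (σ₂ x).1) (fun x => (σ₃ x).1) p) +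
      (σ₂ p).2 (VectorField.mlieBracket 𝓘(ℝ, E) (fun x => (σ₃ x).1) (fun x => (σ₁ x).1) p) +
      (σ₃ p).2 (VectorField.mlieBracket 𝓘(ℝ, E) (fun x => (σ₁ x).1) (fun x => (σ₂ x).1) p) +
      mvfderiv 𝓘(ℝ, E) (fun x => (σ₂ x).2 (σ₃ x).1) p (σ₁ p).1 +
      mvfderiv 𝓘(ℝ, E) (fun x => (σ₃ x).2 (σ₁ x).1) p (σ₂ p).1 +
      mvfderiv 𝓘(ℝ, E) (fun x => (σ₁ x).2 (σ₂ x).1) p (σ₃ p).1 := by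
  have e1 := extD_apply hO h₂.2 h₁.1 h₃.1 hp
  have e2 := extD_apply hO h₁.2 h₂.1 h₃.1 hp
  have c1 : mvfderiv 𝓘(ℝ, E) (fun x => (σ₂ x).2 (σ₁ x).1) p =
      -mvfderiv 𝓘(ℝ, E) (fun x => (σ₁ x).2 (σ₂ x).1) p := by
    rw [← mvfderiv_neg]
    exact mvfderiv_congr hO (fun x hx => eq_neg_of_add_eq_zero_left (h₁₂ x hx)) hp
  have c2 : mvfderiv 𝓘(ℝ, E) (fun x => (σ₁ x).2 (σ₃ x).1) p =
      -mvfderiv 𝓘(ℝ, E) (fun x => (σ₃ x).2 (σ₁ x).1) p := by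
    rw [← mvfderiv_neg]
    exact mvfderiv_congr hO (fun x hx => eq_neg_of_add_eq_zero_right (h₁₃ x hx)) hp
  -- Isotropy makes the two contractions opposite, so the exact term of the bracket loses its factor
  -- one half.
  have c3 : mvfderiv 𝓘(ℝ, E) (fun x => (σ₂ x).2 (σ₁ x).1 - (σ₁ x).2 (σ₂ x).1) p =
      (-2 : ℝ) • mvfderiv 𝓘(ℝ, E) (fun x => (σ₁ x).2 (σ₂ x).1) p := by
    have := mvfderiv_sub (mdifferentiableAt_of_smoothOn hO (h₂.2.apply h₁.1) hp)
      (mdifferentiableAt_of_smoothOn hO (h₁.2.apply h₂.1) hp)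
    rw [c1] at this
    refine Eq.trans this ?_
    module
  have s1 : (σ₂ p).2 (VectorField.mlieBracket 𝓘(ℝ, E) (fun x => (σ₁ x).1) (fun x => (σ₃ x).1) p) =
      -(σ₂ p).2 (VectorField.mlieBracket 𝓘(ℝ, E) (fun x => (σ₃ x).1) (fun x => (σ₁ x).1) p) := by
    rw [VectorField.mlieBracket_swap_apply, map_neg]
  simp only [pairing, courant, add_apply, sub_apply, smul_apply, smul_eq_mul]
  rw [e1, e2, c3, c1, c2, s1]
  simp only [neg_apply, smul_apply, smul_eq_mul]
  ring

variable [CompleteSpace E]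

theorem SmoothFormOn.extD [FiniteDimensional ℝ E] {ξ : ∀ x : M, Cot E x} {X : ∀ x : M, Tan E x}
    {U : Set M} (hO : IsOpen U) (hξ : SmoothFormOn ξ U) (hX : SmoothFieldOn X U) :
    SmoothFormOn (fun x => extD ξ x (X x)) U := by
  refine smoothFormOn_of_forall_field hO fun V hVU hV Y hY => ?_
  have h : ContMDiffOn 𝓘(ℝ, E) 𝓘(ℝ, ℝ) ∞ (fun p =>
      mvfderiv 𝓘(ℝ, E) (fun x => ξ x (Y x)) p (X p) -
      mvfderiv 𝓘(ℝ, E) (fun x => ξ x (X x)) p (Y p) -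
      ξ p (VectorField.mlieBracket 𝓘(ℝ, E) X Y p)) V :=
    ((smoothOn_mvfderiv hV ((hξ.mono hVU).apply hY) (hX.mono hVU)).sub
      (smoothOn_mvfderiv hV ((hξ.mono hVU).apply (hX.mono hVU)) hY)).sub
      ((hξ.mono hVU).apply (SmoothFieldOn.mlieBracket hV (hX.mono hVU) hY))
  exact h.congr fun p hp => extD_apply hV (hξ.mono hVU) (hX.mono hVU) hY hp

theorem SmoothFormOn.lieForm [FiniteDimensional ℝ E] {ξ : ∀ x : M, Cot E x}
    {X : ∀ x : M, Tan E x} {U : Set M} (hO : IsOpen U) (hξ : SmoothFormOn ξ U)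
    (hX : SmoothFieldOn X U) : SmoothFormOn (fun x => lieForm X ξ x) U :=
  (SmoothFormOn.extD hO hξ hX).add (smoothFormOn_mvfderiv hO (hξ.apply hX))

theorem SmoothGenOn.courant [FiniteDimensional ℝ E] {σ τ : ∀ x : M, GenTan E x} {U : Set M}
    (hO : IsOpen U) (hσ : SmoothGenOn σ U) (hτ : SmoothGenOn τ U) :
    SmoothGenOn (courant σ τ) U :=
  ⟨SmoothFieldOn.mlieBracket hO hσ.1 hτ.1,
    ((SmoothFormOn.extD hO hτ.2 hσ.1).sub (SmoothFormOn.extD hO hσ.2 hτ.1)).add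
      ((smoothFormOn_mvfderiv hO ((hτ.2.apply hσ.1).sub (hσ.2.apply hτ.1))).smul
        (smoothFunOn_const _ U))⟩

section Tensor
variable {D : ∀ x : M, Submodule ℝ (GenTan E x)} (hD : ∀ x, IsIsotropic (D x))
  {σ₁ σ₂ σ₃ τ₁ τ₂ τ₃ : ∀ x : M, GenTan E x} {U : Set M}
include hD

-- The formula `pairing_courant` is a sum over cyclic permutations of the three sections.
omit [CompleteSpace E] in
theorem pairing_courant_cyclic (hO : IsOpen U) (h₁ : IsSectionOn D σ₁ U)
    (h₂ : IsSectionOn D σ₂ U) (h₃ : IsSectionOn D σ₃ U) {p : M} (hp : p ∈ U) :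
    pairing (courant σ₁ σ₂ p) (σ₃ p) = pairing (courant σ₂ σ₃ p) (σ₁ p) := by
  rw [pairing_courant hO h₁.1 h₂.1 h₃.1 (fun x hx => hD x _ (h₁.2 x hx) _ (h₂.2 x hx))
      (fun x hx => hD x _ (h₁.2 x hx) _ (h₃.2 x hx)) hp,
    pairing_courant hO h₂.1 h₃.1 h₁.1 (fun x hx => hD x _ (h₂.2 x hx) _ (h₃.2 x hx))
      (fun x hx => hD x _ (h₂.2 x hx) _ (h₁.2 x hx)) hp]
  ring

omit [CompleteSpace E] in
/-- On an isotropic family `⟨[σ₁, σ₂], σ₃⟩` is a tensor. -/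
theorem pairing_courant_congr (hO : IsOpen U) (h₁ : IsSectionOn D σ₁ U)
    (h₂ : IsSectionOn D σ₂ U) (h₃ : IsSectionOn D σ₃ U) (k₁ : IsSectionOn D τ₁ U)
    (k₂ : IsSectionOn D τ₂ U) {p : M} (hp : p ∈ U) (e₁ : σ₁ p = τ₁ p)
    (e₂ : σ₂ p = τ₂ p) :
    pairing (courant σ₁ σ₂ p) (σ₃ p) = pairing (courant τ₁ τ₂ p) (σ₃ p) := by
  -- Cyclicity moves each argument in turn into the last slot, where only its value at `p` enters.
  rw [pairing_courant_cyclic hD hO h₁ h₂ h₃ hp, e₁, pairing_courant_cyclic hD hO h₂ h₃ k₁ hp, e₂,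
    pairing_courant_cyclic hD hO h₃ k₁ k₂ hp]

end Tensor

omit [IsManifold 𝓘(ℝ, E) ∞ M] [CompleteSpace E] in
theorem mem_of_pairing_eq_zero {x : M} {L : Submodule ℝ (GenTan E x)} (hL : orth L = L)
    {v : GenTan E x} (h : ∀ w ∈ L, pairing v w = 0) : v ∈ L := hL.le h

end Courant
end
end DiracGeometry

namespace DiracGeometry

noncomputable section

/-! ### Courant closure of D^S. -/

section InducedDirac

variable {E : Type*} [NormedAddCommGroup E] [NormedSpace ℝ E] [FiniteDimensional ℝ E]
  {M : Type*} [TopologicalSpace M] [ChartedSpace E M] [IsManifold 𝓘(ℝ, E) ∞ M]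

omit [FiniteDimensional ℝ E] in
theorem extD_congr {ξ η : ∀ x : M, Cot E x} {U : Set M} (hO : IsOpen U)
    (h : ∀ x ∈ U, ξ x = η x) {p : M} (hp : p ∈ U) : extD ξ p = extD η p := by
  have he : formInChart ξ p =ᶠ[𝓝 (extChartAt 𝓘(ℝ, E) p p)] formInChart η p := by
    filter_upwards [eventually_symm_mem hO hp] with y ⟨hy, hyU, hs⟩
    rw [formInChart_eq ξ hy, formInChart_eq η hy, h _ hyU]
  ext u v
  rw [extD_apply_eq, extD_apply_eq, he.fderiv_eq]

omit [FiniteDimensional ℝ E] in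
theorem extD_zero (p : M) : extD (fun x : M => (0 : Cot E x)) p = 0 := by
  have he : formInChart (fun x : M => (0 : Cot E x)) p = fun _ => 0 := by
    ext y v
    rfl
  ext u v
  rw [extD_apply_eq, he]
  simp only [fderiv_fun_const, Pi.zero_apply]
  exact sub_self (0 : ℝ)

omit [FiniteDimensional ℝ E] [IsManifold 𝓘(ℝ, E) ∞ M] in
theorem mvfderiv_eq_zero {f : M → ℝ} {U : Set M} (hO : IsOpen U) (h : ∀ x ∈ U, f x = 0) {p : M}
    (hp : p ∈ U) : mvfderiv 𝓘(ℝ, E) f p = 0 := by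
  rw [mvfderiv_congr hO h hp, mvfderiv_const]

omit [FiniteDimensional ℝ E] [IsManifold 𝓘(ℝ, E) ∞ M] in
theorem mlieBracket_congr {X X' Y Y' : ∀ x : M, Tan E x} {U : Set M} (hO : IsOpen U)
    (hX : ∀ x ∈ U, X x = X' x) (hY : ∀ x ∈ U, Y x = Y' x) {p : M} (hp : p ∈ U) :
    VectorField.mlieBracket 𝓘(ℝ, E) X Y p = VectorField.mlieBracket 𝓘(ℝ, E) X' Y' p :=
  Filter.EventuallyEq.mlieBracket_vectorField_eq (Filter.eventually_of_mem (hO.mem_nhds hp) hX)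
    (Filter.eventually_of_mem (hO.mem_nhds hp) hY)

theorem orth_eq_of_isDirac {D : ∀ x : M, Submodule ℝ (GenTan E x)} (hD : IsDirac D) (x : M) :
    orth (D x) = D x := orth_eq_of_maximal (hD.maximal x)

/-- Generically, sections of `D^S` split into sections of `D` and of `S`. -/
theorem exists_generic_splitting {D S : ∀ x : M, Submodule ℝ (GenTan E x)}
    (hD : HasLocalGenerators D) (hS : HasLocalGenerators S) {O : Set M} (hO : IsOpen O)
    (hne : O.Nonempty) :
    ∃ x₀ ∈ O, ∃ V ⊆ O, IsOpen V ∧ x₀ ∈ V ∧ ∀ σ : ∀ x : M, GenTan E x, SmoothGenOn σ V →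
      (∀ x ∈ V, σ x ∈ D x ⊔ S x) → ∃ d z : ∀ x : M, GenTan E x, IsSectionOn D d V ∧
        IsSectionOn S z V ∧ ∀ x ∈ V, σ x = d x + z x := by
  obtain ⟨p, hp⟩ := hne
  obtain ⟨k, U₁, e, hU₁, hp₁, he, hspan₁⟩ := hD p
  obtain ⟨l, U₂, s, hU₂, hp₂, hs, hspan₂⟩ := hS p
  have hO' := (hO.inter hU₁).inter hU₂
  let σ : Fin k ⊕ Fin l → ∀ x : M, GenTan E x := Sum.elim e s
  -- The rank of D + S may jump; smooth coefficients are available near a point where it is maximal.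
  obtain ⟨x₀, hx₀, hmax⟩ := exists_max_on
    (fun x => Module.finrank ℝ (Submodule.span ℝ (range fun i => σ i x)))
    (b := 2 * Module.finrank ℝ E)
    (fun x => (Submodule.finrank_le _).trans (finrank_genTan x).le)
    (O := O ∩ U₁ ∩ U₂) ⟨p, ⟨hp, hp₁⟩, hp₂⟩
  obtain ⟨V, hVO, hV, hxV, hV'⟩ := exists_smooth_coeff_gen hO'
    (σ := σ) (by
      rintro (i | i)
      · exact (he i).mono fun x hx => hx.1.2
      · exact (hs i).mono fun x hx => hx.2) hx₀ hmax
  refine ⟨x₀, hx₀.1.1, V, fun x hx => (hVO hx).1.1, hV, hxV, fun τ hτ hmem => ?_⟩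
  obtain ⟨c, hc, hτc⟩ := hV' τ hτ (fun x hx => by
    have h := hmem x hx
    rw [← hspan₁ x (hVO hx).1.2, ← hspan₂ x (hVO hx).2, ← Submodule.span_union] at h
    convert h using 2
    ext v
    simp [σ])
  refine ⟨fun x => ∑ i, c (Sum.inl i) x • e i x, fun x => ∑ i, c (Sum.inr i) x • s i x,
    ⟨SmoothGenOn.sum _ fun i => ((he i).mono fun x hx => (hVO hx).1.2).smul (hc _), fun x hx => ?_⟩,
    ⟨SmoothGenOn.sum _ fun i => ((hs i).mono fun x hx => (hVO hx).2).smul (hc _), fun x hx => ?_⟩,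
    fun x hx => ?_⟩
  · rw [← hspan₁ x (hVO hx).1.2]
    exact Submodule.sum_mem _ fun i _ =>
      Submodule.smul_mem _ _ (Submodule.subset_span (mem_range_self i))
  · rw [← hspan₂ x (hVO hx).2]
    exact Submodule.sum_mem _ fun i _ =>
      Submodule.smul_mem _ _ (Submodule.subset_span (mem_range_self i))
  · rw [hτc x hx, Fintype.sum_sum_type]
    rfl

/-- A continuous function on an open set vanishes if it vanishes somewhere in each open subset. -/
theorem eq_zero_of_dense {X : Type*} [TopologicalSpace X] {f : X → ℝ} {U : Set X} (hU : IsOpen U)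
    (hf : ContinuousOn f U)
    (h : ∀ O ⊆ U, IsOpen O → O.Nonempty → ∃ x ∈ O, f x = 0) {p : X} (hp : p ∈ U) : f p = 0 := by
  by_contra hne
  obtain ⟨x, hx, h0⟩ := h _ inter_subset_left (hf.isOpen_inter_preimage hU isOpen_compl_singleton)
    ⟨p, hp, hne⟩
  exact hx.2 h0

/-- The Courant bracket of two sections of `D^S` which are compatible with `S` is a section
of `D^S`. -/
theorem courant_mem_induced {D S : ∀ x : M, Submodule ℝ (GenTan E x)} (hD : IsDirac D)
    (hiso : ∀ x, IsIsotropic (S x)) (hS : HasLocalGenerators S)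
    (hsub : HasLocalGenerators (induced D S)) {U : Set M} (hU : IsOpen U)
    {σ₁ σ₂ : ∀ x : M, GenTan E x} (h₁ : IsSectionOn (induced D S) σ₁ U)
    (h₂ : IsSectionOn (induced D S) σ₂ U)
    (b₁ : ∀ V ⊆ U, IsOpen V → ∀ s, IsSectionOn S s V → ∀ x ∈ V,
      courant s σ₁ x ∈ induced D S x)
    (b₂ : ∀ V ⊆ U, IsOpen V → ∀ s, IsSectionOn S s V → ∀ x ∈ V,
      courant s σ₂ x ∈ induced D S x)
    (b₃ : ∀ V ⊆ U, IsOpen V → ∀ s s', IsSectionOn S s V → IsSectionOn S s' V → ∀ x ∈ V,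
      courant s s' x ∈ induced D S x) :
    ∀ x ∈ U, courant σ₁ σ₂ x ∈ induced D S x := by
  have hL : ∀ x, orth (induced D S x) = induced D S x := fun x =>
    orth_induced (orth_eq_of_isDirac hD x) (hiso x)
  have hLi : ∀ x, IsIsotropic (induced D S x) := fun x => (hL x).ge
  intro p hp
  refine mem_of_pairing_eq_zero (hL p) fun w hw => ?_
  obtain ⟨U₃, σ₃, hU₃, hp₃, h₃, rfl⟩ := hsub.exists_section hw
  have hV := hU.inter hU₃
  -- The tensor is a continuous function, so it suffices that it vanishes somewhere in each nonempty
  -- open subset.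
  refine eq_zero_of_dense (f := fun x => pairing (courant σ₁ σ₂ x) (σ₃ x)) hV
    (SmoothGenOn.pairing (SmoothGenOn.courant hV (h₁.1.mono inter_subset_left)
      (h₂.1.mono inter_subset_left)) (h₃.1.mono inter_subset_right)).continuousOn ?_ ⟨hp, hp₃⟩
  intro O hOV hO hne
  obtain ⟨x, hxO, W, hWO, hW, hx, hsplit⟩ :=
    exists_generic_splitting hD.subbundle.hasLocalGenerators hS hO hne
  have hWU : W ⊆ U := fun y hy => (hOV (hWO hy)).1
  -- The part `d = σ - z` lies in D^S as well as in D, because S ⊂ D^S. Hence cyclicity applies to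
  -- the parts too.
  have hsplit' : ∀ σ, IsSectionOn (induced D S) σ W → ∃ d z : ∀ x : M, GenTan E x,
      IsSectionOn D d W ∧ IsSectionOn (induced D S) d W ∧ IsSectionOn S z W ∧
      IsSectionOn (induced D S) z W ∧ ∀ v, pairing v (σ x) = pairing v (d x) + pairing v (z x) := by
    intro σ hσ
    obtain ⟨d, z, hd, hz, hdz⟩ := hsplit σ hσ.1 fun y hy => by
      have := hσ.2 y hy
      rw [induced_eq D (hiso y)] at this
      exact this.1
    have hz' : IsSectionOn (induced D S) z W := ⟨hz.1, fun y hy => le_induced D S y (hz.2 y hy)⟩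
    refine ⟨d, z, hd, ⟨hd.1, fun y hy => ?_⟩, hz, hz', fun v => ?_⟩
    · rw [eq_sub_of_add_eq (hdz y hy).symm]
      exact Submodule.sub_mem _ (hσ.2 y hy) (hz'.2 y hy)
    · rw [hdz x hx, pairing_add_right]
  have k₁ := h₁.mono hWU
  have k₂ := h₂.mono hWU
  have k₃ := h₃.mono fun y hy => (hOV (hWO hy)).2
  obtain ⟨d₁, z₁, hd₁, hd₁', hz₁, hz₁', e₁⟩ := hsplit' σ₁ k₁
  obtain ⟨d₂, z₂, hd₂, hd₂', hz₂, hz₂', e₂⟩ := hsplit' σ₂ k₂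
  obtain ⟨d₃, z₃, hd₃, hd₃', hz₃, hz₃', e₃⟩ := hsplit' σ₃ k₃
  have cyc : ∀ {a b c : ∀ x : M, GenTan E x}, IsSectionOn (induced D S) a W →
      IsSectionOn (induced D S) b W → IsSectionOn (induced D S) c W →
      pairing (courant a b x) (c x) = pairing (courant b c x) (a x) := fun ha hb hc =>
    pairing_courant_cyclic hLi hW ha hb hc hx
  -- The S-parts are removed one at a time: third slot, then second, then first. The order matters,
  -- since brackets with S are controlled only for `σ₁`, `σ₂` and for S itself, not for the D-parts.
  have t₁ : pairing (courant σ₁ σ₂ x) (z₃ x) = 0 := by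
    rw [cyc k₁ k₂ hz₃', cyc k₂ hz₃' k₁]
    exact hLi x _ (b₁ W hWU hW z₃ hz₃ x hx) _ (k₂.2 x hx)
  have t₂ : pairing (courant d₃ σ₁ x) (z₂ x) = 0 := by
    rw [cyc hd₃' k₁ hz₂', courant_antisymm]
    exact hLi x _ (Submodule.neg_mem _ (b₁ W hWU hW z₂ hz₂ x hx)) _ (hd₃'.2 x hx)
  have t₃ : pairing (courant d₃ z₁ x) (σ₂ x) = 0 := by
    rw [cyc hd₃' hz₁' k₂]
    exact hLi x _ (b₂ W hWU hW z₁ hz₁ x hx) _ (hd₃'.2 x hx)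
  have t₄ : pairing (courant d₃ z₁ x) (z₂ x) = 0 := by
    rw [cyc hd₃' hz₁' hz₂']
    exact hLi x _ (b₃ W hWU hW z₁ z₂ hz₁ hz₂ x hx) _ (hd₃'.2 x hx)
  -- T(d₃, z₁, d₂) is the difference of T(d₃, z₁, σ₂) and T(d₃, z₁, z₂), both already zero.
  have t₅ : pairing (courant d₂ d₃ x) (z₁ x) = 0 := by
    rw [cyc hd₂' hd₃' hz₁']
    linarith [e₂ (courant d₃ z₁ x)]
  have t₆ : pairing (courant d₂ d₃ x) (d₁ x) = 0 :=
    (orth_eq_of_isDirac hD x).ge (hD.closed W d₂ d₃ hW hd₂ hd₃ x hx) _ (hd₁.2 x hx)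
  refine ⟨x, hxO, ?_⟩
  rw [e₃, t₁, add_zero, cyc k₁ k₂ hd₃', cyc k₂ hd₃' k₁, e₂, t₂, add_zero, cyc hd₃' k₁ hd₂',
    cyc k₁ hd₂' hd₃', e₁, t₅, t₆, add_zero]

/-- When all sections of D^S are compatible with S, the condition on two sections of S comes for
free, since S ⊂ D^S. -/
theorem isDirac_induced {D S : ∀ x : M, Submodule ℝ (GenTan E x)} (hD : IsDirac D)
    (hiso : ∀ x, IsIsotropic (S x)) (hS : HasLocalGenerators S)
    (hsub : IsSubbundle (induced D S))
    (b : ∀ V, IsOpen V → ∀ s σ, IsSectionOn S s V → IsSectionOn (induced D S) σ V → ∀ x ∈ V,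
      courant s σ x ∈ induced D S x) : IsDirac (induced D S) where
  subbundle := hsub
  maximal x := maximal_of_orth_eq (orth_induced (orth_eq_of_isDirac hD x) (hiso x))
  closed _ σ₁ σ₂ hU h₁ h₂ := courant_mem_induced hD hiso hS hsub.hasLocalGenerators hU h₁ h₂
    (fun V hV hVo s hs => b V hVo s σ₁ hs (h₁.mono hV))
    (fun V hV hVo s hs => b V hVo s σ₂ hs (h₂.mono hV))
    (fun V _ hVo s s' hs hs' => b V hVo s s' hs
      ⟨hs'.1, fun x hx => le_induced D S x (hs'.2 x hx)⟩)

omit [FiniteDimensional ℝ E] in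
theorem IsDistribution.exists_field {S : ∀ x : M, Submodule ℝ (Tan E x)} (hS : IsDistribution S)
    {p : M} {v : Tan E p} (hv : v ∈ S p) :
    ∃ (U : Set M) (Z : ∀ x : M, Tan E x), IsOpen U ∧ p ∈ U ∧ IsFieldIn S Z U ∧ Z p = v := by
  obtain ⟨U, σ, hU, hp, hσ, h⟩ := hS.hasLocalGenerators_tanPart.exists_section
    (v := (v, 0)) (mem_tanPart.2 ⟨hv, rfl⟩)
  exact ⟨U, fun x => (σ x).1, hU, hp, ⟨hσ.1.1, fun x hx => (mem_tanPart.1 (hσ.2 x hx)).1⟩,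
    congrArg Prod.fst h⟩

/-- The Dirac structure `D^{Φ⁰}`. -/
theorem isDirac_induced_annPart {D : ∀ x : M, Submodule ℝ (GenTan E x)} (hD : IsDirac D)
    {Φ : ∀ x : M, Submodule ℝ (Tan E x)} (hΦ : IsIntegrable Φ)
    (hsub : IsSubbundle (induced D (fun x => annPart (Φ x)))) :
    IsDirac (induced D (fun x => annPart (Φ x))) := by
  refine isDirac_induced hD (fun x => isIsotropic_annPart _) hΦ.1.hasLocalGenerators_annPart hsub ?_
  intro V hV s σ hs hσ x hx
  -- The bracket of `(0, α)` with `(X, ξ)` is `(0, -ι_X dα)`, which lies in Φ⁰: in `dα(X, Y) = X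
  -- α(Y) - Y α(X) - α([X, Y])` every term vanishes for X, Y in Φ, the last one by integrability.
  refine le_induced D (fun x => annPart (Φ x)) x (mem_annPart.2 ⟨?_, fun v hv => ?_⟩)
  · change VectorField.mlieBracket 𝓘(ℝ, E) (fun x => (s x).1) (fun x => (σ x).1) x = 0
    rw [mlieBracket_congr hV (X' := 0) (Y' := fun x => (σ x).1)
      (fun y hy => (mem_annPart.1 (hs.2 y hy)).1) (fun _ _ => rfl) hx,
      VectorField.mlieBracket_zero_left]
    rfl
  · have hs1 : ∀ y ∈ V, (s y).1 = 0 := fun y hy => (mem_annPart.1 (hs.2 y hy)).1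
    have hs2 : ∀ y ∈ V, (s y).2 ∈ ann (Φ y) := fun y hy => (mem_annPart.1 (hs.2 y hy)).2
    have hd : mvfderiv 𝓘(ℝ, E) (fun x => (σ x).2 (s x).1 - (s x).2 (σ x).1) x = 0 :=
      mvfderiv_eq_zero hV (fun y hy => by
        rw [hs1 y hy, map_zero, hs2 y hy _ (fst_mem_of_mem_induced (hσ.2 y hy)), sub_zero]) hx
    obtain ⟨W, Y, hW, hxW, hY, rfl⟩ := hΦ.1.exists_field hv
    have hVW := hV.inter hW
    have e := extD_apply' (p := x) hV hs.1.2 hVW (hσ.1.1.mono inter_subset_left)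
      (hY.1.mono inter_subset_right) hx ⟨hx, hxW⟩
    have z1 : mvfderiv 𝓘(ℝ, E) (fun x => (s x).2 (Y x)) x = 0 :=
      mvfderiv_eq_zero hVW (fun y hy => hs2 y hy.1 _ (hY.2 y hy.2)) ⟨hx, hxW⟩
    have z2 : mvfderiv 𝓘(ℝ, E) (fun x => (s x).2 (σ x).1) x = 0 :=
      mvfderiv_eq_zero hV (fun y hy => hs2 y hy _ (fst_mem_of_mem_induced (hσ.2 y hy))) hx
    have z3 := hs2 x hx _ (hΦ.2 (V ∩ W) (fun x => (σ x).1) Y hVW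
      ⟨hσ.1.1.mono inter_subset_left, fun y hy => fst_mem_of_mem_induced (hσ.2 y hy.1)⟩
      (hY.mono inter_subset_right) x ⟨hx, hxW⟩)
    simp only [courant]
    rw [hd, hs1 x hx, map_zero, smul_zero, add_zero, zero_sub, neg_apply, e, z1, z2, z3]
    simp

-- The contraction of the covector with a field of S vanishes identically, so the exact terms of the
-- bracket drop out and only Lie derivatives remain. This is why compatibility with S ⊂ TM is the
-- symmetry condition.
omit [FiniteDimensional ℝ E] in
theorem courant_of_tanPart {S : ∀ x : M, Submodule ℝ (Tan E x)} {s σ : ∀ x : M, GenTan E x}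
    {V : Set M} (hV : IsOpen V) (hs : IsSectionOn (fun x => tanPart (S x)) s V)
    (hσ : ∀ x ∈ V, (σ x).2 ∈ ann (S x)) {x : M} (hx : x ∈ V) :
    courant s σ x = (VectorField.mlieBracket 𝓘(ℝ, E) (fun x => (s x).1) (fun x => (σ x).1) x,
      lieForm (fun x => (s x).1) (fun x => (σ x).2) x) := by
  have hs1 : ∀ y ∈ V, (s y).1 ∈ S y := fun y hy => (mem_tanPart.1 (hs.2 y hy)).1
  have hs2 : ∀ y ∈ V, (s y).2 = 0 := fun y hy => (mem_tanPart.1 (hs.2 y hy)).2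
  have d1 : mvfderiv 𝓘(ℝ, E) (fun x => (σ x).2 (s x).1) x = 0 :=
    mvfderiv_eq_zero hV (fun y hy => hσ y hy _ (hs1 y hy)) hx
  have d2 : mvfderiv 𝓘(ℝ, E) (fun x => (σ x).2 (s x).1 - (s x).2 (σ x).1) x = 0 :=
    mvfderiv_eq_zero hV (fun y hy => by
      rw [hσ y hy _ (hs1 y hy), hs2 y hy, zero_apply, sub_zero]) hx
  have d3 : extD (fun x => (s x).2) x = 0 := by rw [extD_congr hV hs2 hx, extD_zero]
  refine Prod.ext rfl ?_
  simp only [courant, lieForm]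
  rw [d1, d2, d3]
  simp

omit [FiniteDimensional ℝ E] in
theorem IsFieldIn.isSectionOn {S : ∀ x : M, Submodule ℝ (Tan E x)} {Z : ∀ x : M, Tan E x}
    {V : Set M} (hZ : IsFieldIn S Z V) :
    IsSectionOn (fun x => tanPart (S x)) (fun x => (Z x, 0)) V :=
  ⟨⟨hZ.1, smoothFormOn_zero V⟩, fun x hx => mem_tanPart.2 ⟨hZ.2 x hx, rfl⟩⟩

omit [FiniteDimensional ℝ E] in
theorem IsSectionOn.isFieldIn {S : ∀ x : M, Submodule ℝ (Tan E x)} {s : ∀ x : M, GenTan E x}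
    {V : Set M} (hs : IsSectionOn (fun x => tanPart (S x)) s V) :
    IsFieldIn S (fun x => (s x).1) V :=
  ⟨hs.1.1, fun x hx => (mem_tanPart.1 (hs.2 x hx)).1⟩

/-- If `S` is a symmetry of `D^S` then `D^S` is a Dirac structure. -/
theorem isDirac_induced_tanPart {D : ∀ x : M, Submodule ℝ (GenTan E x)} (hD : IsDirac D)
    {S : ∀ x : M, Submodule ℝ (Tan E x)} (hS : IsIntegrable S)
    (hsub : IsSubbundle (induced D (fun x => tanPart (S x))))
    (hsym : IsSymmetry S (induced D (fun x => tanPart (S x)))) :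
    IsDirac (induced D (fun x => tanPart (S x))) := by
  refine isDirac_induced hD (fun x => isIsotropic_tanPart _) hS.1.hasLocalGenerators_tanPart hsub ?_
  intro V hV s σ hs hσ x hx
  rw [courant_of_tanPart hV hs (fun y hy => snd_mem_of_mem_induced (hσ.2 y hy)) hx]
  exact hsym V _ σ hV hs.isFieldIn hσ x hx

end InducedDirac
end
end DiracGeometry

namespace DiracGeometry

noncomputable section

/-! ### Poisson structures as graphs; the Dirac bracket formula. -/

section Poisson

variable {E : Type*} [NormedAddCommGroup E] [NormedSpace ℝ E] [FiniteDimensional ℝ E]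
  {M : Type*} [TopologicalSpace M] [ChartedSpace E M] [IsManifold 𝓘(ℝ, E) ∞ M]

omit [FiniteDimensional ℝ E] in
theorem smoothFieldOn_of_locally {X : ∀ x : M, Tan E x} {U : Set M}
    (h : ∀ x ∈ U, ∃ V, IsOpen V ∧ x ∈ V ∧ SmoothFieldOn X V) : SmoothFieldOn X U := fun x hx => by
  obtain ⟨V, hV, hxV, hXV⟩ := h x hx
  exact (ContMDiffOn.contMDiffAt hXV (hV.mem_nhds hxV)).contMDiffWithinAt

/-- The map whose graph is a smooth subbundle is smooth. -/
theorem IsGraph.smooth {D : ∀ x : M, Submodule ℝ (GenTan E x)} (hD : HasLocalGenerators D)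
    {P : ∀ x : M, Cot E x →ₗ[ℝ] Tan E x} (hP : IsGraph D P) {U : Set M} {ξ : ∀ x : M, Cot E x}
    (hU : IsOpen U) (hξ : SmoothFormOn ξ U) : SmoothFieldOn (fun x => P x (ξ x)) U := by
  refine smoothFieldOn_of_locally fun p hp => ?_
  obtain ⟨k, V, σ, hV, hpV, hσ, hspan⟩ := hD p
  -- The covector components of local generators. As D is a graph they span T*M, so the rank is
  -- constant and `ξ` is a smooth combination of them. The same combination of the vector components
  -- is `P ξ`.
  let σ' : Fin k → ∀ x : M, GenTan E x := fun i x => (0, (σ i x).2)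
  have hspan' : ∀ x ∈ U ∩ V, Submodule.span ℝ (range fun i => σ' i x) =
      LinearMap.range (LinearMap.inr ℝ (Tan E x) (Cot E x)) := by
    intro x hx
    have h1 : Submodule.span ℝ (range fun i => σ' i x) =
        (D x).map ((LinearMap.inr ℝ (Tan E x) (Cot E x)).comp
          (LinearMap.snd ℝ (Tan E x) (Cot E x))) := by
      rw [← hspan x hx.2, Submodule.map_span, ← range_comp]
      rfl
    rw [h1]
    refine le_antisymm ?_ ?_
    · rintro _ ⟨v, -, rfl⟩
      exact ⟨v.2, rfl⟩
    · rintro _ ⟨η, rfl⟩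
      exact ⟨(P x η, η), (hP x _).2 rfl, rfl⟩
  have hrank : ∀ x ∈ U ∩ V, Module.finrank ℝ (Submodule.span ℝ (range fun i => σ' i x)) =
      Module.finrank ℝ E := by
    intro x hx
    rw [hspan' x hx, LinearMap.finrank_range_of_inj LinearMap.inr_injective, finrank_cot]
  obtain ⟨O, hOV, hO, hpO, h⟩ := exists_smooth_coeff_gen (hU.inter hV) (σ := σ')
    (fun i => ⟨smoothFieldOn_zero _, (hσ i).2.mono inter_subset_right⟩) ⟨hp, hpV⟩
    (fun x hx => by rw [hrank x hx, hrank p ⟨hp, hpV⟩])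
  obtain ⟨c, hc, hcξ⟩ := h (fun x => (0, ξ x))
    ⟨smoothFieldOn_zero _, hξ.mono fun x hx => (hOV hx).1⟩ (fun x hx => by
      rw [hspan' x (hOV hx)]
      exact ⟨ξ x, rfl⟩)
  refine ⟨O, hO, hpO, (SmoothFieldOn.sum Finset.univ fun i => ((hσ i).1.mono fun x hx =>
    (hOV hx).2).smul (hc i)).congr fun x hx => ?_⟩
  have hmem : (∑ i, c i x • σ i x) ∈ D x := by
    rw [← hspan x (hOV hx).2]
    exact Submodule.sum_mem _ fun i _ =>
      Submodule.smul_mem _ _ (Submodule.subset_span (mem_range_self i))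
  have h1 := (hP x _).1 hmem
  have h2 : ξ x = (∑ i, c i x • σ i x).2 := by
    have := congrArg Prod.snd (hcξ x hx)
    rw [Prod.snd_sum] at this ⊢
    exact this
  rw [h2, ← h1, Prod.fst_sum]
  rfl

/-- A Dirac structure is Poisson if and only if it meets the tangent bundle trivially. -/
theorem isPoisson_iff {D : ∀ x : M, Submodule ℝ (GenTan E x)} (hD : IsDirac D) :
    IsPoisson D ↔ ∀ x, D x ⊓ tanPart ⊤ = ⊥ := by
  constructor
  · rintro ⟨P, -, hP⟩
    exact hP.inf_tanPart
  · intro h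
    choose P hP using fun x => exists_graph (orth_eq_of_isDirac hD x) (h x)
    have hg : IsGraph D P := hP
    have hiso : ∀ x, IsIsotropic (D x) := fun x => (hD.maximal x).1
    refine ⟨P, ⟨fun x α β => ?_, fun U ξ hU hξ => hg.smooth hD.subbundle.hasLocalGenerators hU hξ,
      fun f g h hf hg' hh x => ?_⟩, hg⟩
    · exact eq_neg_of_add_eq_zero_left
        (hiso x (P x α, α) ((hP x _).2 rfl) (P x β, β) ((hP x _).2 rfl))
    · let s : (M → ℝ) → ∀ x : M, GenTan E x := fun f x =>
        (P x (mvfderiv 𝓘(ℝ, E) f x), mvfderiv 𝓘(ℝ, E) f x)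
      have hs : ∀ f : M → ℝ, ContMDiff 𝓘(ℝ, E) 𝓘(ℝ, ℝ) ∞ f → IsSectionOn D (s f) univ := fun f hf =>
        ⟨⟨hg.smooth hD.subbundle.hasLocalGenerators isOpen_univ
          (smoothFormOn_mvfderiv isOpen_univ hf.contMDiffOn),
          smoothFormOn_mvfderiv isOpen_univ hf.contMDiffOn⟩, fun x _ => (hP x _).2 rfl⟩
      have hx : x ∈ (univ : Set M) := trivial
      have h0 : pairing (courant (s f) (s g) x) (s h x) = 0 :=
        hiso x _ (hD.closed univ (s f) (s g) isOpen_univ (hs f hf) (hs g hg') x hx) _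
          ((hs h hh).2 x hx)
      rw [pairing_courant isOpen_univ (hs f hf).1 (hs g hg').1 (hs h hh).1
        (fun y hy => hiso y _ ((hs f hf).2 y hy) _ ((hs g hg').2 y hy))
        (fun y hy => hiso y _ ((hs f hf).2 y hy) _ ((hs h hh).2 y hy)) hx] at h0
      have e1 := mvfderiv_mlieBracket isOpen_univ hf.contMDiffOn (hs g hg').1.1 (hs h hh).1.1 hx
      have e2 := mvfderiv_mlieBracket isOpen_univ hg'.contMDiffOn (hs h hh).1.1 (hs f hf).1.1 hx
      have e3 := mvfderiv_mlieBracket isOpen_univ hh.contMDiffOn (hs f hf).1.1 (hs g hg').1.1 hx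
      change mvfderiv 𝓘(ℝ, E) (fun x => mvfderiv 𝓘(ℝ, E) h x (s g x).1) x (s f x).1 +
        mvfderiv 𝓘(ℝ, E) (fun x => mvfderiv 𝓘(ℝ, E) f x (s h x).1) x (s g x).1 +
        mvfderiv 𝓘(ℝ, E) (fun x => mvfderiv 𝓘(ℝ, E) g x (s f x).1) x (s h x).1 = 0
      change mvfderiv 𝓘(ℝ, E) f x (VectorField.mlieBracket 𝓘(ℝ, E) (fun x => (s g x).1)
          (fun x => (s h x).1) x) + mvfderiv 𝓘(ℝ, E) g x (VectorField.mlieBracket 𝓘(ℝ, E)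
          (fun x => (s h x).1) (fun x => (s f x).1) x) + mvfderiv 𝓘(ℝ, E) h x
          (VectorField.mlieBracket 𝓘(ℝ, E) (fun x => (s f x).1) (fun x => (s g x).1) x) +
        mvfderiv 𝓘(ℝ, E) (fun x => mvfderiv 𝓘(ℝ, E) g x (s h x).1) x (s f x).1 +
        mvfderiv 𝓘(ℝ, E) (fun x => mvfderiv 𝓘(ℝ, E) h x (s f x).1) x (s g x).1 +
        mvfderiv 𝓘(ℝ, E) (fun x => mvfderiv 𝓘(ℝ, E) f x (s g x).1) x (s h x).1 = 0 at h0
      rw [e1, e2, e3] at h0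
      linarith

omit [IsManifold 𝓘(ℝ, E) ∞ M] in
/-- The Dirac bracket formula. -/
theorem bracket_induced {D : ∀ x : M, Submodule ℝ (GenTan E x)}
    {Φ : ∀ x : M, Submodule ℝ (Tan E x)} {P P' : ∀ x : M, Cot E x →ₗ[ℝ] Tan E x}
    (hP : IsGraph D P) (hP' : IsGraph (induced D (fun x => annPart (Φ x))) P')
    {x : M} {k : ℕ} {φ : Fin k → M → ℝ}
    (hspan : Submodule.span ℝ (Set.range fun a => mvfderiv 𝓘(ℝ, E) (φ a) x) = ann (Φ x))
    (hC : IsUnit (Matrix.of fun a b => bracket P (φ a) (φ b) x).det) (f g : M → ℝ) :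
    bracket P' f g x = bracket P f g x - ∑ a, ∑ b,
      bracket P f (φ a) x * (Matrix.of fun a b => bracket P (φ a) (φ b) x)⁻¹ a b *
        bracket P (φ b) g x := by
  set C := Matrix.of fun a b => bracket P (φ a) (φ b) x with hCdef
  have hw : ((P' x (mvfderiv 𝓘(ℝ, E) f x), mvfderiv 𝓘(ℝ, E) f x) : GenTan E x) ∈
      induced D (fun x => annPart (Φ x)) x := (hP' x _).2 rfl
  -- The covector `df` is corrected by an element of Φ⁰ so that its Hamiltonian vector becomes
  -- tangent to Φ. The coefficients `l` of the correction are Lagrange multipliers.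
  obtain ⟨d, ⟨hdD, hdo⟩, a, ha, hda⟩ := Submodule.mem_sup.1 hw
  obtain ⟨ha1, ha2⟩ := mem_annPart.1 ha
  rw [← hspan, Submodule.mem_span_range_iff_exists_fun] at ha2
  obtain ⟨l, hl⟩ := ha2
  have hd1 : P' x (mvfderiv 𝓘(ℝ, E) f x) = P x d.2 := by
    rw [← (hP x d).1 hdD]
    have := congrArg Prod.fst hda
    rw [Prod.fst_add, ha1, add_zero] at this
    exact this.symm
  have hdΦ : d.1 ∈ Φ x := mem_orth_annPart.1 hdo
  have hd2 : d.2 = mvfderiv 𝓘(ℝ, E) f x - ∑ a, l a • mvfderiv 𝓘(ℝ, E) (φ a) x := by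
    rw [hl]
    exact eq_sub_of_add_eq (congrArg Prod.snd hda)
  have hPd : P x d.2 = P x (mvfderiv 𝓘(ℝ, E) f x) -
      ∑ a, l a • P x (mvfderiv 𝓘(ℝ, E) (φ a) x) := by
    rw [hd2, map_sub, map_sum]
    simp only [map_smul]
  -- Tangency means that every `dφ^b` kills the corrected vector: a linear system for the
  -- multipliers with matrix `C`.
  have hv : (fun b => bracket P f (φ b) x) = Matrix.vecMul l C := by
    ext b
    have h0 : mvfderiv 𝓘(ℝ, E) (φ b) x (P x d.2) = 0 := by
      rw [← (hP x d).1 hdD]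
      have : mvfderiv 𝓘(ℝ, E) (φ b) x ∈ ann (Φ x) :=
        hspan.le (Submodule.subset_span (mem_range_self b))
      exact this _ hdΦ
    rw [hPd, map_sub, map_sum, sub_eq_zero] at h0
    simp only [map_smul, smul_eq_mul] at h0
    exact h0
  have hl' : l = Matrix.vecMul (fun b => bracket P f (φ b) x) C⁻¹ := by
    rw [hv, Matrix.vecMul_vecMul, Matrix.mul_nonsing_inv _ hC, Matrix.vecMul_one]
  have hfin : bracket P' f g x = bracket P f g x - ∑ b, l b * bracket P (φ b) g x := by
    change mvfderiv 𝓘(ℝ, E) g x (P' x (mvfderiv 𝓘(ℝ, E) f x)) = _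
    rw [hd1, hPd, map_sub, map_sum]
    simp only [map_smul, smul_eq_mul]
    rfl
  rw [hfin, Finset.sum_comm]
  congr 1
  refine Finset.sum_congr rfl fun b _ => ?_
  conv_lhs => rw [hl']
  rw [Matrix.vecMul, dotProduct, Finset.sum_mul]

-- A vector of V in D + V⁰ arises as (Pα, α) + (0, -α) with α in V⁰.
omit [FiniteDimensional ℝ E] [IsManifold 𝓘(ℝ, E) ∞ M] in
theorem IsGraph.sup_annPart_inf_tanPart {D : ∀ x : M, Submodule ℝ (GenTan E x)}
    {P : ∀ x : M, Cot E x →ₗ[ℝ] Tan E x} (hP : IsGraph D P) {x : M}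
    (V : Submodule ℝ (Tan E x)) :
    (D x ⊔ annPart V) ⊓ tanPart V = ⊥ ↔ (ann V).map (P x) ⊓ V = ⊥ := by
  rw [Submodule.eq_bot_iff, Submodule.eq_bot_iff]
  constructor
  · rintro h _ ⟨⟨α, hα, rfl⟩, hV⟩
    have := h (P x α, 0) ⟨?_, mem_tanPart.2 ⟨hV, rfl⟩⟩
    · exact congrArg Prod.fst this
    · refine Submodule.mem_sup.2 ⟨(P x α, α), (hP x _).2 rfl, (0, -α),
        mem_annPart.2 ⟨rfl, (ann V).neg_mem hα⟩, ?_⟩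
      simp
  · rintro h v ⟨hv, hvt⟩
    obtain ⟨hv1, hv2⟩ := mem_tanPart.1 hvt
    obtain ⟨d, hd, a, ha, rfl⟩ := Submodule.mem_sup.1 hv
    obtain ⟨ha1, ha2⟩ := mem_annPart.1 ha
    rw [Prod.fst_add, ha1, add_zero] at hv1
    have hd2 : d.2 = -a.2 := eq_neg_of_add_eq_zero_left hv2
    have hd1 : d.1 = 0 := h _ ⟨⟨d.2, hd2 ▸ (ann V).neg_mem ha2, ((hP x d).1 hd).symm⟩, hv1⟩
    exact Prod.ext (by rw [Prod.fst_add, hd1, ha1, add_zero]; rfl) hv2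

variable {F : Type*} [NormedAddCommGroup F] [NormedSpace ℝ F]
  {N : Type*} [TopologicalSpace N] [ChartedSpace F N]

-- If `(u, 0)` lies in the pullback, its covector ξ upstairs kills TN = Φ. Then `(0, ξ)` is in Φ⁰ ⊂
-- D^{Φ⁰} and can be subtracted, leaving `(i_* u, 0)`.
omit [IsManifold 𝓘(ℝ, E) ∞ M] in
theorem pullback_induced_inf_tanPart {D : ∀ x : M, Submodule ℝ (GenTan E x)}
    {Φ : ∀ x : M, Submodule ℝ (Tan E x)} {i : N → M} (hi : IsIntegralManifold (F := F) Φ i)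
    (y : N) :
    pullback (F := F) i (induced D (fun x => annPart (Φ x))) y ⊓ tanPart ⊤ = ⊥ ↔
      (D (i y) ⊔ annPart (tanRange E F i y)) ⊓ tanPart (tanRange E F i y) = ⊥ := by
  rw [hi.tangent y, ← induced_inf_tanPart, inf_tanPart_eq_bot_iff, inf_tanPart_eq_bot_iff]
  constructor
  · intro h X hX
    have hXΦ : X ∈ tanRange E F i y := by
      rw [hi.tangent y]
      exact fst_mem_of_mem_induced hX
    obtain ⟨u, rfl⟩ := hXΦ
    rw [h u ⟨0, hX, by simp⟩, map_zero]
  · rintro h u ⟨ξ, h1, h2⟩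
    have hξ : ξ ∈ ann (Φ (i y)) := by
      rw [← hi.tangent y]
      rintro _ ⟨u', rfl⟩
      exact (DFunLike.congr_fun h2 u').symm
    have h3 : ((0, ξ) : GenTan E (i y)) ∈ induced D (fun x => annPart (Φ x)) (i y) :=
      le_induced D (fun x => annPart (Φ x)) (i y) (mem_annPart.2 ⟨rfl, hξ⟩)
    have h4 := Submodule.sub_mem _ h1 h3
    rw [Prod.mk_sub_mk, sub_zero, sub_self] at h4
    exact hi.immersion y (by rw [h _ h4, map_zero])

end Poisson
end
end DiracGeometry

namespace DiracGeometry

noncomputable section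

/-! ### Projectable sections and their brackets. -/

section Projectable

variable {E : Type*} [NormedAddCommGroup E] [NormedSpace ℝ E] [FiniteDimensional ℝ E]
  {M : Type*} [TopologicalSpace M] [ChartedSpace E M] [IsManifold 𝓘(ℝ, E) ∞ M]

omit [FiniteDimensional ℝ E] in
theorem lieForm_apply {Z Y : ∀ x : M, Tan E x} {ξ : ∀ x : M, Cot E x} {U : Set M}
    (hU : IsOpen U) (hZ : SmoothFieldOn Z U) (hξ : SmoothFormOn ξ U) (hY : SmoothFieldOn Y U)
    {p : M} (hp : p ∈ U) :
    lieForm Z ξ p (Y p) = mvfderiv 𝓘(ℝ, E) (fun x => ξ x (Y x)) p (Z p) -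
      ξ p (VectorField.mlieBracket 𝓘(ℝ, E) Z Y p) := by
  rw [lieForm, add_apply, extD_apply hU hξ hZ hY hp]
  ring

theorem mlieBracket_jacobi {X Y Z : ∀ x : M, Tan E x} {U : Set M} (hU : IsOpen U)
    (hX : SmoothFieldOn X U) (hY : SmoothFieldOn Y U) (hZ : SmoothFieldOn Z U) {p : M}
    (hp : p ∈ U) :
    VectorField.mlieBracket 𝓘(ℝ, E) Z (VectorField.mlieBracket 𝓘(ℝ, E) X Y) p =
      VectorField.mlieBracket 𝓘(ℝ, E) (VectorField.mlieBracket 𝓘(ℝ, E) Z X) Y p +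
      VectorField.mlieBracket 𝓘(ℝ, E) X (VectorField.mlieBracket 𝓘(ℝ, E) Z Y) p := by
  have : IsManifold 𝓘(ℝ, E) (minSmoothness ℝ 3) M :=
    IsManifold.of_le (n := ∞) (by simpa using ENat.LEInfty.out)
  have hle : (minSmoothness ℝ 2 : WithTop ℕ∞) ≤ ∞ := by simpa using ENat.LEInfty.out
  have h : ∀ {W : ∀ x : M, Tan E x}, SmoothFieldOn W U →
      ContMDiffAt 𝓘(ℝ, E) (𝓘(ℝ, E).prod 𝓘(ℝ, E)) (minSmoothness ℝ 2)
        (fun x => Bundle.TotalSpace.mk' E (E := fun x : M => TangentSpace 𝓘(ℝ, E) x) x (W x)) p :=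
    fun hW => (ContMDiffOn.contMDiffAt hW (hU.mem_nhds hp)).of_le hle
  exact VectorField.leibniz_identity_mlieBracket_apply (h hZ) (h hX) (h hY)

variable {S : ∀ x : M, Submodule ℝ (Tan E x)} {D : ∀ x : M, Submodule ℝ (GenTan E x)}

-- By projectability the bracket with a field Z of S is `([Z, X], 0)` with `[Z, X]` in S, so it lies
-- in S ⊂ D^S. This is the hypothesis needed by `courant_mem_induced`.
omit [FiniteDimensional ℝ E] in
theorem IsProjectableOn.courant_mem {σ : ∀ x : M, GenTan E x} {U : Set M}
    (h : IsProjectableOn S (induced D (fun x => tanPart (S x))) σ U) {V : Set M} (hVU : V ⊆ U)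
    (hV : IsOpen V) {s : ∀ x : M, GenTan E x} (hs : IsSectionOn (fun x => tanPart (S x)) s V)
    {x : M} (hx : x ∈ V) : courant s σ x ∈ induced D (fun x => tanPart (S x)) x := by
  obtain ⟨h1, h2⟩ := h.2.2 V _ hV hVU hs.isFieldIn x hx
  rw [courant_of_tanPart hV hs (fun y hy => h.2.1 y (hVU hy)) hx, h2]
  exact le_induced D (fun x => tanPart (S x)) x (mem_tanPart.2 ⟨h1, rfl⟩)

/-- If every element of `D^S` extends to a projectable section then `S` is a symmetry. -/
theorem isSymmetry_of_projectable (hD : IsDirac D)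
    (hsub : IsSubbundle (induced D (fun x => tanPart (S x))))
    (h : ∀ (p : M), ∀ v ∈ induced D (fun x => tanPart (S x)) p,
      ∃ (U : Set M) (σ : ∀ x : M, GenTan E x), IsOpen U ∧ p ∈ U ∧
        IsProjectableOn S (induced D (fun x => tanPart (S x))) σ U ∧ σ p = v) :
    IsSymmetry S (induced D (fun x => tanPart (S x))) := by
  intro U Z σ hU hZ hσ p hp
  have hL : ∀ x, orth (induced D (fun x => tanPart (S x)) x) =
      induced D (fun x => tanPart (S x)) x := fun x =>
    orth_induced (orth_eq_of_isDirac hD x) (isIsotropic_tanPart _)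
  have hLi : ∀ x, IsIsotropic (induced D (fun x => tanPart (S x)) x) := fun x => (hL x).ge
  have e := courant_of_tanPart hU hZ.isSectionOn
    (fun y hy => snd_mem_of_mem_induced (hσ.2 y hy)) hp
  rw [← e]
  refine mem_of_pairing_eq_zero (hL p) fun w hw => ?_
  obtain ⟨U₃, σ₃, hU₃, hp₃, h₃, rfl⟩ := hsub.exists_section hw
  obtain ⟨U', σ', hU', hp', hσ', hpσ⟩ := h p (σ p) (hσ.2 p hp)
  have hV := (hU.inter hU').inter hU₃
  have hs := hZ.isSectionOn.mono (V := U ∩ U' ∩ U₃) fun x hx => hx.1.1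
  have hs' : IsSectionOn (induced D (fun x => tanPart (S x)))
      (fun x => ((Z x, 0) : GenTan E x)) (U ∩ U' ∩ U₃) :=
    ⟨hs.1, fun x hx => le_induced D (fun x => tanPart (S x)) x (hs.2 x hx)⟩
  -- Tensoriality allows σ to be replaced by a projectable section with the same value at `p`.
  rw [pairing_courant_congr hLi hV hs' (hσ.mono fun x hx => hx.1.1) (h₃.mono fun x hx => hx.2)
    hs' (hσ'.1.mono fun x hx => hx.1.2) ⟨⟨hp, hp'⟩, hp₃⟩ rfl hpσ.symm]
  exact hLi p _ (hσ'.courant_mem (fun x hx => hx.1.2) hV hs ⟨⟨hp, hp'⟩, hp₃⟩) _ hw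

-- The bracket's one-form in terms of contractions and Lie brackets, the shape in which it can be
-- differentiated along S. Isotropy merges the exact term with those coming from the exterior
-- derivatives.
omit [FiniteDimensional ℝ E] in
theorem snd_courant_apply {σ σ' : ∀ x : M, GenTan E x} {Y : ∀ x : M, Tan E x} {U : Set M}
    (hU : IsOpen U) (hσ : SmoothGenOn σ U) (hσ' : SmoothGenOn σ' U) (hY : SmoothFieldOn Y U)
    (h : ∀ x ∈ U, pairing (σ x) (σ' x) = 0) {p : M} (hp : p ∈ U) :
    (courant σ σ' p).2 (Y p) =
      mvfderiv 𝓘(ℝ, E) (fun x => (σ' x).2 (Y x)) p (σ p).1 -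
      mvfderiv 𝓘(ℝ, E) (fun x => (σ x).2 (Y x)) p (σ' p).1 +
      mvfderiv 𝓘(ℝ, E) (fun x => (σ x).2 (σ' x).1) p (Y p) -
      (σ' p).2 (VectorField.mlieBracket 𝓘(ℝ, E) (fun x => (σ x).1) Y p) +
      (σ p).2 (VectorField.mlieBracket 𝓘(ℝ, E) (fun x => (σ' x).1) Y p) := by
  have e1 := extD_apply hU hσ'.2 hσ.1 hY hp
  have e2 := extD_apply hU hσ.2 hσ'.1 hY hp
  have c1 : mvfderiv 𝓘(ℝ, E) (fun x => (σ' x).2 (σ x).1) p =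
      -mvfderiv 𝓘(ℝ, E) (fun x => (σ x).2 (σ' x).1) p := by
    rw [← mvfderiv_neg]
    exact mvfderiv_congr hU (fun x hx => eq_neg_of_add_eq_zero_left (h x hx)) hp
  have c3 : mvfderiv 𝓘(ℝ, E) (fun x => (σ' x).2 (σ x).1 - (σ x).2 (σ' x).1) p =
      (-2 : ℝ) • mvfderiv 𝓘(ℝ, E) (fun x => (σ x).2 (σ' x).1) p := by
    have := mvfderiv_sub (mdifferentiableAt_of_smoothOn hU (hσ'.2.apply hσ.1) hp)
      (mdifferentiableAt_of_smoothOn hU (hσ.2.apply hσ'.1) hp)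
    rw [c1] at this
    refine Eq.trans this ?_
    module
  simp only [courant, add_apply, sub_apply, smul_apply, smul_eq_mul]
  rw [e1, e2, c3, c1]
  simp only [neg_apply, smul_apply, smul_eq_mul]
  ring

omit [FiniteDimensional ℝ E] in
theorem mvfderiv_mlieBracket_congr {f g : M → ℝ} {X Y : ∀ x : M, Tan E x} {U : Set M}
    (hU : IsOpen U) (hf : ContMDiffOn 𝓘(ℝ, E) 𝓘(ℝ, ℝ) ∞ f U) (hX : SmoothFieldOn X U)
    (hY : SmoothFieldOn Y U) (hg : ∀ x ∈ U, mvfderiv 𝓘(ℝ, E) f x (X x) = g x) {p : M}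
    (hp : p ∈ U) :
    mvfderiv 𝓘(ℝ, E) (fun x => mvfderiv 𝓘(ℝ, E) f x (Y x)) p (X p) =
      mvfderiv 𝓘(ℝ, E) f p (VectorField.mlieBracket 𝓘(ℝ, E) X Y p) +
      mvfderiv 𝓘(ℝ, E) g p (Y p) := by
  rw [mvfderiv_mlieBracket hU hf hX hY hp, mvfderiv_congr hU hg hp]
  ring

-- The condition L_Z ξ = 0 as a computation rule: Z passes through ξ and acts on Y alone.
omit [FiniteDimensional ℝ E] in
theorem IsProjectableOn.mvfderiv_apply {σ : ∀ x : M, GenTan E x} {U : Set M}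
    {L : ∀ x : M, Submodule ℝ (GenTan E x)}
    (h : IsProjectableOn S L σ U) {V : Set M} (hVU : V ⊆ U)
    (hV : IsOpen V) {Z Y : ∀ x : M, Tan E x} (hZ : IsFieldIn S Z V) (hY : SmoothFieldOn Y V)
    {x : M} (hx : x ∈ V) :
    mvfderiv 𝓘(ℝ, E) (fun x => (σ x).2 (Y x)) x (Z x) =
      (σ x).2 (VectorField.mlieBracket 𝓘(ℝ, E) Z Y x) := by
  have e := lieForm_apply hV hZ.1 (h.1.1.2.mono hVU) hY hx
  rw [(h.2.2 V Z hV hVU hZ x hx).2, zero_apply] at e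
  linarith

omit [FiniteDimensional ℝ E] [IsManifold 𝓘(ℝ, E) ∞ M] in
theorem mvfderiv_five {a b c d e : M → ℝ} {O : Set M} (hO : IsOpen O)
    (ha : ContMDiffOn 𝓘(ℝ, E) 𝓘(ℝ, ℝ) ∞ a O) (hb : ContMDiffOn 𝓘(ℝ, E) 𝓘(ℝ, ℝ) ∞ b O)
    (hc : ContMDiffOn 𝓘(ℝ, E) 𝓘(ℝ, ℝ) ∞ c O) (hd : ContMDiffOn 𝓘(ℝ, E) 𝓘(ℝ, ℝ) ∞ d O)
    (he : ContMDiffOn 𝓘(ℝ, E) 𝓘(ℝ, ℝ) ∞ e O) {x : M} (hx : x ∈ O) (v : Tan E x) :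
    mvfderiv 𝓘(ℝ, E) (fun y => a y - b y + c y - d y + e y) x v =
      mvfderiv 𝓘(ℝ, E) a x v - mvfderiv 𝓘(ℝ, E) b x v + mvfderiv 𝓘(ℝ, E) c x v -
        mvfderiv 𝓘(ℝ, E) d x v + mvfderiv 𝓘(ℝ, E) e x v := by
  have md := fun {f : M → ℝ} (hf : ContMDiffOn 𝓘(ℝ, E) 𝓘(ℝ, ℝ) ∞ f O) =>
    mdifferentiableAt_of_smoothOn hO hf hx
  have a1 := mvfderiv_add (md (((ha.sub hb).add hc).sub hd)) (md he)
  have a2 := mvfderiv_sub (md ((ha.sub hb).add hc)) (md hd)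
  have a3 := mvfderiv_add (md (ha.sub hb)) (md hc)
  have a4 := mvfderiv_sub (md ha) (md hb)
  have h := congrArg (fun l : Cot E x => l v) (a1.trans
    (congrArg (· + _) (a2.trans (congrArg (· - _) (a3.trans (congrArg (· + _) a4))))))
  exact h

/-- The Courant bracket of two projectable sections is projectable. -/
theorem IsProjectableOn.courant (hD : IsDirac D) (hS : IsIntegrable S)
    (hsub : IsSubbundle (induced D (fun x => tanPart (S x)))) {U : Set M} (hU : IsOpen U)
    {σ σ' : ∀ x : M, GenTan E x}
    (hσ : IsProjectableOn S (induced D (fun x => tanPart (S x))) σ U)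
    (hσ' : IsProjectableOn S (induced D (fun x => tanPart (S x))) σ' U) :
    IsProjectableOn S (induced D (fun x => tanPart (S x))) (courant σ σ') U := by
  have hLi : ∀ x, IsIsotropic (induced D (fun x => tanPart (S x)) x) := fun x =>
    (orth_induced (orth_eq_of_isDirac hD x) (isIsotropic_tanPart _)).ge
  have hiso : ∀ x ∈ U, pairing (σ x) (σ' x) = 0 := fun x hx =>
    hLi x _ (hσ.1.2 x hx) _ (hσ'.1.2 x hx)
  have hmem : ∀ x ∈ U, DiracGeometry.courant σ σ' x ∈ induced D (fun x => tanPart (S x)) x := by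
    refine courant_mem_induced hD (fun x => isIsotropic_tanPart _) hS.1.hasLocalGenerators_tanPart
      hsub.hasLocalGenerators hU hσ.1 hσ'.1 (fun V hVU hV s hs x hx => hσ.courant_mem hVU hV hs hx)
      (fun V hVU hV s hs x hx => hσ'.courant_mem hVU hV hs hx) ?_
    intro V hVU hV s s' hs hs' x hx
    have hs2 : ∀ y ∈ V, (s' y).2 = 0 := fun y hy => (mem_tanPart.1 (hs'.2 y hy)).2
    rw [courant_of_tanPart hV hs (fun y hy => by
      rw [hs2 y hy]
      exact (ann (S y)).zero_mem) hx]
    refine le_induced D (fun x => tanPart (S x)) x (mem_tanPart.2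
      ⟨hS.2 V _ _ hV hs.isFieldIn hs'.isFieldIn x hx, ?_⟩)
    have d1 : mvfderiv 𝓘(ℝ, E) (fun x => (s' x).2 (s x).1) x = 0 :=
      mvfderiv_eq_zero hV (fun y hy => by rw [hs2 y hy, zero_apply]) hx
    simp only [lieForm]
    rw [d1, extD_congr hV hs2 hx, extD_zero]
    simp
  refine ⟨⟨SmoothGenOn.courant hU hσ.1.1 hσ'.1.1, hmem⟩,
    fun x hx => snd_mem_of_mem_induced (hmem x hx), fun V Z hV hVU hZ x hx => ?_⟩
  have hX := hσ.1.1.1.mono hVU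
  have hX' := hσ'.1.1.1.mono hVU
  have hξ := hσ.1.1.2.mono hVU
  have hξ' := hσ'.1.1.2.mono hVU
  have hW : IsFieldIn S (VectorField.mlieBracket 𝓘(ℝ, E) Z fun y => (σ y).1) V :=
    ⟨SmoothFieldOn.mlieBracket hV hZ.1 hX, fun y hy => (hσ.2.2 V Z hV hVU hZ y hy).1⟩
  have hW' : IsFieldIn S (VectorField.mlieBracket 𝓘(ℝ, E) Z fun y => (σ' y).1) V :=
    ⟨SmoothFieldOn.mlieBracket hV hZ.1 hX', fun y hy => (hσ'.2.2 V Z hV hVU hZ y hy).1⟩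
  constructor
  · change VectorField.mlieBracket 𝓘(ℝ, E) Z (VectorField.mlieBracket 𝓘(ℝ, E) (fun y => (σ y).1)
      (fun y => (σ' y).1)) x ∈ S x
    -- By Jacobi both terms are brackets of a projectable section with `[Z, X]` or `[Z, X']`, which
    -- are again fields of S.
    rw [mlieBracket_jacobi hV hX hX' hZ.1 hx]
    refine Submodule.add_mem _ (hσ'.2.2 V _ hV hVU hW x hx).1 ?_
    rw [VectorField.mlieBracket_swap_apply]
    exact Submodule.neg_mem _ (hσ.2.2 V _ hV hVU hW' x hx).1
  · ext v
    obtain ⟨Y, hY, rfl⟩ := exists_smoothFieldOn x v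
    let O := V ∩ (chartAt E x).source
    have hO : IsOpen O := hV.inter (chartAt E x).open_source
    have hOV : O ⊆ V := inter_subset_left
    have hOU : O ⊆ U := hOV.trans hVU
    have hxO : x ∈ O := ⟨hx, mem_chart_source E x⟩
    replace hY : SmoothFieldOn Y O := hY.mono inter_subset_right
    have hZO := hZ.mono hOV
    have hZY : SmoothFieldOn (VectorField.mlieBracket 𝓘(ℝ, E) Z Y) O :=
      SmoothFieldOn.mlieBracket hO hZO.1 hY
    have gX := hX.mono hOV
    have gX' := hX'.mono hOV
    have gξ := hξ.mono hOV
    have gξ' := hξ'.mono hOV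
    have hXY := SmoothFieldOn.mlieBracket hO gX hY
    have hXY' := SmoothFieldOn.mlieBracket hO gX' hY
    have gc := SmoothGenOn.courant hU hσ.1.1 hσ'.1.1
    rw [lieForm_apply hO hZO.1 (gc.2.mono hOU) hY hxO, zero_apply,
      snd_courant_apply (Y := VectorField.mlieBracket 𝓘(ℝ, E) Z Y) hO (hσ.1.1.mono hOU)
        (hσ'.1.1.mono hOU) hZY (fun y hy => hiso y (hOU hy)) hxO,
      mvfderiv_congr hO (fun y hy => snd_courant_apply hO (hσ.1.1.mono hOU)
        (hσ'.1.1.mono hOU) hY (fun z hz => hiso z (hOU hz)) hy) hxO]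
    have s1 := smoothOn_mvfderiv hO (gξ'.apply hY) gX
    have s2 := smoothOn_mvfderiv hO (gξ.apply hY) gX'
    have s3 := smoothOn_mvfderiv hO (gξ.apply gX') hY
    have s4 := gξ'.apply hXY
    have s5 := gξ.apply hXY'
    rw [mvfderiv_five hO s1 s2 s3 s4 s5 hxO]
    -- Z is applied to the five terms of the bracket's form on Y. `t1` to `t5` move Z inside each
    -- term; the third gives zero because ξ kills `[Z, X']`. `w1` and `w2` use invariance along the
    -- fields `[Z, X]` and `[Z, X']` of S, and `j1`, `j2` are Jacobi. Everything then cancels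
    -- linearly.
    have t1 := mvfderiv_mlieBracket_congr hO (gξ'.apply hY) hZO.1 gX
      (fun y hy => hσ'.mvfderiv_apply hOU hO hZO hY hy) hxO
    have t2 := mvfderiv_mlieBracket_congr hO (gξ.apply hY) hZO.1 gX'
      (fun y hy => hσ.mvfderiv_apply hOU hO hZO hY hy) hxO
    have t3 := mvfderiv_mlieBracket_congr hO (gξ.apply gX') hZO.1 hY (g := fun _ => 0)
      (fun y hy => by
        rw [hσ.mvfderiv_apply hOU hO hZO gX' hy]
        exact hσ.2.1 y (hOU hy) _ (hW'.2 y (hOV hy))) hxO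
    have t4 := hσ'.mvfderiv_apply hOU hO hZO hXY hxO
    have t5 := hσ.mvfderiv_apply hOU hO hZO hXY' hxO
    have w1 := hσ'.mvfderiv_apply hOU hO (hW.mono hOV) hY hxO
    have w2 := hσ.mvfderiv_apply hOU hO (hW'.mono hOV) hY hxO
    have j1 := congrArg (σ' x).2 (mlieBracket_jacobi hO gX hY hZO.1 hxO)
    have j2 := congrArg (σ x).2 (mlieBracket_jacobi hO gX' hY hZO.1 hxO)
    rw [map_add] at j1 j2
    rw [mvfderiv_const, zero_apply] at t3
    linarith

end Projectable
end
end DiracGeometry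

namespace DiracGeometry

noncomputable section

/-! ### Testing smoothness and equality of vectors. -/

section Criteria

variable {E : Type*} [NormedAddCommGroup E] [NormedSpace ℝ E] [FiniteDimensional ℝ E]
  {M : Type*} [TopologicalSpace M] [ChartedSpace E M]
  {W : Type*} [NormedAddCommGroup W] [NormedSpace ℝ W] [FiniteDimensional ℝ W]

omit [FiniteDimensional ℝ E] in
theorem contMDiffOn_of_forall_dual {f : M → W} {U : Set M}
    (h : ∀ β : W →L[ℝ] ℝ, ContMDiffOn 𝓘(ℝ, E) 𝓘(ℝ, ℝ) ∞ (fun x => β (f x)) U) :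
    ContMDiffOn 𝓘(ℝ, E) 𝓘(ℝ, W) ∞ f U := by
  let b := Module.finBasis ℝ W
  have hs : ContMDiffOn 𝓘(ℝ, E) 𝓘(ℝ, W) ∞
      (fun x => ∑ i, (LinearMap.toContinuousLinearMap (b.coord i)) (f x) • b i) U :=
    contMDiffOn_finsetSum fun i _ => (h _).smul contMDiffOn_const
  exact hs.congr fun x _ => (b.sum_repr (f x)).symm

variable [IsManifold 𝓘(ℝ, E) ∞ M]

theorem smoothFormOn_toCoord (p : M) (β : E →L[ℝ] ℝ) :
    SmoothFormOn (fun x : M => (β.comp (toCoord p x) : Cot E x)) (chartAt E p).source :=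
  smoothFormOn_of_apply (chartAt E p).open_source subset_rfl fun v =>
    (contMDiffOn_const (c := β v)).congr fun _ hx => congrArg β (toCoord_ofCoord hx v)

theorem smoothFieldOn_of_forall_form {X : ∀ x : M, Tan E x} {U : Set M} (hU : IsOpen U)
    (h : ∀ V ⊆ U, IsOpen V → ∀ ξ : ∀ x : M, Cot E x, SmoothFormOn ξ V →
      ContMDiffOn 𝓘(ℝ, E) 𝓘(ℝ, ℝ) ∞ (fun x => ξ x (X x)) V) : SmoothFieldOn X U := by
  refine smoothFieldOn_of_locally fun p hp => ?_
  have hV := hU.inter (chartAt E p).open_source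
  exact ⟨_, hV, ⟨hp, mem_chart_source E p⟩, (smoothFieldOn_iff hV inter_subset_right X).2
    (contMDiffOn_of_forall_dual fun β => h _ inter_subset_left hV _
      ((smoothFormOn_toCoord p β).mono inter_subset_right))⟩

/-- A tangent vector is determined by its action on functions. -/
theorem tan_ext {p : M} {v w : Tan E p} (h : ∀ (U : Set M) (g : M → ℝ), IsOpen U → p ∈ U →
    ContMDiffOn 𝓘(ℝ, E) 𝓘(ℝ, ℝ) ∞ g U → mvfderiv 𝓘(ℝ, E) g p v = mvfderiv 𝓘(ℝ, E) g p w) :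
    v = w := by
  by_contra hne
  obtain ⟨β, -, hβ⟩ := exists_cot_ne_zero (V := (⊥ : Submodule ℝ (Tan E p))) (v := v - w)
    (by simpa [sub_eq_zero] using hne)
  let β' : E →L[ℝ] ℝ := β
  have hs : ContMDiffOn 𝓘(ℝ, E) 𝓘(ℝ, ℝ) ∞ (fun x => β' (extChartAt 𝓘(ℝ, E) p x))
      (chartAt E p).source :=
    (β'.contDiff.contMDiff (n := ∞)).comp_contMDiffOn (contMDiffOn_extChartAt (n := ∞))
  have e : ∀ u : Tan E p, mvfderiv 𝓘(ℝ, E) (fun x => β' (extChartAt 𝓘(ℝ, E) p x)) p u = β u := by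
    intro u
    rw [mvfderiv_eq_fderiv (mdifferentiableAt_of_smoothOn (chartAt E p).open_source hs
      (mem_chart_source E p))]
    have he : (fun x => β' (extChartAt 𝓘(ℝ, E) p x)) ∘ (extChartAt 𝓘(ℝ, E) p).symm
        =ᶠ[𝓝 (extChartAt 𝓘(ℝ, E) p p)] β' := by
      filter_upwards [extChartAt_target_mem_nhds p] with y hy
      exact congrArg β' ((extChartAt 𝓘(ℝ, E) p).right_inv hy)
    rw [he.fderiv_eq, ContinuousLinearMap.fderiv]
    rfl
  have := h _ _ (chartAt E p).open_source (mem_chart_source E p) hs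
  rw [e, e] at this
  exact hβ (by rw [map_sub, this, sub_self])

end Criteria

/-! ### Naturality of the brackets for related sections. -/

section Maps

variable {E : Type*} [NormedAddCommGroup E] [NormedSpace ℝ E] [FiniteDimensional ℝ E]
  {M : Type*} [TopologicalSpace M] [ChartedSpace E M] [IsManifold 𝓘(ℝ, E) ∞ M]
  {F : Type*} [NormedAddCommGroup F] [NormedSpace ℝ F] [FiniteDimensional ℝ F]
  {N : Type*} [TopologicalSpace N] [ChartedSpace F N] [IsManifold 𝓘(ℝ, F) ∞ N]

omit [FiniteDimensional ℝ E] [FiniteDimensional ℝ F] in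
theorem contMDiffOn_tanMap {f : N → M} {O : Set N} (hO : IsOpen O)
    (hf : ContMDiffOn 𝓘(ℝ, F) 𝓘(ℝ, E) ∞ f O) {u : ∀ y : N, Tan F y} (hu : SmoothFieldOn u O) :
    ContMDiffOn 𝓘(ℝ, F) (𝓘(ℝ, E).prod 𝓘(ℝ, E)) ∞ (fun y => Bundle.TotalSpace.mk' E
      (E := fun x : M => TangentSpace 𝓘(ℝ, E) x) (f y) (tanMap E F f y (u y))) O := by
  have h := ContMDiffOn.contMDiffOn_tangentMapWithin (m := ∞) hf (by simp) hO.uniqueMDiffOn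
  have h2 := h.comp hu fun y hy => hy
  refine h2.congr fun y hy => ?_
  change _ = Bundle.TotalSpace.mk' E (f y) (mfderivWithin 𝓘(ℝ, F) 𝓘(ℝ, E) f O y (u y))
  rw [mfderivWithin_of_isOpen hO hy]

omit [FiniteDimensional ℝ E] in
theorem SmoothFormOn.pull {f : N → M} {O : Set N} {U : Set M} (hO : IsOpen O)
    (hf : ContMDiffOn 𝓘(ℝ, F) 𝓘(ℝ, E) ∞ f O) (hOU : MapsTo f O U) {ξ : ∀ x : M, Cot E x}
    (hξ : SmoothFormOn ξ U) :
    SmoothFormOn (fun y => (ξ (f y)).comp (tanMap E F f y)) O := by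
  refine smoothFormOn_of_forall_field hO fun V hVO hV u hu => ?_
  have h1 := contMDiffOn_tanMap hV (hf.mono hVO) hu
  have h2 : ContMDiffOn 𝓘(ℝ, F) (𝓘(ℝ, E).prod 𝓘(ℝ, E →L[ℝ] ℝ)) ∞
      (fun y => Bundle.TotalSpace.mk' (E →L[ℝ] ℝ)
        (E := fun x : M => TangentSpace 𝓘(ℝ, E) x →L[ℝ] ℝ) (f y) (ξ (f y))) V :=
    ContMDiffOn.comp hξ (hf.mono hVO) fun y hy => hOU (hVO hy)
  intro y hy
  have h := ContMDiffWithinAt.clm_bundle_apply (F₂ := ℝ) (E₂ := fun _ : M => ℝ) (b := f)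
    (h2 y hy) (h1 y hy)
  exact (Bundle.contMDiffWithinAt_totalSpace.1 h).2

omit [FiniteDimensional ℝ E] [FiniteDimensional ℝ F] [IsManifold 𝓘(ℝ, E) ∞ M]
  [IsManifold 𝓘(ℝ, F) ∞ N] in
theorem mvfderiv_comp_on {f : N → M} {O : Set N} {U : Set M} (hO : IsOpen O) (hU : IsOpen U)
    (hf : ContMDiffOn 𝓘(ℝ, F) 𝓘(ℝ, E) ∞ f O) (hOU : MapsTo f O U) {g : M → ℝ}
    (hg : ContMDiffOn 𝓘(ℝ, E) 𝓘(ℝ, ℝ) ∞ g U) {y : N} (hy : y ∈ O) (u : Tan F y) :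
    mvfderiv 𝓘(ℝ, F) (fun y => g (f y)) y u = mvfderiv 𝓘(ℝ, E) g (f y) (tanMap E F f y u) :=
  mvfderiv_comp_apply y (mdifferentiableAt_of_smoothOn hU hg (hOU hy))
    ((hf.contMDiffAt (hO.mem_nhds hy)).mdifferentiableAt (by simp)) u

omit [FiniteDimensional ℝ F] in
/-- Brackets of related vector fields are related. -/
theorem mlieBracket_related {f : N → M} {O : Set N} {U : Set M} (hO : IsOpen O) (hU : IsOpen U)
    (hf : ContMDiffOn 𝓘(ℝ, F) 𝓘(ℝ, E) ∞ f O) (hOU : MapsTo f O U)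
    {X Y : ∀ y : N, Tan F y} (hX : SmoothFieldOn X O) (hY : SmoothFieldOn Y O)
    {X' Y' : ∀ x : M, Tan E x} (hX' : SmoothFieldOn X' U) (hY' : SmoothFieldOn Y' U)
    (rX : ∀ y ∈ O, tanMap E F f y (X y) = X' (f y))
    (rY : ∀ y ∈ O, tanMap E F f y (Y y) = Y' (f y)) {y : N} (hy : y ∈ O) :
    tanMap E F f y (VectorField.mlieBracket 𝓘(ℝ, F) X Y y) =
      VectorField.mlieBracket 𝓘(ℝ, E) X' Y' (f y) := by
  -- Both vectors are compared as derivations on `g`: pullback by `f` intertwines the derivations of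
  -- related fields, hence also their commutators.
  refine tan_ext fun V g hV hyV hg => ?_
  have hV' : IsOpen (U ∩ V) := hU.inter hV
  let O' := O ∩ f ⁻¹' V
  have hO' : IsOpen O' := hf.continuousOn.isOpen_inter_preimage hO hV
  have hf' := hf.mono (inter_subset_left : O' ⊆ O)
  have hmaps : MapsTo f O' (U ∩ V) := fun z hz => ⟨hOU hz.1, hz.2⟩
  have hg' := hg.mono (inter_subset_right : U ∩ V ⊆ V)
  have hX1 := hX'.mono (inter_subset_left : U ∩ V ⊆ U)
  have hY1 := hY'.mono (inter_subset_left : U ∩ V ⊆ U)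
  have hX2 := hX.mono (inter_subset_left : O' ⊆ O)
  have hY2 := hY.mono (inter_subset_left : O' ⊆ O)
  have hyO' : y ∈ O' := ⟨hy, hyV⟩
  have hgf : ContMDiffOn 𝓘(ℝ, F) 𝓘(ℝ, ℝ) ∞ (fun z => g (f z)) O' := hg'.comp hf' hmaps
  have e1 : ∀ z ∈ O', mvfderiv 𝓘(ℝ, F) (fun z => g (f z)) z (X z) =
      mvfderiv 𝓘(ℝ, E) g (f z) (X' (f z)) := fun z hz => by
    rw [mvfderiv_comp_on hO' hV' hf' hmaps hg' hz, rX z hz.1]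
  have e2 : ∀ z ∈ O', mvfderiv 𝓘(ℝ, F) (fun z => g (f z)) z (Y z) =
      mvfderiv 𝓘(ℝ, E) g (f z) (Y' (f z)) := fun z hz => by
    rw [mvfderiv_comp_on hO' hV' hf' hmaps hg' hz, rY z hz.1]
  rw [← mvfderiv_comp_on hO' hV' hf' hmaps hg' hyO', mvfderiv_mlieBracket hO' hgf hX2 hY2 hyO',
    mvfderiv_mlieBracket hV' hg' hX1 hY1 (hmaps hyO'), mvfderiv_congr hO' e1 hyO',
    mvfderiv_congr hO' e2 hyO',
    mvfderiv_comp_on hO' hV' hf' hmaps (smoothOn_mvfderiv hV' hg' hY1) hyO',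
    mvfderiv_comp_on hO' hV' hf' hmaps (smoothOn_mvfderiv hV' hg' hX1) hyO', rX y hy, rY y hy]

/-- Sections related by a map: `f_* X = X' ∘ f` and `ξ = f^* ξ'`. -/
def Related (f : N → M) (σ : ∀ y : N, GenTan F y) (σ' : ∀ x : M, GenTan E x) (O : Set N) : Prop :=
  ∀ y ∈ O, tanMap E F f y (σ y).1 = (σ' (f y)).1 ∧ (σ y).2 = (σ' (f y)).2.comp (tanMap E F f y)

omit [FiniteDimensional ℝ E] [FiniteDimensional ℝ F] [IsManifold 𝓘(ℝ, E) ∞ M]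
  [IsManifold 𝓘(ℝ, F) ∞ N] in
theorem Related.apply {f : N → M} {O : Set N} {σ τ : ∀ y : N, GenTan F y}
    {σ' τ' : ∀ x : M, GenTan E x} (hσ : Related f σ σ' O) (hτ : Related f τ τ' O) {y : N}
    (hy : y ∈ O) : (σ y).2 (τ y).1 = (σ' (f y)).2 (τ' (f y)).1 := by
  rw [(hσ y hy).2, ContinuousLinearMap.comp_apply, (hτ y hy).1]

omit [FiniteDimensional ℝ E] [FiniteDimensional ℝ F] [IsManifold 𝓘(ℝ, E) ∞ M]
  [IsManifold 𝓘(ℝ, F) ∞ N] in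
theorem Related.pairing {f : N → M} {O : Set N} {σ τ : ∀ y : N, GenTan F y}
    {σ' τ' : ∀ x : M, GenTan E x} (hσ : Related f σ σ' O) (hτ : Related f τ τ' O) {y : N}
    (hy : y ∈ O) : pairing (σ y) (τ y) = pairing (σ' (f y)) (τ' (f y)) := by
  rw [DiracGeometry.pairing, hσ.apply hτ hy, hτ.apply hσ hy]
  rfl

-- The formula for ⟨[σ₁, σ₂], σ₃⟩ contains only brackets of related fields, contractions, and
-- derivatives of pulled-back functions, and each of these is natural. Isotropy is needed only on
-- the target, since related sections have equal pairings.
omit [FiniteDimensional ℝ F] in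
theorem Related.pairing_courant {f : N → M} {O : Set N} {U : Set M} (hO : IsOpen O)
    (hU : IsOpen U) (hf : ContMDiffOn 𝓘(ℝ, F) 𝓘(ℝ, E) ∞ f O) (hOU : MapsTo f O U)
    {σ₁ σ₂ σ₃ : ∀ y : N, GenTan F y} {τ₁ τ₂ τ₃ : ∀ x : M, GenTan E x}
    (h₁ : SmoothGenOn σ₁ O) (h₂ : SmoothGenOn σ₂ O) (h₃ : SmoothGenOn σ₃ O)
    (k₁ : SmoothGenOn τ₁ U) (k₂ : SmoothGenOn τ₂ U) (k₃ : SmoothGenOn τ₃ U)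
    (r₁ : Related f σ₁ τ₁ O) (r₂ : Related f σ₂ τ₂ O) (r₃ : Related f σ₃ τ₃ O)
    (k₁₂ : ∀ x ∈ U, DiracGeometry.pairing (τ₁ x) (τ₂ x) = 0)
    (k₁₃ : ∀ x ∈ U, DiracGeometry.pairing (τ₁ x) (τ₃ x) = 0) {y : N} (hy : y ∈ O) :
    DiracGeometry.pairing (courant σ₁ σ₂ y) (σ₃ y) =
      DiracGeometry.pairing (courant τ₁ τ₂ (f y)) (τ₃ (f y)) := by
  rw [DiracGeometry.pairing_courant hO h₁ h₂ h₃
      (fun z hz => (r₁.pairing r₂ hz).trans (k₁₂ _ (hOU hz)))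
      (fun z hz => (r₁.pairing r₃ hz).trans (k₁₃ _ (hOU hz))) hy,
    DiracGeometry.pairing_courant hU k₁ k₂ k₃ k₁₂ k₁₃ (hOU hy)]
  have key : ∀ {a b : ∀ y : N, GenTan F y} {a' b' : ∀ x : M, GenTan E x}
      {c : ∀ y : N, GenTan F y} {c' : ∀ x : M, GenTan E x}, SmoothGenOn a O → SmoothGenOn b O →
      SmoothGenOn a' U → SmoothGenOn b' U → Related f a a' O → Related f b b' O →
      Related f c c' O →
      (c y).2 (VectorField.mlieBracket 𝓘(ℝ, F) (fun x => (a x).1) (fun x => (b x).1) y) =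
        (c' (f y)).2 (VectorField.mlieBracket 𝓘(ℝ, E) (fun x => (a' x).1)
          (fun x => (b' x).1) (f y)) ∧
      mvfderiv 𝓘(ℝ, F) (fun x => (a x).2 (b x).1) y (c y).1 =
        mvfderiv 𝓘(ℝ, E) (fun x => (a' x).2 (b' x).1) (f y) (c' (f y)).1 := by
    intro a b a' b' c c' ha hb ha' hb' ra rb rc
    constructor
    · rw [(rc y hy).2, ContinuousLinearMap.comp_apply,
        mlieBracket_related hO hU hf hOU ha.1 hb.1 ha'.1 hb'.1 (fun z hz => (ra z hz).1)
          (fun z hz => (rb z hz).1) hy]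
    · rw [mvfderiv_congr hO (fun z hz => ra.apply rb hz) hy,
        mvfderiv_comp_on hO hU hf hOU (ha'.2.apply hb'.1) hy, (rc y hy).1]
  obtain ⟨a1, b1⟩ := key h₂ h₃ k₂ k₃ r₂ r₃ r₁
  obtain ⟨a2, b2⟩ := key h₃ h₁ k₃ k₁ r₃ r₁ r₂
  obtain ⟨a3, b3⟩ := key h₁ h₂ k₁ k₂ r₁ r₂ r₃
  rw [a1, b1, a2, b2, a3, b3]

end Maps
end
end DiracGeometry

namespace DiracGeometry

noncomputable section

/-! ### A local inverse that is smooth throughout. -/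

section InverseFunction

/-- The inverse function theorem, with the domain shrunk to the open set where the derivative is
invertible, so that the inverse is smooth on its whole domain and not just at one point. -/
theorem exists_localInverse {V W : Type*} [NormedAddCommGroup V] [NormedSpace ℝ V]
    [CompleteSpace V] [NormedAddCommGroup W] [NormedSpace ℝ W] {h : V → W} {O : Set V}
    (hO : IsOpen O) (hh : ContDiffOn ℝ ∞ h O) {a : V} (ha : a ∈ O) (e : V ≃L[ℝ] W)
    (he : HasFDerivAt h (e : V →L[ℝ] W) a) :
    ∃ Φ : OpenPartialHomeomorph V W, a ∈ Φ.source ∧ Φ.source ⊆ O ∧ (∀ z ∈ Φ.source, Φ z = h z) ∧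
      ContDiffOn ℝ ∞ Φ.symm Φ.target := by
  have hat : ∀ z ∈ O, ContDiffAt ℝ ∞ h z := fun z hz => hh.contDiffAt (hO.mem_nhds hz)
  let Φ₀ := (hat a ha).toOpenPartialHomeomorph h he (by simp)
  have hcont : ContinuousOn (fderiv ℝ h) O := hh.continuousOn_fderiv_of_isOpen hO (by simp)
  have hO₁ : IsOpen (O ∩ fderiv ℝ h ⁻¹' range ((↑) : (V ≃L[ℝ] W) → V →L[ℝ] W)) :=
    hcont.isOpen_inter_preimage hO (ContinuousLinearEquiv.isOpen (𝕜 := ℝ))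
  have hΦ : ∀ z, Φ₀ z = h z := fun z => rfl
  refine ⟨Φ₀.restrOpen _ hO₁, ?_, ?_, fun z _ => rfl, ?_⟩
  · exact ⟨ContDiffAt.mem_toOpenPartialHomeomorph_source _ he _, ha, e, he.fderiv.symm⟩
  · exact fun z hz => hz.2.1
  · intro w hw
    obtain ⟨hz0, hzO, e', he'⟩ := (Φ₀.restrOpen _ hO₁).map_target hw
    refine ContDiffAt.contDiffWithinAt
      ((Φ₀.restrOpen _ hO₁).contDiffAt_symm (f₀' := e') hw ?_ (hat _ hzO))
    rw [he']
    exact ((hat _ hzO).differentiableAt (by simp)).hasFDerivAt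

end InverseFunction

/-! ### Local sections of submersions and local retractions of immersions. -/

section LocalMaps

variable {E : Type*} [NormedAddCommGroup E] [NormedSpace ℝ E] [FiniteDimensional ℝ E]
  {M : Type*} [TopologicalSpace M] [ChartedSpace E M] [IsManifold 𝓘(ℝ, E) ∞ M]
  {F : Type*} [NormedAddCommGroup F] [NormedSpace ℝ F] [FiniteDimensional ℝ F]
  {N : Type*} [TopologicalSpace N] [ChartedSpace F N] [IsManifold 𝓘(ℝ, F) ∞ N]

omit [FiniteDimensional ℝ E] [FiniteDimensional ℝ F] [IsManifold 𝓘(ℝ, E) ∞ M]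
  [IsManifold 𝓘(ℝ, F) ∞ N] in
theorem hasFDerivAt_inChart {f : N → M} (hf : ContMDiff 𝓘(ℝ, F) 𝓘(ℝ, E) ∞ f) (y : N) :
    HasFDerivAt (fun z => extChartAt 𝓘(ℝ, E) (f y) (f ((extChartAt 𝓘(ℝ, F) y).symm z)))
      (show F →L[ℝ] E from tanMap E F f y) (extChartAt 𝓘(ℝ, F) y y) := by
  have h := ((hf y).mdifferentiableAt (by simp)).hasMFDerivAt.2
  have h' : HasFDerivWithinAt
      (fun z => extChartAt 𝓘(ℝ, E) (f y) (f ((extChartAt 𝓘(ℝ, F) y).symm z)))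
      (show F →L[ℝ] E from tanMap E F f y) univ (extChartAt 𝓘(ℝ, F) y y) := by
    rw [← range_id]
    exact h
  exact h'.hasFDerivAt Filter.univ_mem

omit [FiniteDimensional ℝ E] [FiniteDimensional ℝ F] in
theorem contMDiffOn_inChart {f : N → M} (hf : ContMDiff 𝓘(ℝ, F) 𝓘(ℝ, E) ∞ f) (y : N) :
    IsOpen {z | z ∈ (extChartAt 𝓘(ℝ, F) y).target ∧
      f ((extChartAt 𝓘(ℝ, F) y).symm z) ∈ (chartAt E (f y)).source} ∧
    ContDiffOn ℝ ∞ (fun z => extChartAt 𝓘(ℝ, E) (f y) (f ((extChartAt 𝓘(ℝ, F) y).symm z)))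
      {z | z ∈ (extChartAt 𝓘(ℝ, F) y).target ∧
        f ((extChartAt 𝓘(ℝ, F) y).symm z) ∈ (chartAt E (f y)).source} := by
  have h1 := hf.comp_contMDiffOn (contMDiffOn_extChartAt_symm (I := 𝓘(ℝ, F)) (n := ∞) y)
  refine ⟨h1.continuousOn.isOpen_inter_preimage (isOpen_extChartAt_target y)
    (chartAt E (f y)).open_source, ?_⟩
  rw [← contMDiffOn_iff_contDiffOn]
  exact (contMDiffOn_extChartAt (I := 𝓘(ℝ, E)) (x := f y)).comp (h1.mono fun z hz => hz.1)
    fun z hz => hz.2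

omit [FiniteDimensional ℝ F] in
/-- A submersion has local sections. -/
theorem exists_localSection {f : N → M} (hf : ContMDiff 𝓘(ℝ, F) 𝓘(ℝ, E) ∞ f) (y : N)
    (hsurj : Function.Surjective (tanMap E F f y)) :
    ∃ (V : Set M) (s : M → N), IsOpen V ∧ f y ∈ V ∧ ContMDiffOn 𝓘(ℝ, E) 𝓘(ℝ, F) ∞ s V ∧
      s (f y) = y ∧ ∀ b ∈ V, f (s b) = b := by
  let φ := extChartAt 𝓘(ℝ, F) y
  let ψ := extChartAt 𝓘(ℝ, E) (f y)
  let A : F →L[ℝ] E := tanMap E F f y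
  obtain ⟨R₀, hR₀⟩ := A.toLinearMap.exists_rightInverse_of_surjective
    (LinearMap.range_eq_top.2 hsurj)
  let R : E →L[ℝ] F := LinearMap.toContinuousLinearMap R₀
  -- An affine slice through the base point along a right inverse of the derivative. On it `f` has
  -- identity derivative at 0, so it is invertible there.
  let ℓ : E → F := fun z => φ y + R z
  have hℓ : ContDiff ℝ ∞ ℓ := contDiff_const.add R.contDiff
  have hℓ' : HasFDerivAt ℓ R 0 := R.hasFDerivAt.const_add _
  have hℓ0 : ℓ 0 = φ y := by simp [ℓ]
  obtain ⟨hO, hs⟩ := contMDiffOn_inChart hf y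
  have hd := hasFDerivAt_inChart hf y
  have hd0 : HasFDerivAt (fun z => ψ (f (φ.symm (ℓ z))))
      (ContinuousLinearEquiv.refl ℝ E : E →L[ℝ] E) 0 := by
    have h1 := HasFDerivAt.comp (0 : E) (g := fun z => ψ (f (φ.symm z))) (by rw [hℓ0]; exact hd) hℓ'
    refine h1.congr_fderiv ?_
    ext z
    exact LinearMap.congr_fun hR₀ z
  obtain ⟨Φ, h0, hΦO, hΦ, hΦs⟩ := exists_localInverse (hℓ.continuous.isOpen_preimage _ hO)
    (hs.comp hℓ.contDiffOn fun z hz => hz) (a := 0)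
    (by
      rw [mem_preimage, hℓ0]
      refine ⟨mem_extChartAt_target y, ?_⟩
      rw [extChartAt_to_inv]
      exact mem_chart_source E (f y)) (ContinuousLinearEquiv.refl ℝ E) hd0
  have hψc : ContMDiffOn 𝓘(ℝ, E) 𝓘(ℝ, E) ∞ ψ (chartAt E (f y)).source := contMDiffOn_extChartAt
  let V := (chartAt E (f y)).source ∩ ψ ⁻¹' Φ.target
  have hV : IsOpen V := hψc.continuousOn.isOpen_inter_preimage (chartAt E (f y)).open_source
    Φ.open_target
  have hψ0 : ψ (f y) = Φ 0 := by
    rw [hΦ 0 h0]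
    change _ = ψ (f (φ.symm (ℓ 0)))
    rw [hℓ0]
    exact congrArg (fun z => ψ (f z)) (extChartAt_to_inv y).symm
  refine ⟨V, fun b => φ.symm (ℓ (Φ.symm (ψ b))), hV, ⟨mem_chart_source E _, ?_⟩, ?_, ?_, ?_⟩
  · rw [mem_preimage, hψ0]
    exact Φ.map_source h0
  · refine (contMDiffOn_extChartAt_symm y).comp (hℓ.contMDiff.comp_contMDiffOn
      ((contMDiffOn_iff_contDiffOn.2 hΦs).comp (hψc.mono inter_subset_left) fun b hb => hb.2)) ?_
    intro b hb
    exact (hΦO (Φ.map_target hb.2)).1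
  · change φ.symm (ℓ (Φ.symm (ψ (f y)))) = y
    rw [hψ0, Φ.left_inv h0, hℓ0]
    exact extChartAt_to_inv y
  · intro b hb
    have hz := Φ.map_target hb.2
    have h1 : ψ (f (φ.symm (ℓ (Φ.symm (ψ b))))) = ψ b :=
      (hΦ _ hz).symm.trans (Φ.right_inv hb.2)
    refine ψ.injOn ?_ ?_ h1
    · rw [extChartAt_source]
      exact (hΦO hz).2
    · rw [extChartAt_source]
      exact hb.1

/-- An immersion has local retractions. -/
theorem exists_localRetraction {f : N → M} (hf : ContMDiff 𝓘(ℝ, F) 𝓘(ℝ, E) ∞ f) (y : N)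
    (hinj : Function.Injective (tanMap E F f y)) :
    ∃ (V : Set M) (O : Set N) (r : M → N), IsOpen V ∧ IsOpen O ∧ y ∈ O ∧ MapsTo f O V ∧
      ContMDiffOn 𝓘(ℝ, E) 𝓘(ℝ, F) ∞ r V ∧ ∀ z ∈ O, r (f z) = z := by
  let φ := extChartAt 𝓘(ℝ, F) y
  let ψ := extChartAt 𝓘(ℝ, E) (f y)
  let A : F →L[ℝ] E := tanMap E F f y
  obtain ⟨L₀, hL₀⟩ := A.toLinearMap.exists_leftInverse_of_injective (LinearMap.ker_eq_bot.2 hinj)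
  let L : E →L[ℝ] F := LinearMap.toContinuousLinearMap L₀
  obtain ⟨hO, hs⟩ := contMDiffOn_inChart hf y
  have hd := hasFDerivAt_inChart hf y
  -- Following `f` by a left inverse `L` of its derivative gives a local diffeomorphism; its inverse
  -- after `L` is the retraction.
  have hd0 : HasFDerivAt (fun z => L (ψ (f (φ.symm z))))
      (ContinuousLinearEquiv.refl ℝ F : F →L[ℝ] F) (φ y) := by
    refine (L.hasFDerivAt.comp (φ y) hd).congr_fderiv ?_
    ext z
    exact LinearMap.congr_fun hL₀ z
  obtain ⟨Φ, h0, hΦO, hΦ, hΦs⟩ := exists_localInverse hO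
    (L.contDiff.comp_contDiffOn hs) (a := φ y)
    ⟨mem_extChartAt_target y, by
      rw [extChartAt_to_inv]
      exact mem_chart_source E (f y)⟩ (ContinuousLinearEquiv.refl ℝ F) hd0
  have hψc : ContMDiffOn 𝓘(ℝ, E) 𝓘(ℝ, F) ∞ (fun x => L (ψ x)) (chartAt E (f y)).source :=
    (L.contDiff.contMDiff (n := ∞)).comp_contMDiffOn contMDiffOn_extChartAt
  have hφc : ContMDiffOn 𝓘(ℝ, F) 𝓘(ℝ, F) ∞ φ (chartAt F y).source := contMDiffOn_extChartAt
  have hz : ∀ z ∈ (chartAt F y).source, φ.symm (φ z) = z := fun z hz =>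
    φ.left_inv (by rw [extChartAt_source]; exact hz)
  refine ⟨(chartAt E (f y)).source ∩ (fun x => L (ψ x)) ⁻¹' Φ.target,
    (chartAt F y).source ∩ φ ⁻¹' Φ.source, fun x => φ.symm (Φ.symm (L (ψ x))),
    hψc.continuousOn.isOpen_inter_preimage (chartAt E (f y)).open_source Φ.open_target,
    hφc.continuousOn.isOpen_inter_preimage (chartAt F y).open_source Φ.open_source,
    ⟨mem_chart_source F y, h0⟩, ?_, ?_, ?_⟩
  · rintro z ⟨hz1, hz2⟩
    have h1 := (hΦO hz2).2
    have h2 := Φ.map_source hz2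
    rw [hΦ _ hz2] at h2
    change f (φ.symm (φ z)) ∈ _ at h1
    change L (ψ (f (φ.symm (φ z)))) ∈ _ at h2
    rw [hz z hz1] at h1 h2
    exact ⟨h1, h2⟩
  · refine (contMDiffOn_extChartAt_symm y).comp
      ((contMDiffOn_iff_contDiffOn.2 hΦs).comp (hψc.mono inter_subset_left) fun b hb => hb.2) ?_
    intro b hb
    exact (hΦO (Φ.map_target hb.2)).1
  · rintro z ⟨hz1, hz2⟩
    have h2 : Φ (φ z) = L (ψ (f z)) := by
      rw [hΦ _ hz2]
      change L (ψ (f (φ.symm (φ z)))) = _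
      rw [hz z hz1]
    change φ.symm (Φ.symm (L (ψ (f z)))) = z
    rw [← h2, Φ.left_inv hz2, hz z hz1]

end LocalMaps
end
end DiracGeometry

namespace DiracGeometry

noncomputable section

/-! ### Zeros of solutions of linear differential equations. -/

section LinearODE

/-- The zero set of a solution of a homogeneous linear differential equation is locally all or
nothing. -/
theorem exists_ball_zero_of_linearODE {k : ℕ} {u : ℝ → Fin k → ℝ} {m : Fin k → Fin k → ℝ → ℝ}
    {J : Set ℝ} (hJ : IsOpen J) (hm : ∀ i j, ContinuousOn (m i j) J)
    (hu : ∀ t ∈ J, ∀ i, HasDerivAt (fun t => u t i) (∑ j, m i j t * u t j) t) {t₀ : ℝ}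
    (ht₀ : t₀ ∈ J) :
    ∃ ε > 0, Metric.ball t₀ ε ⊆ J ∧
      ∀ t₁ ∈ Metric.ball t₀ ε, ∀ t₂ ∈ Metric.ball t₀ ε, u t₁ = 0 → u t₂ = 0 := by
  have hb : ∀ᶠ t in 𝓝 t₀, t ∈ J ∧ ∀ i j, |m i j t| ≤ |m i j t₀| + 1 := by
    refine (hJ.eventually_mem ht₀).and (Filter.eventually_all.2 fun i => Filter.eventually_all.2
      fun j => ?_)
    have hc : ContinuousAt (fun t => |m i j t|) t₀ :=
      ((hm i j).continuousAt (hJ.mem_nhds ht₀)).abs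
    filter_upwards [hc.eventually (gt_mem_nhds (lt_add_one |m i j t₀|))] with t ht using ht.le
  obtain ⟨ε, hε, h⟩ := Metric.eventually_nhds_iff_ball.1 hb
  refine ⟨ε, hε, fun t ht => (h t ht).1, fun t₁ h₁ t₂ h₂ h0 => ?_⟩
  -- Crude uniform Lipschitz constant on the ball: the sum of bounds for all matrix entries.
  let C : ℝ := ∑ i, ∑ j, (|m i j t₀| + 1)
  have hCpos : 0 ≤ C := Finset.sum_nonneg fun i _ => Finset.sum_nonneg fun j _ => by positivity
  let v : ℝ → (Fin k → ℝ) → Fin k → ℝ := fun t x i => ∑ j, m i j t * x j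
  have hv : ∀ t ∈ Metric.ball t₀ ε, LipschitzOnWith C.toNNReal (v t) univ := by
    intro t ht
    refine LipschitzWith.lipschitzOnWith (LipschitzWith.of_dist_le_mul fun x y => ?_)
    rw [Real.coe_toNNReal _ hCpos]
    refine (dist_pi_le_iff (by positivity)).2 fun i => ?_
    rw [Real.dist_eq, ← Finset.sum_sub_distrib]
    calc |∑ j, (m i j t * x j - m i j t * y j)|
        ≤ ∑ j, |m i j t * x j - m i j t * y j| := Finset.abs_sum_le_sum_abs _ _
      _ ≤ ∑ j, (|m i j t₀| + 1) * dist x y := by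
          refine Finset.sum_le_sum fun j _ => ?_
          rw [← mul_sub, abs_mul]
          exact mul_le_mul ((h t ht).2 i j) (dist_le_pi_dist x y j) (abs_nonneg _) (by positivity)
      _ = (∑ j, (|m i j t₀| + 1)) * dist x y := (Finset.sum_mul _ _ _).symm
      _ ≤ C * dist x y := by
          refine mul_le_mul_of_nonneg_right ?_ dist_nonneg
          exact Finset.single_le_sum (f := fun i => ∑ j, (|m i j t₀| + 1))
            (fun i _ => Finset.sum_nonneg fun j _ => by positivity) (Finset.mem_univ i)
  rw [Real.ball_eq_Ioo] at h h₁ h₂ hv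
  -- Comparison with the zero solution at the interior time `t₁`; uniqueness runs both forwards and
  -- backwards.
  have := ODE_solution_unique_of_mem_Ioo (f := u) (g := fun _ => 0) (s := fun _ => univ) hv h₁
    (fun t ht => ⟨hasDerivAt_pi.2 fun i => hu t (h t ht).1 i, trivial⟩)
    (fun t _ => ⟨by
      have : v t 0 = 0 := by ext i; simp [v]
      change HasDerivAt (fun _ => (0 : Fin k → ℝ)) (v t 0) t
      rw [this]
      exact hasDerivAt_const t 0, trivial⟩) h0
  exact this h₂

end LinearODE

/-! ### Lifting fields along a submersion; invariance of basic objects. -/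

section Lifts

variable {E : Type*} [NormedAddCommGroup E] [NormedSpace ℝ E] [FiniteDimensional ℝ E]
  {M : Type*} [TopologicalSpace M] [ChartedSpace E M] [IsManifold 𝓘(ℝ, E) ∞ M]
  {G : Type*} [NormedAddCommGroup G] [NormedSpace ℝ G] [FiniteDimensional ℝ G]
  {B : Type*} [TopologicalSpace B] [ChartedSpace G B] [IsManifold 𝓘(ℝ, G) ∞ B]

omit [FiniteDimensional ℝ E] in
theorem toCoord_injective {p x : M} (hx : x ∈ (chartAt E p).source) :
    Function.Injective (toCoord (E := E) p x) :=
  Function.LeftInverse.injective (ofCoord_toCoord hx)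

/-- The coordinates of `f_* v` depend smoothly on the base point. -/
theorem contMDiffOn_toCoord_tanMap {f : M → B} {O : Set M} (hO : IsOpen O)
    (hf : ContMDiffOn 𝓘(ℝ, E) 𝓘(ℝ, G) ∞ f O) {b : B} (hOb : MapsTo f O (chartAt G b).source)
    {u : ∀ x : M, Tan E x} (hu : SmoothFieldOn u O) :
    ContMDiffOn 𝓘(ℝ, E) 𝓘(ℝ, G) ∞ (fun x => toCoord b (f x) (tanMap G E f x (u x))) O :=
  contMDiffOn_of_forall_dual fun β =>
    (SmoothFormOn.pull hO hf hOb (smoothFormOn_toCoord b β)).apply hu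

/-- Vector fields lift along submersions. -/
theorem exists_lift {f : M → B} (hf : ContMDiff 𝓘(ℝ, E) 𝓘(ℝ, G) ∞ f)
    (hsurj : ∀ x, Function.Surjective (tanMap G E f x)) {U : Set B} (hU : IsOpen U)
    {X' : ∀ b : B, Tan G b} (hX' : SmoothFieldOn X' U) {p : M} (hp : f p ∈ U) :
    ∃ (O : Set M) (X : ∀ x : M, Tan E x), IsOpen O ∧ p ∈ O ∧ MapsTo f O U ∧ SmoothFieldOn X O ∧
      ∀ x ∈ O, tanMap G E f x (X x) = X' (f x) := by
  have hU' := hU.inter (chartAt G (f p)).open_source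
  let O := (chartAt E p).source ∩ f ⁻¹' (U ∩ (chartAt G (f p)).source)
  have hO : IsOpen O := (chartAt E p).open_source.inter (hU'.preimage hf.continuous)
  have hpO : p ∈ O := ⟨mem_chart_source E p, hp, mem_chart_source G (f p)⟩
  let A : M → E →L[ℝ] G := fun x =>
    (toCoord (E := G) (f p) (f x)).comp ((tanMap G E f x).comp (ofCoord p x))
  have hA : ContMDiffOn 𝓘(ℝ, E) 𝓘(ℝ, E →L[ℝ] G) ∞ A O := contMDiffOn_clm_of_apply fun v =>
    contMDiffOn_toCoord_tanMap hO hf.contMDiffOn (fun x hx => hx.2.2)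
      ((smoothFieldOn_ofCoord p v).mono inter_subset_left)
  have hAs : ∀ x ∈ O, Function.Surjective (A x) := by
    intro x hx w
    obtain ⟨v, hv⟩ := hsurj x (ofCoord (f p) (f x) w)
    refine ⟨toCoord p x v, ?_⟩
    change toCoord (f p) (f x) (tanMap G E f x (ofCoord p x (toCoord p x v))) = w
    rw [ofCoord_toCoord hx.1, hv, toCoord_ofCoord hx.2.2]
  -- `A` is surjective at every point of `O`, so its generalized inverse is a smooth right inverse,
  -- which produces the lift.
  obtain ⟨O', hO'O, hO', hpO', R, hR, hAR⟩ := exists_generalizedInverse hO hA hpO fun x hx => by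
    rw [LinearMap.range_eq_top.2 (hAs x hx), LinearMap.range_eq_top.2 (hAs p hpO)]
  have hw : ContMDiffOn 𝓘(ℝ, E) 𝓘(ℝ, G) ∞ (fun x => toCoord (f p) (f x) (X' (f x))) O' :=
    ((smoothFieldOn_iff hU' inter_subset_right X').1 (hX'.mono inter_subset_left)).comp
      hf.contMDiffOn fun x hx => (hO'O hx).2
  refine ⟨O', fun x => ofCoord p x (R x (toCoord (f p) (f x) (X' (f x)))), hO', hpO',
    fun x hx => (hO'O hx).2.1, ?_, fun x hx => ?_⟩
  · refine (smoothFieldOn_iff hO' (fun x hx => (hO'O hx).1) _).2 ((hR.clm_apply hw).congr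
      fun x hx => ?_)
    exact toCoord_ofCoord (hO'O hx).1 _
  · apply toCoord_injective (hO'O hx).2.2
    obtain ⟨v, hv⟩ := hAs x (hO'O hx) (toCoord (f p) (f x) (X' (f x)))
    have := hAR x hx v
    rw [hv] at this
    exact this

variable {S : ∀ x : M, Submodule ℝ (Tan E x)} {τ : M → B} (hτ : IsLeafSpace (E := G) S τ)
include hτ

omit [FiniteDimensional ℝ E] [IsManifold 𝓘(ℝ, E) ∞ M] [FiniteDimensional ℝ G]
  [IsManifold 𝓘(ℝ, G) ∞ B] in
theorem IsLeafSpace.mem_iff {x : M} {v : Tan E x} : v ∈ S x ↔ tanMap G E τ x v = 0 := by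
  rw [← hτ.vertical x]
  rfl

-- A field of S is τ-related to zero, so its bracket with a projectable field is related to a
-- bracket with zero.
omit [FiniteDimensional ℝ E] in
theorem IsLeafSpace.mlieBracket_mem {O : Set M} {U : Set B} (hO : IsOpen O) (hU : IsOpen U)
    (hOU : MapsTo τ O U) {Z X : ∀ x : M, Tan E x} {X' : ∀ b : B, Tan G b} (hZ : IsFieldIn S Z O)
    (hX : SmoothFieldOn X O) (hX' : SmoothFieldOn X' U)
    (h : ∀ x ∈ O, tanMap G E τ x (X x) = X' (τ x)) {x : M} (hx : x ∈ O) :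
    VectorField.mlieBracket 𝓘(ℝ, E) Z X x ∈ S x := by
  rw [hτ.mem_iff, mlieBracket_related hO hU hτ.smooth.contMDiffOn hOU hZ.1 hX
    (smoothFieldOn_zero U) hX' (fun y hy => (hτ.mem_iff).1 (hZ.2 y hy)) h hx]
  have h0 : (fun b : B => (0 : Tan G b)) = 0 := rfl
  rw [h0, VectorField.mlieBracket_zero_left]
  rfl

/-- Extend τ_* v on B, lift the extension, and correct by a field of S to reach v itself. One-forms
on M can thus be tested on projectable fields. -/
theorem IsLeafSpace.exists_related_field (hS : IsDistribution S) {p : M} (v : Tan E p) :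
    ∃ (O : Set M) (U : Set B) (Y : ∀ x : M, Tan E x) (Y' : ∀ b : B, Tan G b), IsOpen O ∧
      IsOpen U ∧ p ∈ O ∧ MapsTo τ O U ∧ SmoothFieldOn Y O ∧ SmoothFieldOn Y' U ∧
      (∀ x ∈ O, tanMap G E τ x (Y x) = Y' (τ x)) ∧ Y p = v := by
  obtain ⟨Y', hY', hY'p⟩ := exists_smoothFieldOn (τ p) (tanMap G E τ p v)
  obtain ⟨O, Y, hO, hpO, hmaps, hY, hrel⟩ := exists_lift hτ.smooth hτ.submersion
    (chartAt G (τ p)).open_source hY' (mem_chart_source G (τ p))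
  have hv : v - Y p ∈ S p := by
    rw [hτ.mem_iff, map_sub, hrel p hpO, hY'p, sub_self]
  obtain ⟨V, Z, hV, hpV, hZ, hZp⟩ := hS.exists_field hv
  refine ⟨O ∩ V, _, fun x => Y x + Z x, Y', hO.inter hV, (chartAt G (τ p)).open_source,
    ⟨hpO, hpV⟩, fun x hx => hmaps hx.1, (hY.mono inter_subset_left).add
    (hZ.1.mono inter_subset_right), hY', fun x hx => ?_, ?_⟩
  · rw [map_add, hrel x hx.1, hτ.mem_iff.1 (hZ.2 x hx.2), add_zero]
  · change Y p + Z p = v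
    rw [hZp, add_sub_cancel]

/-- Basic one-forms are invariant. -/
theorem IsLeafSpace.lieForm_pull (hS : IsDistribution S) {O : Set M} {U : Set B} (hO : IsOpen O)
    (hU : IsOpen U) (hOU : MapsTo τ O U) {Z : ∀ x : M, Tan E x} (hZ : IsFieldIn S Z O)
    {η : ∀ b : B, Cot G b} (hη : SmoothFormOn η U) {p : M} (hp : p ∈ O) :
    lieForm Z (fun x => (η (τ x)).comp (tanMap G E τ x)) p = 0 := by
  ext v
  obtain ⟨O', U', Y, Y', hO', hU', hpO', hOU', hY, hY', hrel, rfl⟩ :=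
    hτ.exists_related_field hS v
  have hOO := hO.inter hO'
  have hUU := hU.inter hU'
  have hmaps : MapsTo τ (O ∩ O') (U ∩ U') := fun x hx => ⟨hOU hx.1, hOU' hx.2⟩
  have hξ := SmoothFormOn.pull hO hτ.smooth.contMDiffOn hOU hη
  rw [lieForm_apply hOO (hZ.1.mono inter_subset_left) (hξ.mono inter_subset_left)
    (hY.mono inter_subset_right) ⟨hp, hpO'⟩, zero_apply]
  have h1 := hτ.mlieBracket_mem hOO hUU hmaps (hZ.mono inter_subset_left)
    (hY.mono inter_subset_right) (hY'.mono inter_subset_right) (fun x hx => hrel x hx.2) ⟨hp, hpO'⟩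
  -- The contraction with a projectable field is a function pulled back from B, hence killed by Z.
  have h2 : mvfderiv 𝓘(ℝ, E) (fun x => ((η (τ x)).comp (tanMap G E τ x)) (Y x)) p (Z p) = 0 := by
    rw [mvfderiv_congr hOO (f := fun x => ((η (τ x)).comp (tanMap G E τ x)) (Y x))
      (g := fun x => η (τ x) (Y' (τ x)))
      (fun x hx => congrArg (η (τ x)) (hrel x hx.2)) ⟨hp, hpO'⟩,
      mvfderiv_comp_on hOO hUU hτ.smooth.contMDiffOn hmaps
        (g := fun b => η b (Y' b)) ((hη.mono inter_subset_left).apply (hY'.mono inter_subset_right))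
        ⟨hp, hpO'⟩, hτ.mem_iff.1 (hZ.2 p hp), map_zero]
  rw [h2, ContinuousLinearMap.comp_apply, hτ.mem_iff.1 h1, map_zero, sub_zero]

end Lifts
end
end DiracGeometry

namespace DiracGeometry

noncomputable section

/-! ### Curves tangent to S and derivatives along them. -/

section Curves

variable {E : Type*} [NormedAddCommGroup E] [NormedSpace ℝ E] [FiniteDimensional ℝ E]
  {M : Type*} [TopologicalSpace M] [ChartedSpace E M] [IsManifold 𝓘(ℝ, E) ∞ M]

theorem smoothFieldOn_one (U : Set ℝ) : SmoothFieldOn (fun _ : ℝ => (1 : ℝ)) U := by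
  have h : SmoothFieldOn (fun _ : ℝ => (1 : ℝ)) (univ : Set ℝ) := by
    refine (smoothFieldOn_iff (p := (0 : ℝ)) isOpen_univ
      (by rw [chartAt_self_eq]; exact subset_univ _) _).2 ?_
    refine (contMDiffOn_const (c := (1 : ℝ))).congr fun t _ => ?_
    exact DFunLike.congr_fun (TangentBundle.continuousLinearMapAt_model_space (𝕜 := ℝ) (0 : ℝ) t)
      (1 : ℝ)
  exact h.mono (subset_univ U)

omit [FiniteDimensional ℝ E] [IsManifold 𝓘(ℝ, E) ∞ M] in
theorem hasDerivAt_comp_curve {γ : ℝ → M} (hγ : ContMDiff 𝓘(ℝ, ℝ) 𝓘(ℝ, E) ∞ γ) {g : M → ℝ}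
    {O : Set M} (hO : IsOpen O) (hg : ContMDiffOn 𝓘(ℝ, E) 𝓘(ℝ, ℝ) ∞ g O) {t : ℝ}
    (ht : γ t ∈ O) :
    HasDerivAt (fun t => g (γ t)) (mvfderiv 𝓘(ℝ, E) g (γ t) (tanMap E ℝ γ t (1 : ℝ))) t := by
  have hJ := hO.preimage hγ.continuous
  have hs : ContMDiffOn 𝓘(ℝ, ℝ) 𝓘(ℝ, ℝ) ∞ (fun t => g (γ t)) (γ ⁻¹' O) :=
    hg.comp hγ.contMDiffOn fun t ht => ht
  have h2 := mvfderiv_comp_on hJ hO hγ.contMDiffOn (fun t ht => ht) hg ht (1 : ℝ)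
  have hd : DifferentiableAt ℝ (fun t => g (γ t)) t :=
    (contMDiffAt_iff_contDiffAt.1 (hs.contMDiffAt (hJ.mem_nhds ht))).differentiableAt (by simp)
  have h1 : (mvfderiv 𝓘(ℝ, ℝ) (fun t => g (γ t)) t) (1 : ℝ) =
      (fderiv ℝ (fun t => g (γ t)) t) 1 := by
    rw [← mfderiv_eq_fderiv]
    rfl
  exact hd.hasDerivAt.congr_deriv (h1.symm.trans h2)

/-- The velocity of a curve tangent to `S` in terms of a frame of `S`. -/
theorem exists_curve_coeff {S : ∀ x : M, Submodule ℝ (Tan E x)} (hS : IsDistribution S)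
    {γ : ℝ → M} (hγ : ContMDiff 𝓘(ℝ, ℝ) 𝓘(ℝ, E) ∞ γ)
    (htan : ∀ t, tanRange E ℝ γ t ≤ S (γ t)) (t₀ : ℝ) :
    ∃ (l : ℕ) (O : Set M) (Z : Fin l → ∀ x : M, Tan E x) (c : Fin l → ℝ → ℝ), IsOpen O ∧
      γ t₀ ∈ O ∧ (∀ i, IsFieldIn S (Z i) O) ∧ (∀ i, ContinuousOn (c i) (γ ⁻¹' O)) ∧
      ∀ t ∈ γ ⁻¹' O, tanMap E ℝ γ t (1 : ℝ) = ∑ i, c i t • Z i (γ t) := by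
  obtain ⟨l, U, Z, hU, hp, hZ, h⟩ := hS (γ t₀)
  have hO := hU.inter (chartAt E (γ t₀)).open_source
  have hp' : γ t₀ ∈ U ∩ (chartAt E (γ t₀)).source := ⟨hp, mem_chart_source E _⟩
  have hrank : ∀ x ∈ U ∩ (chartAt E (γ t₀)).source,
      Module.finrank ℝ (Submodule.span ℝ (range fun i => toCoord (γ t₀) x (Z i x))) = l := by
    intro x hx
    have := (h x hx.1).1.map' (toCoord (E := E) (γ t₀) x).toLinearMap
      (LinearMap.ker_eq_bot.2 (toCoord_injective hx.2))
    exact (finrank_span_eq_card this).trans (Fintype.card_fin l)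
  obtain ⟨O, hOU, hO', hpO, G, hG, hGZ⟩ := exists_smooth_coeff
    (σ := fun i x => toCoord (γ t₀) x (Z i x)) hO
    (fun i => (smoothFieldOn_iff hO inter_subset_right _).1 ((hZ i).mono inter_subset_left)) hp'
    fun x hx => by rw [hrank x hx, hrank _ hp']
  have hJ := hO'.preimage hγ.continuous
  have hw := contMDiffOn_toCoord_tanMap (O := γ ⁻¹' O) (b := γ t₀) hJ hγ.contMDiffOn
    (fun t ht => (hOU ht).2) (smoothFieldOn_one _)
  have hc : ContMDiffOn 𝓘(ℝ, ℝ) 𝓘(ℝ, Fin l → ℝ) ∞ (fun t => G (γ t)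
      (toCoord (γ t₀) (γ t) (tanMap E ℝ γ t (1 : ℝ)))) (γ ⁻¹' O) :=
    (hG.comp hγ.contMDiffOn fun t ht => ht).clm_apply hw
  refine ⟨l, O, Z, fun i t => G (γ t) (toCoord (γ t₀) (γ t) (tanMap E ℝ γ t (1 : ℝ))) i, hO', hpO,
    fun i => ⟨(hZ i).mono fun x hx => (hOU hx).1, fun x hx => ?_⟩,
    fun i => (contMDiffOn_pi_space.1 hc i).continuousOn, fun t ht => ?_⟩
  · rw [← (h x (hOU hx).1).2]
    exact Submodule.subset_span (mem_range_self i)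
  · apply toCoord_injective (hOU ht).2
    have hmem : tanMap E ℝ γ t (1 : ℝ) ∈ S (γ t) := htan t ⟨(1 : ℝ), rfl⟩
    rw [← (h _ (hOU ht).1).2] at hmem
    have := Submodule.mem_map_of_mem (f := (toCoord (E := E) (γ t₀) (γ t)).toLinearMap) hmem
    rw [Submodule.map_span, ← range_comp] at this
    rw [map_sum]
    simp only [map_smul]
    exact (hGZ (γ t) ht _ this).symm

omit [FiniteDimensional ℝ E] in
/-- The Leibniz rule for the pairing. -/
theorem mvfderiv_pairing {Z : ∀ x : M, Tan E x} {σ τ : ∀ x : M, GenTan E x} {O : Set M}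
    (hO : IsOpen O) (hZ : SmoothFieldOn Z O) (hσ : SmoothGenOn σ O) (hτ : SmoothGenOn τ O) {x : M}
    (hx : x ∈ O) :
    mvfderiv 𝓘(ℝ, E) (fun x => pairing (σ x) (τ x)) x (Z x) =
      pairing ((VectorField.mlieBracket 𝓘(ℝ, E) Z (fun y => (σ y).1) x,
        lieForm Z (fun y => (σ y).2) x) : GenTan E x) (τ x) +
      pairing (σ x) ((VectorField.mlieBracket 𝓘(ℝ, E) Z (fun y => (τ y).1) x,
        lieForm Z (fun y => (τ y).2) x) : GenTan E x) := by
  have h := congrArg (fun l : Cot E x => l (Z x))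
    (mvfderiv_add (mdifferentiableAt_of_smoothOn hO (hτ.2.apply hσ.1) hx)
      (mdifferentiableAt_of_smoothOn hO (hσ.2.apply hτ.1) hx))
  refine h.trans ?_
  simp only [pairing, add_apply]
  rw [lieForm_apply hO hZ hσ.2 hτ.1 hx, lieForm_apply hO hZ hτ.2 hσ.1 hx]
  ring

end Curves

/-! ### The image of L on B is constant along leaves. -/

section Invariance

variable {E : Type*} [NormedAddCommGroup E] [NormedSpace ℝ E] [FiniteDimensional ℝ E]
  {M : Type*} [TopologicalSpace M] [ChartedSpace E M] [IsManifold 𝓘(ℝ, E) ∞ M]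
  {G : Type*} [NormedAddCommGroup G] [NormedSpace ℝ G] [FiniteDimensional ℝ G]
  {B : Type*} [TopologicalSpace B] [ChartedSpace G B] [IsManifold 𝓘(ℝ, G) ∞ B]
  {S : ∀ x : M, Submodule ℝ (Tan E x)} {τ : M → B} (hτ : IsLeafSpace (E := G) S τ)
  (hS : IsDistribution S) {L : ∀ x : M, Submodule ℝ (GenTan E x)} (hL : ∀ x, orth (L x) = L x)
  (hsub : IsSubbundle L) (hSL : ∀ x, tanPart (S x) ≤ L x) (hsym : IsSymmetry S L)

omit [FiniteDimensional ℝ E] [IsManifold 𝓘(ℝ, E) ∞ M] in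
include hL hSL in
theorem snd_mem_ann_of_tanPart_le {x : M} {v : GenTan E x} (hv : v ∈ L x) : v.2 ∈ ann (S x) :=
  mem_orth_tanPart.1 (orth_anti (hSL x) ((hL x).ge hv))

include hτ hS hL hsub hSL hsym in
/-- A basic section which lies in `L` at a point lies in `L` at nearby points of the leaf. -/
theorem exists_ball_mem {O : Set M} {U : Set B} (hO : IsOpen O) (hU : IsOpen U)
    (hOU : MapsTo τ O U) {σ : ∀ x : M, GenTan E x} {σ' : ∀ b : B, GenTan G b}
    (hσ : SmoothGenOn σ O) (hσ' : SmoothGenOn σ' U) (hrel : Related τ σ σ' O) {γ : ℝ → M}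
    (hγ : ContMDiff 𝓘(ℝ, ℝ) 𝓘(ℝ, E) ∞ γ) (htan : ∀ t, tanRange E ℝ γ t ≤ S (γ t)) {t₀ : ℝ}
    (ht₀ : γ t₀ ∈ O) :
    ∃ ε > 0, Metric.ball t₀ ε ⊆ γ ⁻¹' O ∧ ∀ t₁ ∈ Metric.ball t₀ ε, ∀ t₂ ∈ Metric.ball t₀ ε,
      σ (γ t₁) ∈ L (γ t₁) → σ (γ t₂) ∈ L (γ t₂) := by
  obtain ⟨k, U₁, e, hU₁, hp₁, he, hspan⟩ := hsub (γ t₀)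
  obtain ⟨l, O₂, Z, c, hO₂, hp₂, hZ, hc, hγZ⟩ := exists_curve_coeff hS hγ htan t₀
  have hO₃ := (hO.inter hU₁).inter hO₂
  obtain ⟨O₄, h₄, hO₄, hp₄, hcoeff⟩ := exists_smooth_coeff_gen hO₃ (σ := e)
    (fun i => (he i).mono fun x hx => hx.1.2) (x₀ := γ t₀) ⟨⟨ht₀, hp₁⟩, hp₂⟩ (fun x hx => by
      rw [finrank_span_eq_card (hspan x hx.1.2).1, finrank_span_eq_card (hspan _ hp₁).1])
  have heL : ∀ a, IsSectionOn L (e a) O₄ := fun a =>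
    ⟨(he a).mono fun x hx => (h₄ hx).1.2, fun x hx => by
      rw [← (hspan x (h₄ hx).1.2).2]
      exact Submodule.subset_span (mem_range_self a)⟩
  have hZ₄ : ∀ i, IsFieldIn S (Z i) O₄ := fun i => (hZ i).mono fun x hx => (h₄ hx).2
  have hσ₄ : SmoothGenOn σ O₄ := hσ.mono fun x hx => (h₄ hx).1.1
  -- Here the symmetry enters: the Lie derivatives of a frame of L are smooth combinations of that
  -- frame.
  have hA : ∀ i a, ∃ A : Fin k → M → ℝ, (∀ b, ContMDiffOn 𝓘(ℝ, E) 𝓘(ℝ, ℝ) ∞ (A b) O₄) ∧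
      ∀ x ∈ O₄, ((VectorField.mlieBracket 𝓘(ℝ, E) (Z i) (fun y => (e a y).1) x,
        lieForm (Z i) (fun y => (e a y).2) x) : GenTan E x) = ∑ b, A b x • e b x := by
    intro i a
    refine hcoeff (fun x => ((VectorField.mlieBracket 𝓘(ℝ, E) (Z i) (fun y => (e a y).1) x,
        lieForm (Z i) (fun y => (e a y).2) x) : GenTan E x))
      ⟨SmoothFieldOn.mlieBracket hO₄ (hZ₄ i).1 (heL a).1.1,
        SmoothFormOn.lieForm hO₄ (heL a).1.2 (hZ₄ i).1⟩ fun x hx => ?_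
    rw [(hspan x (h₄ hx).1.2).2]
    exact hsym O₄ (Z i) (e a) hO₄ (hZ₄ i) (heL a) x hx
  choose A hAs hA using hA
  -- Leibniz rule for the pairing. The Lie derivative of the basic section σ is `([Z, X], 0)` with
  -- `[Z, X]` in S, and S pairs to zero with L, so only the derivative of the frame contributes.
  have hder : ∀ i a, ∀ x ∈ O₄, mvfderiv 𝓘(ℝ, E) (fun x => pairing (σ x) (e a x)) x (Z i x) =
      ∑ b, A i a b x * pairing (σ x) (e b x) := by
    intro i a x hx
    rw [mvfderiv_pairing hO₄ (hZ₄ i).1 hσ₄ (heL a).1 hx, hA i a x hx]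
    have hmaps : MapsTo τ O₄ U := fun y hy => hOU (h₄ hy).1.1
    have h1 := hτ.mlieBracket_mem hO₄ hU hmaps (hZ₄ i) hσ₄.1 hσ'.1
      (fun y hy => (hrel y (h₄ hy).1.1).1) hx
    have h2 : lieForm (Z i) (fun y => (σ y).2) x = 0 := by
      have h3 := hτ.lieForm_pull hS hO₄ hU hmaps (hZ₄ i) hσ'.2 hx
      have h4 : ∀ y ∈ O₄, (σ y).2 = (σ' (τ y)).2.comp (tanMap G E τ y) := fun y hy =>
        (hrel y (h₄ hy).1.1).2
      rw [lieForm, extD_congr hO₄ h4 hx, mvfderiv_congr hO₄ (fun y hy => by rw [h4 y hy]) hx]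
      exact h3
    have h5 : pairing ((VectorField.mlieBracket 𝓘(ℝ, E) (Z i) (fun y => (σ y).1) x,
        lieForm (Z i) (fun y => (σ y).2) x) : GenTan E x) (e a x) = 0 := by
      rw [h2, pairing, snd_mem_ann_of_tanPart_le hL hSL ((heL a).2 x hx) _ h1, zero_apply,
        add_zero]
    rw [h5, zero_add, ← pairingForm_apply, map_sum]
    simp only [map_smul, smul_eq_mul, pairingForm_apply]
  let J := γ ⁻¹' O₄
  have hJ : IsOpen J := hO₄.preimage hγ.continuous
  -- Since L = L^⊥, membership of σ in L is the vanishing of all its pairings with the frame.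
  have hmem : ∀ t ∈ J, (σ (γ t) ∈ L (γ t) ↔ (fun a => pairing (σ (γ t)) (e a (γ t))) = 0) := by
    intro t ht
    constructor
    · intro h
      ext a
      exact (hL (γ t)).ge h _ ((heL a).2 _ ht)
    · intro h
      refine mem_of_pairing_eq_zero (hL _) fun w hw => ?_
      rw [← (hspan _ (h₄ ht).1.2).2, Submodule.mem_span_range_iff_exists_fun] at hw
      obtain ⟨d, rfl⟩ := hw
      rw [← pairingForm_apply, map_sum]
      refine Finset.sum_eq_zero fun a _ => ?_
      rw [map_smul, pairingForm_apply, congrFun h a, Pi.zero_apply, smul_zero]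
  -- The pairings along γ solve a linear system: the frame coefficients `c` of the velocity,
  -- contracted with the matrices `A`.
  obtain ⟨ε, hε, hball, hzero⟩ := exists_ball_zero_of_linearODE
    (u := fun t a => pairing (σ (γ t)) (e a (γ t)))
    (m := fun a b t => ∑ i, c i t * A i a b (γ t)) hJ
    (fun a b => continuousOn_finsetSum _ fun i _ =>
      ((hc i).mono fun t ht => (h₄ ht).2).mul
        ((hAs i a b).continuousOn.comp hγ.continuous.continuousOn fun t ht => ht))
    (fun t ht a => by
      have h := hasDerivAt_comp_curve hγ hO₄ (SmoothGenOn.pairing hσ₄ (heL a).1) (t := t) ht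
      rw [hγZ t (h₄ ht).2, map_sum] at h
      refine h.congr_deriv ?_
      simp only [map_smul, smul_eq_mul, hder _ a (γ t) ht, Finset.mul_sum, Finset.sum_mul]
      rw [Finset.sum_comm]
      simp only [mul_assoc]) (t₀ := t₀) hp₄
  refine ⟨ε, hε, fun t ht => (h₄ (hball ht)).1.1, fun t₁ h₁ t₂ h₂ h => ?_⟩
  rw [hmem t₂ (hball h₂)]
  exact hzero t₁ h₁ t₂ h₂ ((hmem t₁ (hball h₁)).1 h)

-- Two lifts of a vector differ by an element of ker τ_* = S ⊂ L, so membership can be checked on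
-- any chosen lift.
omit [FiniteDimensional ℝ E] [IsManifold 𝓘(ℝ, E) ∞ M] [FiniteDimensional ℝ G]
  [IsManifold 𝓘(ℝ, G) ∞ B] in
include hτ hSL in
theorem mem_pushforwardAt_iff {x : M} {X : Tan E x} {w : GenTan G (τ x)}
    (hX : tanMap G E τ x X = w.1) :
    w ∈ pushforwardAt τ L x ↔ ((X, w.2.comp (tanMap G E τ x)) : GenTan E x) ∈ L x := by
  constructor
  · rintro ⟨Y, hY, hYw⟩
    have hXY : X - Y ∈ S x := by rw [hτ.mem_iff, map_sub, hX, hYw, sub_self]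
    have := (L x).add_mem hY (hSL x (mem_tanPart.2 ⟨hXY, rfl⟩ : ((X - Y, 0) : GenTan E x) ∈ _))
    rwa [Prod.mk_add_mk, add_zero, add_sub_cancel] at this
  · exact fun h => ⟨X, h, hX.symm⟩

-- The reparametrised curve `s ↦ γ (s * t)` joins γ 0 to γ t within the leaf.
omit [FiniteDimensional ℝ E] [IsManifold 𝓘(ℝ, E) ∞ M] [FiniteDimensional ℝ G]
  [IsManifold 𝓘(ℝ, G) ∞ B] in
include hτ in
theorem IsLeafSpace.curve_const {γ : ℝ → M} (hγ : ContMDiff 𝓘(ℝ, ℝ) 𝓘(ℝ, E) ∞ γ)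
    (htan : ∀ t, tanRange E ℝ γ t ≤ S (γ t)) (t : ℝ) : τ (γ t) = τ (γ 0) := by
  refine ((hτ.fibre _ _).2 ⟨fun s => γ (s * t), ?_, by simp, by simp, fun s => ?_⟩).symm
  · exact hγ.comp (contDiff_id.mul contDiff_const).contMDiff
  · rintro _ ⟨r, rfl⟩
    have hm : MDifferentiableAt 𝓘(ℝ, ℝ) 𝓘(ℝ, ℝ) (fun s : ℝ => s * t) s :=
      mdifferentiableAt_iff_differentiableAt.2 (by fun_prop)
    refine htan (s * t) ⟨mfderiv 𝓘(ℝ, ℝ) 𝓘(ℝ, ℝ) (fun s : ℝ => s * t) s r, ?_⟩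
    exact (mfderiv_comp_apply (I' := 𝓘(ℝ, ℝ)) s ((hγ (s * t)).mdifferentiableAt (by simp)) hm
      r).symm

include hτ hS hL hsub hSL hsym in
/-- The image of `L` in the leaf space does not depend on the point of the leaf. -/
theorem pushforwardAt_eq_of_eq {p p' : M} (h : τ p = τ p') (v : G) (β : G →L[ℝ] ℝ)
    (hmem : ((v, β) : GenTan G (τ p)) ∈ pushforwardAt (E := G) τ L p) :
    ((v, β) : GenTan G (τ p')) ∈ pushforwardAt (E := G) τ L p' := by
  obtain ⟨γ, hγ, rfl, rfl, htan⟩ := (hτ.fibre p p').1 h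
  let P : ℝ → Prop := fun t => ((v, β) : GenTan G (τ (γ t))) ∈ pushforwardAt (E := G) τ L (γ t)
  have hconst := hτ.curve_const hγ htan
  -- Open-closed argument on the parameter line: membership cannot change locally, and ℝ is
  -- connected.
  have hloc : IsLocallyConstant P := by
    rw [IsLocallyConstant.iff_eventually_eq]
    intro t₀
    let b := τ (γ t₀)
    have hb : b ∈ (chartAt G b).source := mem_chart_source G b
    obtain ⟨O, X, hO, hpO, hmaps, hX, hrel⟩ := exists_lift hτ.smooth hτ.submersion
      (chartAt G b).open_source (smoothFieldOn_ofCoord b v) hb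
    -- The element `(v, β)` extended with constant coordinates in the chart at `b`; its lift σ is
    -- related to it.
    let σ' : ∀ b' : B, GenTan G b' := fun b' => (ofCoord b b' v, β.comp (toCoord b b'))
    let σ : ∀ x : M, GenTan E x := fun x => (X x, (σ' (τ x)).2.comp (tanMap G E τ x))
    have hσ' : SmoothGenOn σ' (chartAt G b).source :=
      ⟨smoothFieldOn_ofCoord b v, smoothFormOn_toCoord b β⟩
    have hσ : SmoothGenOn σ O :=
      ⟨hX, SmoothFormOn.pull hO hτ.smooth.contMDiffOn hmaps hσ'.2⟩
    obtain ⟨ε, hε, hball, hz⟩ := exists_ball_mem hτ hS hL hsub hSL hsym hO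
      (chartAt G b).open_source hmaps hσ hσ' (fun x hx => ⟨hrel x hx, rfl⟩) hγ htan hpO
    have hP : ∀ t ∈ Metric.ball t₀ ε, (P t ↔ σ (γ t) ∈ L (γ t)) := by
      intro t ht
      have hw : ∀ b' : B, b' = b → σ' b' = ((v, β) : GenTan G b') := by
        rintro _ rfl
        refine Prod.ext (ofCoord_self b v) ?_
        ext w
        exact congrArg β (toCoord_self b w)
      have hw' := hw (τ (γ t)) ((hconst t).trans (hconst t₀).symm)
      change ((v, β) : GenTan G (τ (γ t))) ∈ pushforwardAt (E := G) τ L (γ t) ↔ _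
      rw [← hw']
      exact mem_pushforwardAt_iff hτ hSL (hrel _ (hball ht))
    filter_upwards [Metric.ball_mem_nhds t₀ hε] with t ht
    have h0 := Metric.mem_ball_self (x := t₀) hε
    rw [hP t ht, hP t₀ h0]
    exact propext ⟨hz t ht t₀ h0, hz t₀ h0 t ht⟩
  have h01 : P 0 = P 1 := hloc.apply_eq_of_preconnectedSpace 0 1
  exact h01.mp hmem

end Invariance
end
end DiracGeometry

namespace DiracGeometry

noncomputable section

/-! ### The Dirac structure on the leaf space. -/

section LeafSpace

variable {E : Type*} [NormedAddCommGroup E] [NormedSpace ℝ E] [FiniteDimensional ℝ E]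
  {M : Type*} [TopologicalSpace M] [ChartedSpace E M] [IsManifold 𝓘(ℝ, E) ∞ M]
  {G : Type*} [NormedAddCommGroup G] [NormedSpace ℝ G] [FiniteDimensional ℝ G]
  {B : Type*} [TopologicalSpace B] [ChartedSpace G B] [IsManifold 𝓘(ℝ, G) ∞ B]

-- Differentiates f ∘ s = id. The fibres over `f (s b)` and `b` are distinct types, so the
-- comparison takes place in the model space G.
omit [FiniteDimensional ℝ E] [IsManifold 𝓘(ℝ, E) ∞ M] [FiniteDimensional ℝ G]
  [IsManifold 𝓘(ℝ, G) ∞ B] in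
theorem tanMap_localSection {f : M → B} (hf : ContMDiff 𝓘(ℝ, E) 𝓘(ℝ, G) ∞ f) {V : Set B}
    (hV : IsOpen V) {s : B → M} (hs : ContMDiffOn 𝓘(ℝ, G) 𝓘(ℝ, E) ∞ s V)
    (h : ∀ b ∈ V, f (s b) = b) {b : B} (hb : b ∈ V) (w : G) :
    (show G from tanMap G E f (s b) (tanMap E G s b w)) = w := by
  have h1 := mfderiv_comp_apply (I := 𝓘(ℝ, G)) (I'' := 𝓘(ℝ, G)) b
    ((hf (s b)).mdifferentiableAt (by simp))
    ((hs.contMDiffAt (hV.mem_nhds hb)).mdifferentiableAt (by simp)) w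
  have h2 : (f ∘ s) =ᶠ[𝓝 b] id := Filter.eventuallyEq_of_mem (hV.mem_nhds hb) h
  refine h1.symm.trans ?_
  exact (DFunLike.congr_fun (h2.mfderiv_eq (I := 𝓘(ℝ, G)) (I' := 𝓘(ℝ, G))) w).trans
    (DFunLike.congr_fun (mfderiv_id (I := 𝓘(ℝ, G))) w)

omit [FiniteDimensional ℝ G] [IsManifold 𝓘(ℝ, G) ∞ B] in
theorem mem_congr_point {D : ∀ b : B, Submodule ℝ (GenTan G b)} {b b' : B} (h : b = b') {v : G}
    {β : G →L[ℝ] ℝ} (hv : ((v, β) : GenTan G b) ∈ D b) : ((v, β) : GenTan G b') ∈ D b' := by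
  subst h
  exact hv

variable {S : ∀ x : M, Submodule ℝ (Tan E x)} {τ : M → B} (hτ : IsLeafSpace (E := G) S τ)
  {L : ∀ x : M, Submodule ℝ (GenTan E x)} (hSL : ∀ x, tanPart (S x) ≤ L x)

-- D_B is read off at a chosen point of each fibre; invariance along leaves makes the choice
-- immaterial.
include hτ hSL in
theorem exists_eq_pushforwardAt (hS : IsDistribution S) (hL : ∀ x, orth (L x) = L x)
    (hsub : IsSubbundle L) (hsym : IsSymmetry S L) :
    ∃ DB : ∀ b : B, Submodule ℝ (GenTan G b), ∀ p, DB (τ p) = pushforwardAt (E := G) τ L p := by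
  refine ⟨fun b => show Submodule ℝ (G × (G →L[ℝ] ℝ)) from
    pushforwardAt (E := G) τ L (Function.surjInv hτ.surjective b), fun p => ?_⟩
  have hp := Function.surjInv_eq hτ.surjective (τ p)
  ext ⟨v, β⟩
  exact ⟨pushforwardAt_eq_of_eq hτ hS hL hsub hSL hsym hp v β,
    pushforwardAt_eq_of_eq hτ hS hL hsub hSL hsym hp.symm v β⟩

variable {DB : ∀ b : B, Submodule ℝ (GenTan G b)}
  (hDB : ∀ p, DB (τ p) = pushforwardAt (E := G) τ L p)

include hτ hSL hDB

/-- An arbitrary section `(X, ξ)` of L is evaluated along a local section `s` of τ, as `(τ_* X, s^*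
ξ)`; it need not be projectable. No integrability is involved, so the lemma applies equally to ρ : N
→ Q. -/
theorem exists_section_of_eq_pushforwardAt (hL : ∀ x, orth (L x) = L x) (hsub : IsSubbundle L)
    (b : B) (w : GenTan G b) (hw : w ∈ DB b) :
    ∃ (U : Set B) (σ : ∀ b : B, GenTan G b), IsOpen U ∧ b ∈ U ∧ IsSectionOn DB σ U ∧ σ b = w := by
  obtain ⟨p, rfl⟩ := hτ.surjective b
  have hw' := hw
  rw [hDB] at hw'
  obtain ⟨X₀, hX₀, hw1⟩ := hw'
  obtain ⟨U, σ, hU, hpU, hσ, hσp⟩ := hsub.exists_section hX₀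
  obtain ⟨V, s, hV, hpV, hs, hsp, hτs⟩ := exists_localSection hτ.smooth p (hτ.submersion p)
  have hO : IsOpen (V ∩ s ⁻¹' U) := hs.continuousOn.isOpen_inter_preimage hV hU
  have hpU' : s (τ p) ∈ U := by rw [hsp]; exact hpU
  refine ⟨V ∩ s ⁻¹' U, fun b => (show G from tanMap G E τ (s b) (σ (s b)).1,
    (σ (s b)).2.comp (tanMap E G s b)), hO, ⟨hpV, hpU'⟩, ⟨⟨?_, ?_⟩, fun b hb => ?_⟩, ?_⟩
  · refine smoothFieldOn_of_forall_form hO fun V' hV' hV'o η hη => ?_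
    have h1 := (SmoothFormOn.pull ((hV'o.preimage hτ.smooth.continuous).inter hU)
      hτ.smooth.contMDiffOn (fun x hx => hx.1) hη).apply (hσ.1.1.mono inter_subset_right)
    refine (h1.comp (hs.mono fun b hb => (hV' hb).1) fun b hb => ⟨?_, (hV' hb).2⟩).congr
      fun b hb => ?_
    · change τ (s b) ∈ V'
      rw [hτs b (hV' hb).1]
      exact hb
    · have h2 : ∀ b', b' = b → ∀ v : G, η b v = η b' v := by
        rintro _ rfl v
        rfl
      exact h2 _ (hτs b (hV' hb).1) _
  · exact SmoothFormOn.pull hO (hs.mono inter_subset_left) (fun b hb => hb.2) hσ.1.2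
  · refine mem_congr_point (hτs b hb.1) ?_
    rw [hDB]
    refine ⟨(σ (s b)).1, ?_, rfl⟩
    -- `τ^* s^* ξ = ξ`, because `s_* τ_* v - v` is vertical and ξ kills S.
    have h1 : ((σ (s b)).2.comp (tanMap E G s b)).comp (tanMap G E τ (s b)) = (σ (s b)).2 := by
      ext v
      have hmem : tanMap E G s b (tanMap G E τ (s b) v) - v ∈ S (s b) := by
        rw [hτ.mem_iff, map_sub]
        exact sub_eq_zero.2 (tanMap_localSection hτ.smooth hV hs hτs hb.1 _)
      have h2 := snd_mem_ann_of_tanPart_le hL hSL (hσ.2 _ hb.2) _ hmem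
      rw [map_sub] at h2
      exact sub_eq_zero.1 h2
    exact h1.symm ▸ hσ.2 _ hb.2
  · have h1 : ∀ x, x = p → (show G from tanMap G E τ x (σ x).1) = w.1 := by
      rintro _ rfl
      rw [hσp]
      exact hw1.symm
    have h2 : ∀ x, x = p → ∀ u : Tan E x,
        (σ x).2 u = (show G →L[ℝ] ℝ from w.2) (show G from tanMap G E τ x u) := by
      rintro _ rfl u
      rw [hσp]
      rfl
    refine Prod.ext (h1 _ hsp) ?_
    ext v
    exact (h2 _ hsp _).trans (congrArg (show G →L[ℝ] ℝ from w.2)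
      (tanMap_localSection hτ.smooth hV hs hτs hpV v))

theorem exists_lift_section {U : Set B} (hU : IsOpen U) {σ : ∀ b : B, GenTan G b}
    (hσ : IsSectionOn DB σ U) {p : M} (hp : τ p ∈ U) :
    ∃ (O : Set M) (σ' : ∀ x : M, GenTan E x), IsOpen O ∧ p ∈ O ∧ MapsTo τ O U ∧
      IsSectionOn L σ' O ∧ Related τ σ' σ O := by
  obtain ⟨O, X, hO, hpO, hmaps, hX, hrel⟩ := exists_lift hτ.smooth hτ.submersion hU hσ.1.1 hp
  refine ⟨O, fun x => (X x, (σ (τ x)).2.comp (tanMap G E τ x)), hO, hpO, hmaps,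
    ⟨⟨hX, SmoothFormOn.pull hO hτ.smooth.contMDiffOn hmaps hσ.1.2⟩, fun x hx => ?_⟩,
    fun x hx => ⟨hrel x hx, rfl⟩⟩
  rw [← mem_pushforwardAt_iff hτ hSL (hrel x hx), ← hDB]
  exact hσ.2 _ (hmaps hx)

/-- Sections of D_B lift to related sections of L, so by naturality ⟨[σ₁, σ₂], σ₃⟩ on B equals its
counterpart on L, which is zero. -/
theorem isDirac_of_eq_pushforwardAt (hL : IsDirac L) : IsDirac DB := by
  have hLo := orth_eq_of_isDirac hL
  have horth : ∀ b, orth (DB b) = DB b := by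
    intro b
    obtain ⟨p, rfl⟩ := hτ.surjective b
    rw [hDB]
    exact orth_pushforwardAt τ (hLo p)
  have hex := exists_section_of_eq_pushforwardAt hτ hSL hDB hLo hL.subbundle
  have hiso : ∀ b, IsIsotropic (DB b) := fun b => ((maximal_iff_orth_eq).2 (horth b)).prop
  refine ⟨isSubbundle_of_exists_section (fun b => finrank_of_orth_eq (horth b)) hex,
    fun b => (maximal_iff_orth_eq).2 (horth b), fun U σ₁ σ₂ hU h₁ h₂ b hb => ?_⟩
  refine mem_of_pairing_eq_zero (horth b) fun w hw => ?_
  obtain ⟨U₃, σ₃, hU₃, hb₃, h₃, rfl⟩ := hex b w hw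
  obtain ⟨p, rfl⟩ := hτ.surjective b
  have hUU := hU.inter hU₃
  obtain ⟨O₁, τ₁, hO₁, hp₁, m₁, k₁, r₁⟩ := exists_lift_section hτ hSL hDB hUU
    (h₁.mono inter_subset_left) ⟨hb, hb₃⟩
  obtain ⟨O₂, τ₂, hO₂, hp₂, m₂, k₂, r₂⟩ := exists_lift_section hτ hSL hDB hUU
    (h₂.mono inter_subset_left) ⟨hb, hb₃⟩
  obtain ⟨O₃, τ₃, hO₃, hp₃, m₃, k₃, r₃⟩ := exists_lift_section hτ hSL hDB hUU
    (h₃.mono inter_subset_right) ⟨hb, hb₃⟩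
  have hO := (hO₁.inter hO₂).inter hO₃
  have k₁' := k₁.mono (V := O₁ ∩ O₂ ∩ O₃) fun x hx => hx.1.1
  have k₂' := k₂.mono (V := O₁ ∩ O₂ ∩ O₃) fun x hx => hx.1.2
  have k₃' := k₃.mono (V := O₁ ∩ O₂ ∩ O₃) fun x hx => hx.2
  rw [← Related.pairing_courant hO hUU hτ.smooth.contMDiffOn (fun x hx => m₁ hx.1.1)
    k₁'.1 k₂'.1 k₃'.1 (h₁.1.mono inter_subset_left) (h₂.1.mono inter_subset_left)
    (h₃.1.mono inter_subset_right) (fun x hx => r₁ x hx.1.1) (fun x hx => r₂ x hx.1.2)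
    (fun x hx => r₃ x hx.2) (fun x hx => hiso x _ (h₁.2 x hx.1) _ (h₂.2 x hx.1))
    (fun x hx => hiso x _ (h₁.2 x hx.1) _ (h₃.2 x hx.2)) ⟨⟨hp₁, hp₂⟩, hp₃⟩]
  exact (hL.maximal p).prop _ (hL.closed _ _ _ hO k₁' k₂' p ⟨⟨hp₁, hp₂⟩, hp₃⟩) _
    (k₃'.2 p ⟨⟨hp₁, hp₂⟩, hp₃⟩)

end LeafSpace
end
end DiracGeometry

namespace DiracGeometry

noncomputable section

/-! ### Pullback of Dirac structures by immersions. -/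

section Pullback

variable {E : Type*} [NormedAddCommGroup E] [NormedSpace ℝ E] [FiniteDimensional ℝ E]
  {M : Type*} [TopologicalSpace M] [ChartedSpace E M] [IsManifold 𝓘(ℝ, E) ∞ M]
  {F : Type*} [NormedAddCommGroup F] [NormedSpace ℝ F] [FiniteDimensional ℝ F]
  {N : Type*} [TopologicalSpace N] [ChartedSpace F N] [IsManifold 𝓘(ℝ, F) ∞ N]
  {j : N → M} {D : ∀ x : M, Submodule ℝ (GenTan E x)}

/-- Generically on `N`, every element of the pullback of `D` extends to a section which is related
to a section of `D`. -/
theorem exists_related_section (hD : IsSubbundle D) (hj : ContMDiff 𝓘(ℝ, F) 𝓘(ℝ, E) ∞ j)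
    (hinj : ∀ y, Function.Injective (tanMap E F j y)) {O : Set N} (hO : IsOpen O)
    (hne : O.Nonempty) :
    ∃ y₀ ∈ O, ∀ w ∈ pullback (F := F) j D y₀, ∃ (O' : Set N) (V : Set M)
      (σ : ∀ y : N, GenTan F y) (τ : ∀ x : M, GenTan E x), O' ⊆ O ∧ IsOpen O' ∧ IsOpen V ∧
      y₀ ∈ O' ∧ MapsTo j O' V ∧ IsSectionOn (pullback (F := F) j D) σ O' ∧ IsSectionOn D τ V ∧
      Related j σ τ O' ∧ σ y₀ = w := by
  obtain ⟨y₁, hy₁⟩ := hne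
  obtain ⟨k, U, e, hU, hyU, he, hspan⟩ := hD (j y₁)
  obtain ⟨R, O₂, r, hR, hO₂, hy₂, hjR, hr, hrj⟩ := exists_localRetraction hj y₁ (hinj y₁)
  let b := j y₁
  have hUb := hU.inter (chartAt E b).open_source
  let O₁ := ((O ∩ O₂) ∩ (chartAt F y₁).source) ∩ j ⁻¹' (U ∩ (chartAt E b).source)
  have hO₁ : IsOpen O₁ :=
    ((hO.inter hO₂).inter (chartAt F y₁).open_source).inter (hUb.preimage hj.continuous)
  -- In coordinates, `A y (c, u)` is the vector part of `∑ cᵢ eᵢ` minus `j_* u`. Its kernel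
  -- parametrises the pullback, and its rank may jump with the intersection of TN and the vector
  -- parts of D.
  let A : N → ((Fin k → ℝ) × F) →L[ℝ] E := fun y =>
    (combo fun i => toCoord b (j y) (e i (j y)).1).comp (ContinuousLinearMap.fst ℝ _ F) -
      ((toCoord (E := E) b (j y)).comp ((tanMap E F j y).comp (ofCoord y₁ y))).comp
        (ContinuousLinearMap.snd ℝ (Fin k → ℝ) F)
  have hA : ContMDiffOn 𝓘(ℝ, F) 𝓘(ℝ, ((Fin k → ℝ) × F) →L[ℝ] E) ∞ A O₁ := by
    refine ContMDiffOn.sub ((contMDiffOn_combo fun i => ?_).clm_comp contMDiffOn_const)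
      (ContMDiffOn.clm_comp (contMDiffOn_clm_of_apply fun v => ?_) contMDiffOn_const)
    · exact ((smoothFieldOn_iff hUb inter_subset_right _).1 ((he i).1.mono inter_subset_left)).comp
        hj.contMDiffOn fun y hy => hy.2
    · exact contMDiffOn_toCoord_tanMap hO₁ hj.contMDiffOn (fun y hy => hy.2.2)
        ((smoothFieldOn_ofCoord y₁ v).mono fun y hy => hy.1.2)
  have hy₁' : y₁ ∈ O₁ := ⟨⟨⟨hy₁, hy₂⟩, mem_chart_source F y₁⟩, hyU, mem_chart_source E b⟩
  obtain ⟨y₀, hy₀, hmax⟩ := exists_max_on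
    (fun y => Module.finrank ℝ (LinearMap.range (A y).toLinearMap))
    (fun y => Submodule.finrank_le _) ⟨y₁, hy₁'⟩
  obtain ⟨O', hO'O₁, hO', hy₀', C, hC, hAC⟩ := exists_generalizedInverse hO₁ hA hy₀ hmax
  refine ⟨y₀, hy₀.1.1.1, fun w hw => ?_⟩
  obtain ⟨ξ, hξ, hw2⟩ := mem_pullback.1 hw
  rw [← (hspan _ hy₀.2.1).2, Submodule.mem_span_range_iff_exists_fun] at hξ
  obtain ⟨c₀, hc₀⟩ := hξ
  have hc1 : ∑ i, c₀ i • (e i (j y₀)).1 = tanMap E F j y₀ w.1 := by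
    have := congrArg Prod.fst hc₀
    rwa [Prod.fst_sum] at this
  have hc2 : ∑ i, c₀ i • (e i (j y₀)).2 = ξ := by
    have := congrArg Prod.snd hc₀
    rwa [Prod.snd_sum] at this
  let a₀ : (Fin k → ℝ) × F := (c₀, toCoord y₁ y₀ w.1)
  -- Since A C A = A, this is a smooth family in ker A, and it passes through `a₀`, which is in the
  -- kernel at `y₀`.
  let κ : N → (Fin k → ℝ) × F := fun y => a₀ - C y (A y a₀)
  have hA₀ : ∀ y ∈ O', ∀ a, A y a = 0 ↔ ∑ i, a.1 i • (e i (j y)).1 =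
      tanMap E F j y (ofCoord y₁ y a.2) := by
    intro y hy a
    rw [← (toCoord_injective (p := b) (hO'O₁ hy).2.2).eq_iff, map_sum]
    simp only [map_smul]
    rw [← combo_apply]
    exact sub_eq_zero (a := combo (fun i => toCoord b (j y) (e i (j y)).1) a.1)
      (b := toCoord b (j y) (tanMap E F j y (ofCoord y₁ y a.2)))
  have hκ : ContMDiffOn 𝓘(ℝ, F) 𝓘(ℝ, (Fin k → ℝ) × F) ∞ κ O' :=
    contMDiffOn_const.sub (hC.clm_apply ((hA.mono hO'O₁).clm_apply contMDiffOn_const))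
  have hκ₀ : κ y₀ = a₀ := by
    have : A y₀ a₀ = 0 := by
      rw [hA₀ y₀ hy₀']
      change ∑ i, c₀ i • (e i (j y₀)).1 = tanMap E F j y₀ (ofCoord y₁ y₀ (toCoord y₁ y₀ w.1))
      rw [ofCoord_toCoord hy₀.1.2, hc1]
    change a₀ - C y₀ (A y₀ a₀) = a₀
    rw [this, map_zero, sub_zero]
  have hκA : ∀ y ∈ O', ∑ i, (κ y).1 i • (e i (j y)).1 = tanMap E F j y (ofCoord y₁ y (κ y).2) := by
    intro y hy
    rw [← hA₀ y hy]
    change A y (a₀ - C y (A y a₀)) = 0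
    rw [map_sub, hAC y hy, sub_self]
  -- The coefficients, known only on N, are extended to M by the retraction `r`.
  let τ : ∀ x : M, GenTan E x := fun x => ∑ i, (κ (r x)).1 i • e i x
  have hV : IsOpen ((R ∩ r ⁻¹' O') ∩ U) := (hr.continuousOn.isOpen_inter_preimage hR hO').inter hU
  have hmaps : MapsTo j O' ((R ∩ r ⁻¹' O') ∩ U) := fun y hy =>
    ⟨⟨hjR (hO'O₁ hy).1.1.2, by
      change r (j y) ∈ O'
      rw [hrj y (hO'O₁ hy).1.1.2]
      exact hy⟩, (hO'O₁ hy).2.1⟩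
  have hτ : IsSectionOn D τ ((R ∩ r ⁻¹' O') ∩ U) := by
    refine ⟨SmoothGenOn.sum _ fun i => SmoothGenOn.smul ?_ ((he i).mono inter_subset_right),
      fun x hx => ?_⟩
    · have h1 : ContMDiffOn 𝓘(ℝ, F) 𝓘(ℝ, ℝ) ∞ (fun y => (κ y).1 i) O' :=
        contMDiffOn_pi_space.1
          ((ContinuousLinearMap.fst ℝ (Fin k → ℝ) F).contMDiff.comp_contMDiffOn hκ) i
      exact h1.comp (hr.mono fun x hx => hx.1.1) fun x hx => hx.1.2
    · rw [← (hspan x hx.2).2]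
      exact Submodule.sum_mem _ fun i _ =>
        Submodule.smul_mem _ _ (Submodule.subset_span (mem_range_self i))
  have hτj : ∀ y ∈ O', τ (j y) = ∑ i, (κ y).1 i • e i (j y) := fun y hy => by
    change ∑ i, (κ (r (j y))).1 i • e i (j y) = _
    rw [hrj y (hO'O₁ hy).1.1.2]
  have hrel : Related j (fun y => (ofCoord y₁ y (κ y).2, (τ (j y)).2.comp (tanMap E F j y))) τ
      O' := fun y hy => ⟨by rw [hτj y hy, Prod.fst_sum]; exact (hκA y hy).symm, rfl⟩
  refine ⟨O', _, _, τ, fun y hy => (hO'O₁ hy).1.1.1, hO', hV, hy₀', hmaps, ⟨⟨?_, ?_⟩,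
    fun y hy => ?_⟩, hτ, hrel, ?_⟩
  · refine (smoothFieldOn_iff (p := y₁) hO' (fun y hy => (hO'O₁ hy).1.2) _).2
      (((ContinuousLinearMap.snd ℝ (Fin k → ℝ) F).contMDiff.comp_contMDiffOn hκ).congr
        fun y hy => ?_)
    exact toCoord_ofCoord (hO'O₁ hy).1.2 _
  · exact SmoothFormOn.pull hO' hj.contMDiffOn hmaps hτ.1.2
  · refine mem_pullback.2 ⟨(τ (j y)).2, ?_, rfl⟩
    rw [(hrel y hy).1]
    exact hτ.2 _ (hmaps hy)
  · refine Prod.ext ?_ ?_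
    · change ofCoord y₁ y₀ (κ y₀).2 = w.1
      rw [hκ₀]
      exact ofCoord_toCoord hy₀.1.2 w.1
    · change (τ (j y₀)).2.comp (tanMap E F j y₀) = w.2
      rw [hτj y₀ hy₀', hκ₀, Prod.snd_sum, hw2]
      exact congrArg (fun ζ : Cot E (j y₀) => ζ.comp (tanMap E F j y₀)) hc2

/-- The pullback of a Dirac structure by an immersion is a Dirac structure if it is a subbundle. -/
theorem isDirac_pullback (hD : IsDirac D) (hj : ContMDiff 𝓘(ℝ, F) 𝓘(ℝ, E) ∞ j)
    (hinj : ∀ y, Function.Injective (tanMap E F j y))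
    (hsub : IsSubbundle (pullback (F := F) j D)) : IsDirac (pullback (F := F) j D) := by
  have hL : ∀ y, orth (pullback (F := F) j D y) = pullback (F := F) j D y := fun y =>
    orth_pullback j (orth_eq_of_isDirac hD _)
  have hLi : ∀ y, IsIsotropic (pullback (F := F) j D y) := fun y => (hL y).ge
  have hDi : ∀ x, IsIsotropic (D x) := fun x => (hD.maximal x).prop
  refine ⟨hsub, fun y => maximal_iff_orth_eq.2 (hL y), fun U σ₁ σ₂ hU h₁ h₂ y hy => ?_⟩
  refine mem_of_pairing_eq_zero (hL y) fun w hw => ?_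
  obtain ⟨U₃, σ₃, hU₃, hy₃, h₃, rfl⟩ := hsub.exists_section hw
  have hV := hU.inter hU₃
  refine eq_zero_of_dense (f := fun x => pairing (courant σ₁ σ₂ x) (σ₃ x)) hV
    (SmoothGenOn.pairing (SmoothGenOn.courant hV (h₁.1.mono inter_subset_left)
      (h₂.1.mono inter_subset_left)) (h₃.1.mono inter_subset_right)).continuousOn ?_ ⟨hy, hy₃⟩
  intro O hOV hO hne
  obtain ⟨z, hzO, hz⟩ := exists_related_section hD.subbundle hj hinj hO hne
  have k₁ := h₁.mono fun x hx => (hOV hx).1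
  have k₂ := h₂.mono fun x hx => (hOV hx).1
  have k₃ := h₃.mono fun x hx => (hOV hx).2
  obtain ⟨O₁, V₁, τ₁, μ₁, hO₁, hO₁', hV₁, hz₁, m₁, l₁, s₁, r₁, e₁⟩ := hz _ (k₁.2 z hzO)
  obtain ⟨O₂, V₂, τ₂, μ₂, hO₂, hO₂', hV₂, hz₂, m₂, l₂, s₂, r₂, e₂⟩ := hz _ (k₂.2 z hzO)
  obtain ⟨O₃, V₃, τ₃, μ₃, hO₃, hO₃', hV₃, hz₃, m₃, l₃, s₃, r₃, e₃⟩ := hz _ (k₃.2 z hzO)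
  have hW := (hO₁'.inter hO₂').inter hO₃'
  have hX := (hV₁.inter hV₂).inter hV₃
  have hzW : z ∈ O₁ ∩ O₂ ∩ O₃ := ⟨⟨hz₁, hz₂⟩, hz₃⟩
  have hmaps : MapsTo j (O₁ ∩ O₂ ∩ O₃) (V₁ ∩ V₂ ∩ V₃) := fun x hx =>
    ⟨⟨m₁ hx.1.1, m₂ hx.1.2⟩, m₃ hx.2⟩
  have l₁' := l₁.mono (V := O₁ ∩ O₂ ∩ O₃) fun x hx => hx.1.1
  have l₂' := l₂.mono (V := O₁ ∩ O₂ ∩ O₃) fun x hx => hx.1.2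
  have l₃' := l₃.mono (V := O₁ ∩ O₂ ∩ O₃) fun x hx => hx.2
  have s₁' := s₁.mono (V := V₁ ∩ V₂ ∩ V₃) fun x hx => hx.1.1
  have s₂' := s₂.mono (V := V₁ ∩ V₂ ∩ V₃) fun x hx => hx.1.2
  have s₃' := s₃.mono (V := V₁ ∩ V₂ ∩ V₃) fun x hx => hx.2
  refine ⟨z, hzO, ?_⟩
  -- By tensoriality the sections are replaced at `z` by related ones, and naturality moves the
  -- computation to M, where D is closed.
  rw [pairing_courant_congr hLi hW (k₁.mono fun x hx => hO₁ hx.1.1) (k₂.mono fun x hx => hO₁ hx.1.1)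
    (k₃.mono fun x hx => hO₁ hx.1.1) l₁' l₂' hzW e₁.symm e₂.symm, ← e₃,
    Related.pairing_courant hW hX hj.contMDiffOn hmaps l₁'.1 l₂'.1 l₃'.1 s₁'.1 s₂'.1 s₃'.1
      (fun x hx => r₁ x hx.1.1) (fun x hx => r₂ x hx.1.2) (fun x hx => r₃ x hx.2)
      (fun x hx => hDi x _ (s₁'.2 x hx) _ (s₂'.2 x hx))
      (fun x hx => hDi x _ (s₁'.2 x hx) _ (s₃'.2 x hx)) hzW]
  exact hDi _ _ (hD.closed _ _ _ hX s₁' s₂' _ (hmaps hzW)) _ (s₃'.2 _ (hmaps hzW))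

end Pullback
end
end DiracGeometry

namespace DiracGeometry

noncomputable section

/-! ### Restriction to integral manifolds. -/

section Submanifold

variable {E : Type*} [NormedAddCommGroup E] [NormedSpace ℝ E] [FiniteDimensional ℝ E]
  {M : Type*} [TopologicalSpace M] [ChartedSpace E M] [IsManifold 𝓘(ℝ, E) ∞ M]
  {F : Type*} [NormedAddCommGroup F] [NormedSpace ℝ F] [FiniteDimensional ℝ F]
  {N : Type*} [TopologicalSpace N] [ChartedSpace F N] [IsManifold 𝓘(ℝ, F) ∞ N]
  {i : N → M}

/-- A vector field tangent to an immersed manifold restricts to it. -/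
theorem exists_restrict_field (hi : ContMDiff 𝓘(ℝ, F) 𝓘(ℝ, E) ∞ i)
    (hinj : ∀ y, Function.Injective (tanMap E F i y)) {U : Set M} (hU : IsOpen U)
    {X : ∀ x : M, Tan E x} (hX : SmoothFieldOn X U)
    (htan : ∀ y, i y ∈ U → X (i y) ∈ tanRange E F i y) {y : N} (hy : i y ∈ U) :
    ∃ (O : Set N) (u : ∀ y : N, Tan F y), IsOpen O ∧ y ∈ O ∧ MapsTo i O U ∧ SmoothFieldOn u O ∧
      ∀ z ∈ O, tanMap E F i z (u z) = X (i z) := by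
  let b := i y
  have hU' := hU.inter (chartAt E b).open_source
  let O := (chartAt F y).source ∩ i ⁻¹' (U ∩ (chartAt E b).source)
  have hO : IsOpen O := (chartAt F y).open_source.inter (hU'.preimage hi.continuous)
  have hyO : y ∈ O := ⟨mem_chart_source F y, hy, mem_chart_source E b⟩
  let A : N → F →L[ℝ] E := fun z =>
    (toCoord (E := E) b (i z)).comp ((tanMap E F i z).comp (ofCoord y z))
  have hA : ContMDiffOn 𝓘(ℝ, F) 𝓘(ℝ, F →L[ℝ] E) ∞ A O := contMDiffOn_clm_of_apply fun v =>
    contMDiffOn_toCoord_tanMap hO hi.contMDiffOn (fun z hz => hz.2.2)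
      ((smoothFieldOn_ofCoord y v).mono inter_subset_left)
  have hAi : ∀ z ∈ O, Function.Injective (A z) := fun z hz =>
    (toCoord_injective hz.2.2).comp ((hinj z).comp
      (Function.LeftInverse.injective (g := toCoord y z) (toCoord_ofCoord hz.1)))
  obtain ⟨O', hO'O, hO', hyO', R, hR, hAR⟩ := exists_generalizedInverse hO hA hyO fun z hz => by
    rw [LinearMap.finrank_range_of_inj (hAi z hz), LinearMap.finrank_range_of_inj (hAi y hyO)]
  have hw : ContMDiffOn 𝓘(ℝ, F) 𝓘(ℝ, E) ∞ (fun z => toCoord b (i z) (X (i z))) O' :=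
    ((smoothFieldOn_iff hU' inter_subset_right X).1 (hX.mono inter_subset_left)).comp
      hi.contMDiffOn fun z hz => (hO'O hz).2
  refine ⟨O', fun z => ofCoord y z (R z (toCoord b (i z) (X (i z)))), hO', hyO',
    fun z hz => (hO'O hz).2.1, ?_, fun z hz => ?_⟩
  · refine (smoothFieldOn_iff hO' (fun z hz => (hO'O hz).1) _).2 ((hR.clm_apply hw).congr
      fun z hz => ?_)
    exact toCoord_ofCoord (hO'O hz).1 _
  · apply toCoord_injective (hO'O hz).2.2
    obtain ⟨v, hv⟩ := htan z (hO'O hz).2.1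
    have h1 : A z (toCoord y z v) = toCoord b (i z) (X (i z)) := by
      change toCoord b (i z) (tanMap E F i z (ofCoord y z (toCoord y z v))) = _
      rw [ofCoord_toCoord (hO'O hz).1]
      exact congrArg (toCoord b (i z)) hv
    have := hAR z hz (toCoord y z v)
    rw [h1] at this
    exact this

/-- When all vector components of D along N are tangent to N, sections of D restrict to N, so every
element of the pullback extends smoothly. The rank is constant since the pullback equals its
orthogonal. -/
theorem isSubbundle_pullback {D : ∀ x : M, Submodule ℝ (GenTan E x)} (hsub : IsSubbundle D)
    (hD : ∀ x, orth (D x) = D x) (hi : ContMDiff 𝓘(ℝ, F) 𝓘(ℝ, E) ∞ i)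
    (hinj : ∀ y, Function.Injective (tanMap E F i y))
    (htan : ∀ y, ∀ v ∈ D (i y), v.1 ∈ tanRange E F i y) :
    IsSubbundle (pullback (F := F) i D) := by
  refine isSubbundle_of_exists_section (fun y => finrank_of_orth_eq (orth_pullback i (hD (i y))))
    fun y w hw => ?_
  obtain ⟨ξ, hξ, hw2⟩ := mem_pullback.1 hw
  obtain ⟨U, σ, hU, hyU, hσ, hσy⟩ := hsub.exists_section hξ
  obtain ⟨O, u, hO, hyO, hmaps, hu, hui⟩ := exists_restrict_field hi hinj hU hσ.1.1
    (fun z hz => htan z _ (hσ.2 _ hz)) hyU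
  refine ⟨O, fun z => (u z, (σ (i z)).2.comp (tanMap E F i z)), hO, hyO,
    ⟨⟨hu, SmoothFormOn.pull hO hi.contMDiffOn hmaps hσ.1.2⟩, fun z hz => ?_⟩, Prod.ext ?_ ?_⟩
  · refine mem_pullback.2 ⟨(σ (i z)).2, ?_, rfl⟩
    rw [hui z hz]
    exact hσ.2 _ (hmaps hz)
  · apply hinj y
    rw [hui y hyO, hσy]
  · change (σ (i y)).2.comp (tanMap E F i y) = w.2
    rw [hσy, hw2]

theorem isDirac_pullback_induced {D : ∀ x : M, Submodule ℝ (GenTan E x)}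
    {Φ : ∀ x : M, Submodule ℝ (Tan E x)} (hD : IsDirac (induced D fun x => annPart (Φ x)))
    (hi : IsIntegralManifold (F := F) Φ i) :
    IsDirac (pullback (F := F) i (induced D fun x => annPart (Φ x))) := by
  refine isDirac_pullback hD hi.smooth hi.immersion (isSubbundle_pullback hD.subbundle
    (orth_eq_of_isDirac hD) hi.smooth hi.immersion fun y v hv => ?_)
  rw [hi.tangent]
  exact fst_mem_of_mem_induced hv

end Submanifold

/-! ### The induced immersion j : Q → B. -/

section Reduction

variable {E : Type*} [NormedAddCommGroup E] [NormedSpace ℝ E] [FiniteDimensional ℝ E]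
  {M : Type*} [TopologicalSpace M] [ChartedSpace E M] [IsManifold 𝓘(ℝ, E) ∞ M]
  {G : Type*} [NormedAddCommGroup G] [NormedSpace ℝ G] [FiniteDimensional ℝ G]
  {B : Type*} [TopologicalSpace B] [ChartedSpace G B] [IsManifold 𝓘(ℝ, G) ∞ B]
  {F : Type*} [NormedAddCommGroup F] [NormedSpace ℝ F] [FiniteDimensional ℝ F]
  {N : Type*} [TopologicalSpace N] [ChartedSpace F N] [IsManifold 𝓘(ℝ, F) ∞ N]
  {K : Type*} [NormedAddCommGroup K] [NormedSpace ℝ K] [FiniteDimensional ℝ K]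
  {Q : Type*} [TopologicalSpace Q] [ChartedSpace K Q] [IsManifold 𝓘(ℝ, K) ∞ Q]
  {S : ∀ x : M, Submodule ℝ (Tan E x)} {τ : M → B} (hτ : IsLeafSpace (E := G) S τ)
  {i : N → M} (hi : ContMDiff 𝓘(ℝ, F) 𝓘(ℝ, E) ∞ i) {ρ : N → Q}
  (hρ : IsLeafSpace (E := K) (restrictDist (F := F) i S) ρ)

-- A curve in N tangent to S ∩ TN is mapped by i to a curve tangent to S, so τ ∘ i is constant on
-- the fibres of ρ.
omit [FiniteDimensional ℝ E] [IsManifold 𝓘(ℝ, E) ∞ M] [FiniteDimensional ℝ G]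
  [IsManifold 𝓘(ℝ, G) ∞ B] [FiniteDimensional ℝ F] [IsManifold 𝓘(ℝ, F) ∞ N]
  [FiniteDimensional ℝ K] [IsManifold 𝓘(ℝ, K) ∞ Q] in
include hτ hi hρ in
theorem exists_reducedMap : ∃ j : Q → B, ∀ y, j (ρ y) = τ (i y) := by
  refine ⟨fun q => τ (i (Function.surjInv hρ.surjective q)), fun y => ?_⟩
  obtain ⟨γ, hγ, h0, h1, htan⟩ :=
    (hρ.fibre _ _).1 (Function.surjInv_eq hρ.surjective (ρ y))
  refine (hτ.fibre _ _).2 ⟨fun t => i (γ t), hi.comp hγ, congrArg i h0, congrArg i h1, ?_⟩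
  rintro t _ ⟨r, rfl⟩
  have h2 := htan t ⟨r, rfl⟩
  have h3 := mfderiv_comp_apply (I'' := 𝓘(ℝ, E)) t ((hi (γ t)).mdifferentiableAt (by simp))
    ((hγ t).mdifferentiableAt (by simp)) r
  exact (congrArg (· ∈ S (i (γ t))) h3).mpr h2

variable {j : Q → B} (hj : ∀ y, j (ρ y) = τ (i y))

include hτ hi hρ hj

-- Locally j = τ ∘ i ∘ s for a local section s of ρ.
omit [FiniteDimensional ℝ E] [IsManifold 𝓘(ℝ, E) ∞ M] [FiniteDimensional ℝ G]
  [IsManifold 𝓘(ℝ, G) ∞ B] [FiniteDimensional ℝ F] in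
theorem contMDiff_reducedMap : ContMDiff 𝓘(ℝ, K) 𝓘(ℝ, G) ∞ j := by
  intro q
  obtain ⟨y, rfl⟩ := hρ.surjective q
  obtain ⟨V, s, hV, hyV, hs, -, hρs⟩ := exists_localSection hρ.smooth y (hρ.submersion y)
  refine (((hτ.smooth.comp hi).comp_contMDiffOn hs).congr fun b hb => ?_).contMDiffAt
    (hV.mem_nhds hyV)
  exact (congrArg j (hρs b hb)).symm.trans (hj (s b))

omit [FiniteDimensional ℝ E] [IsManifold 𝓘(ℝ, E) ∞ M] [FiniteDimensional ℝ G]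
  [IsManifold 𝓘(ℝ, G) ∞ B] [FiniteDimensional ℝ F] in
theorem tanMap_reducedMap (y : N) (v : Tan F y) :
    (show G from tanMap G K j (ρ y) (tanMap K F ρ y v)) =
      tanMap G E τ (i y) (tanMap E F i y v) := by
  have h1 := mfderiv_comp_apply (I'' := 𝓘(ℝ, G)) y
    ((contMDiff_reducedMap hτ hi hρ hj (ρ y)).mdifferentiableAt (by simp))
    ((hρ.smooth y).mdifferentiableAt (by simp)) v
  have h2 := mfderiv_comp_apply (I'' := 𝓘(ℝ, G)) y
    ((hτ.smooth (i y)).mdifferentiableAt (by simp)) ((hi y).mdifferentiableAt (by simp)) v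
  have h3 : j ∘ ρ = τ ∘ i := funext hj
  refine h1.symm.trans (Eq.trans ?_ h2)
  exact congrArg (fun f : N → B => (show F →L[ℝ] G from mfderiv 𝓘(ℝ, F) 𝓘(ℝ, G) f y) v) h3

-- If j_* ρ_* v = τ_* i_* v vanishes, then i_* v lies in S, so v is in S ∩ TN = ker ρ_*.
omit [FiniteDimensional ℝ E] [IsManifold 𝓘(ℝ, E) ∞ M] [FiniteDimensional ℝ G]
  [IsManifold 𝓘(ℝ, G) ∞ B] [FiniteDimensional ℝ F] in
theorem injective_tanMap_reducedMap (q : Q) : Function.Injective (tanMap G K j q) := by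
  refine (injective_iff_map_eq_zero _).2 fun w hw => ?_
  obtain ⟨y, rfl⟩ := hρ.surjective q
  obtain ⟨v, rfl⟩ := hρ.submersion y w
  refine hρ.mem_iff.1 ?_
  change tanMap E F i y v ∈ S (i y)
  rw [hτ.mem_iff]
  exact (tanMap_reducedMap hτ hi hρ hj y v).symm.trans hw

variable {L : ∀ x : M, Submodule ℝ (GenTan E x)} (hSL : ∀ x, tanPart (S x) ≤ L x)
  {DB : ∀ b : B, Submodule ℝ (GenTan G b)}
  (hDB : ∀ p, DB (τ p) = pushforwardAt (E := G) τ L p)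

include hSL hDB

-- Moves membership in the reduced structure from Q up to N and M, where it concerns only L and an
-- arbitrary lift v.
omit [FiniteDimensional ℝ E] [IsManifold 𝓘(ℝ, E) ∞ M] [FiniteDimensional ℝ G]
  [IsManifold 𝓘(ℝ, G) ∞ B] [FiniteDimensional ℝ F] in
theorem mem_pullback_reducedMap_iff {y : N} {w : GenTan K (ρ y)} {v : Tan F y}
    (hv : tanMap K F ρ y v = w.1) :
    w ∈ pullback (F := K) j DB (ρ y) ↔ ∃ η : Cot G (τ (i y)),
      ((tanMap E F i y v, η.comp (tanMap G E τ (i y))) : GenTan E (i y)) ∈ L (i y) ∧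
        w.2.comp (tanMap K F ρ y) = (η.comp (tanMap G E τ (i y))).comp (tanMap E F i y) := by
  have hX : tanMap G E τ (i y) (tanMap E F i y v) = (show G from tanMap G K j (ρ y) w.1) := by
    rw [← hv]
    exact (tanMap_reducedMap hτ hi hρ hj y v).symm
  constructor
  · rintro ⟨η, h1, h2⟩
    have h3 := mem_congr_point (hj y) h1
    rw [hDB] at h3
    refine ⟨η, (mem_pushforwardAt_iff hτ hSL hX).1 h3, ?_⟩
    ext u
    rw [h2]
    exact congrArg (show G →L[ℝ] ℝ from η) (tanMap_reducedMap hτ hi hρ hj y u)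
  · rintro ⟨η, h1, h2⟩
    have h3 := (mem_pushforwardAt_iff hτ hSL (w := (show G from tanMap G K j (ρ y) w.1, η)) hX).2 h1
    rw [← hDB] at h3
    refine mem_pullback.2 ⟨(show G →L[ℝ] ℝ from η), mem_congr_point (hj y).symm h3, ?_⟩
    ext a
    obtain ⟨u, rfl⟩ := hρ.submersion y a
    exact (DFunLike.congr_fun h2 u).trans
      (congrArg (show G →L[ℝ] ℝ from η) (tanMap_reducedMap hτ hi hρ hj y u)).symm

end Reduction
end
end DiracGeometry

namespace DiracGeometry

noncomputable section

/-! ### Generalized Marsden–Ratiu reduction. -/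

section MarsdenRatiu

variable {E : Type*} [NormedAddCommGroup E] [NormedSpace ℝ E] [FiniteDimensional ℝ E]
  {M : Type*} [TopologicalSpace M] [ChartedSpace E M] [IsManifold 𝓘(ℝ, E) ∞ M]
  {G : Type*} [NormedAddCommGroup G] [NormedSpace ℝ G] [FiniteDimensional ℝ G]
  {B : Type*} [TopologicalSpace B] [ChartedSpace G B] [IsManifold 𝓘(ℝ, G) ∞ B]
  {F : Type*} [NormedAddCommGroup F] [NormedSpace ℝ F] [FiniteDimensional ℝ F]
  {N : Type*} [TopologicalSpace N] [ChartedSpace F N] [IsManifold 𝓘(ℝ, F) ∞ N]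
  {K : Type*} [NormedAddCommGroup K] [NormedSpace ℝ K] [FiniteDimensional ℝ K]
  {Q : Type*} [TopologicalSpace Q] [ChartedSpace K Q] [IsManifold 𝓘(ℝ, K) ∞ Q]
  {S : ∀ x : M, Submodule ℝ (Tan E x)} {τ : M → B} (hτ : IsLeafSpace (E := G) S τ)
  {i : N → M} (hi : ContMDiff 𝓘(ℝ, F) 𝓘(ℝ, E) ∞ i) {ρ : N → Q}
  (hρ : IsLeafSpace (E := K) (restrictDist (F := F) i S) ρ)
  {j : Q → B} (hj : ∀ y, j (ρ y) = τ (i y))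
  {DB : ∀ b : B, Submodule ℝ (GenTan G b)}

omit [FiniteDimensional ℝ E] [IsManifold 𝓘(ℝ, E) ∞ M] [IsManifold 𝓘(ℝ, G) ∞ B] in
include hτ in
/-- A covector which annihilates the leaves is the pullback of a covector of the leaf space. -/
theorem IsLeafSpace.exists_comp_eq {x : M} {ξ : Cot E x} (hξ : ξ ∈ ann (S x)) :
    ∃ η : Cot G (τ x), η.comp (tanMap G E τ x) = ξ := by
  have : FiniteDimensional ℝ (Tan G (τ x)) := inferInstanceAs (FiniteDimensional ℝ G)
  obtain ⟨R, hR⟩ := (tanMap G E τ x).toLinearMap.exists_rightInverse_of_surjective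
    (LinearMap.range_eq_top.2 (hτ.submersion x))
  refine ⟨LinearMap.toContinuousLinearMap (ξ.toLinearMap ∘ₗ R), ?_⟩
  ext v
  have hmem : R (tanMap G E τ x v) - v ∈ S x := by
    rw [hτ.mem_iff, map_sub]
    exact sub_eq_zero.2 (LinearMap.congr_fun hR (tanMap G E τ x v))
  have h := hξ _ hmem
  rw [map_sub] at h
  exact sub_eq_zero.1 h

include hτ hi hρ hj

omit [IsManifold 𝓘(ℝ, E) ∞ M] [IsManifold 𝓘(ℝ, G) ∞ B] in
/-- The reduction is the projection of the restriction of `L^{Φ⁰}` to `N`. -/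
theorem pullback_reducedMap_eq {L : ∀ x : M, Submodule ℝ (GenTan E x)} (hL : ∀ x, orth (L x) = L x)
    (hSL : ∀ x, tanPart (S x) ≤ L x)
    (hDB : ∀ p, DB (τ p) = pushforwardAt (E := G) τ L p) (hDBo : ∀ b, orth (DB b) = DB b)
    {Φ : ∀ x : M, Submodule ℝ (Tan E x)} (hΦ : ∀ y, tanRange E F i y = Φ (i y)) (y : N) :
    pullback (F := K) j DB (ρ y) =
      pushforwardAt (E := K) ρ (pullback (F := F) i (induced L fun x => annPart (Φ x))) y := by
  have hle : pullback (F := K) j DB (ρ y) ≤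
      pushforwardAt (E := K) ρ (pullback (F := F) i (induced L fun x => annPart (Φ x))) y := by
    intro w hw
    obtain ⟨v, hv⟩ := hρ.submersion y w.1
    obtain ⟨η, h1, h2⟩ := (mem_pullback_reducedMap_iff hτ hi hρ hj hSL hDB hv).1 hw
    refine ⟨v, mem_pullback.2 ⟨_, ?_, h2⟩, hv.symm⟩
    refine Submodule.mem_sup_left ⟨h1, mem_orth_annPart.2 ?_⟩
    rw [← hΦ]
    exact ⟨v, rfl⟩
  -- Both sides equal their own orthogonals, so taking orthogonals of the inclusion reverses it.
  refine le_antisymm hle ?_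
  have h := orth_anti hle
  rwa [orth_pushforwardAt ρ (orth_pullback i (orth_induced (hL _) (isIsotropic_annPart _))),
    orth_pullback j (hDBo _)] at h

-- An element `(ρ_* u, 0)` of the reduced structure comes from some `(X, ξ)` in D with ξ in S⁰ ∩ TN⁰
-- and X in i_* u + S. It vanishes exactly when i_* u, equivalently X, lies in S.
omit [FiniteDimensional ℝ E] [IsManifold 𝓘(ℝ, E) ∞ M] [IsManifold 𝓘(ℝ, G) ∞ B]
  [FiniteDimensional ℝ F] in
theorem pullback_reducedMap_inf_tanPart {D : ∀ x : M, Submodule ℝ (GenTan E x)}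
    (hDB : ∀ p, DB (τ p) = pushforwardAt (E := G) τ (induced D fun x => tanPart (S x)) p) (y : N) :
    pullback (F := K) j DB (ρ y) ⊓ tanPart ⊤ = ⊥ ↔
      ∀ v ∈ D (i y), v.2 ∈ ann (S (i y)) → v.2 ∈ ann (tanRange E F i y) →
        v.1 ∈ S (i y) ⊔ tanRange E F i y → v.1 ∈ S (i y) := by
  have hSL := le_induced D fun x => tanPart (S x)
  rw [inf_tanPart_eq_bot_iff]
  constructor
  · intro h v hv hvS hvN hvX
    obtain ⟨s, hs, _, ⟨u, rfl⟩, hsu⟩ := Submodule.mem_sup.1 hvX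
    obtain ⟨η, hη⟩ := hτ.exists_comp_eq hvS
    have hmem : ((tanMap E F i y u, η.comp (tanMap G E τ (i y))) : GenTan E (i y)) ∈
        induced D (fun x => tanPart (S x)) (i y) := by
      rw [hη]
      refine Submodule.mem_sup.2 ⟨v, ⟨hv, mem_orth_tanPart.2 hvS⟩, (-s, 0),
        mem_tanPart.2 ⟨Submodule.neg_mem _ hs, rfl⟩, Prod.ext ?_ (add_zero _)⟩
      change v.1 + -s = tanMap E F i y u
      rw [← hsu]
      exact add_neg_eq_of_eq_add (add_comm _ _)
    have h0 := h (tanMap K F ρ y u) ((mem_pullback_reducedMap_iff hτ hi hρ hj hSL hDB rfl).2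
      ⟨η, hmem, by
        ext a
        rw [hη]
        exact (hvN _ ⟨a, rfl⟩).symm⟩)
    have hu : tanMap E F i y u ∈ S (i y) := hρ.mem_iff.2 h0
    rw [← hsu]
    exact Submodule.add_mem _ hs hu
  · intro h X hX
    obtain ⟨u, rfl⟩ := hρ.submersion y X
    obtain ⟨η, h1, h2⟩ := (mem_pullback_reducedMap_iff hτ hi hρ hj hSL hDB rfl).1 hX
    obtain ⟨v, ⟨hv, hvS⟩, s, hs, hvs⟩ := Submodule.mem_sup.1 h1
    obtain ⟨hs1, hs2⟩ := mem_tanPart.1 hs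
    have e1 : v.1 + s.1 = tanMap E F i y u := congrArg Prod.fst hvs
    have e2 : v.2 = η.comp (tanMap G E τ (i y)) := by
      have : v.2 + s.2 = η.comp (tanMap G E τ (i y)) := congrArg Prod.snd hvs
      rwa [hs2, add_zero] at this
    have hvX : v.1 ∈ S (i y) := by
      refine h v hv (mem_orth_tanPart.1 hvS) ?_ ?_
      · rintro _ ⟨a, rfl⟩
        rw [e2]
        exact (DFunLike.congr_fun h2 a).symm
      · rw [eq_sub_of_add_eq e1]
        exact Submodule.sub_mem _ (Submodule.mem_sup_right ⟨u, rfl⟩) (Submodule.mem_sup_left hs1)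
    refine hρ.mem_iff.1 ?_
    change tanMap E F i y u ∈ S (i y)
    rw [← e1]
    exact Submodule.add_mem _ hvX hs1

/-- The generalized Marsden-Ratiu reduction of a Dirac structure. -/
theorem isDirac_pullback_reducedMap {L : ∀ x : M, Submodule ℝ (GenTan E x)}
    (hL : ∀ x, orth (L x) = L x) (hSL : ∀ x, tanPart (S x) ≤ L x)
    (hDB : ∀ p, DB (τ p) = pushforwardAt (E := G) τ L p) (hDBd : IsDirac DB)
    {Φ : ∀ x : M, Submodule ℝ (Tan E x)} (hΦ : IsIntegralManifold (F := F) Φ i)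
    (h : IsSubbundle (induced L fun x => annPart (Φ x)) ∨ IsSubbundle (pullback (F := K) j DB)) :
    IsDirac (pullback (F := K) j DB) := by
  have hjs := contMDiff_reducedMap hτ hi hρ hj
  have hji := injective_tanMap_reducedMap hτ hi hρ hj
  have hDBo := orth_eq_of_isDirac hDBd
  -- Closure is inherited from D_B, so only smoothness remains; the second alternative supplies it
  -- directly.
  refine isDirac_pullback hDBd hjs hji (h.elim (fun hsub => ?_) id)
  have hL' : ∀ x, orth (induced L (fun x => annPart (Φ x)) x) =
      induced L (fun x => annPart (Φ x)) x := fun x => orth_induced (hL x) (isIsotropic_annPart _)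
  -- L^{Φ⁰} is tangent to N, hence restricts to a subbundle, whose sections are then pushed to Q
  -- along local sections of ρ.
  have hN := isSubbundle_pullback hsub hL' hΦ.smooth hΦ.immersion fun y v hv => by
    rw [hΦ.tangent]
    exact fst_mem_of_mem_induced hv
  refine isSubbundle_of_exists_section (fun q => finrank_of_orth_eq (orth_pullback j (hDBo _)))
    (exists_section_of_eq_pushforwardAt hρ (fun y => ?_)
      (pullback_reducedMap_eq hτ hi hρ hj hL hSL hDB hDBo hΦ.tangent)
      (fun y => orth_pullback i (hL' _)) hN)
  intro v hv
  obtain ⟨hv1, hv2⟩ := mem_tanPart.1 hv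
  refine mem_pullback.2 ⟨0, Submodule.mem_sup_left ⟨hSL _ (mem_tanPart.2 ⟨hv1, rfl⟩),
    mem_orth_annPart.2 ?_⟩, by rw [hv2, ContinuousLinearMap.zero_comp]⟩
  rw [← hΦ.tangent]
  exact ⟨v.1, rfl⟩

end MarsdenRatiu

/-! ### The Marsden–Ratiu condition. -/

section Poisson

variable {E : Type*} [NormedAddCommGroup E] [NormedSpace ℝ E] [FiniteDimensional ℝ E]
  {M : Type*} [TopologicalSpace M] [ChartedSpace E M] [IsManifold 𝓘(ℝ, E) ∞ M]

/-- For β in V⁰ skewness gives β(X) = -ξ(Π^♯β). The vector Π^♯β lies in TM ∩ (D + V⁰) ⊂ V + W, which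
ξ kills. So V⁰ kills X. -/
theorem fst_mem_of_isPoisson {D : ∀ x : M, Submodule ℝ (GenTan E x)} (hD : IsPoisson D) {x : M}
    {V W : Submodule ℝ (Tan E x)} (h : tanPart ⊤ ⊓ (D x ⊔ annPart V) ≤ tanPart (V ⊔ W))
    {v : GenTan E x} (hv : v ∈ D x) (hvV : v.2 ∈ ann V) (hvW : v.2 ∈ ann W) : v.1 ∈ V := by
  obtain ⟨P, hP, hg⟩ := hD
  refine mem_of_forall_ann fun β hβ => ?_
  have h1 : ((P x β, 0) : GenTan E x) ∈ tanPart (V ⊔ W) :=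
    h ⟨mem_tanPart.2 ⟨trivial, rfl⟩, Submodule.mem_sup.2 ⟨(P x β, β), (hg x _).2 rfl, (0, -β),
      mem_annPart.2 ⟨rfl, (ann V).neg_mem hβ⟩, Prod.ext (add_zero _) (add_neg_cancel _)⟩⟩
  obtain ⟨a, ha, b, hb, hab⟩ := Submodule.mem_sup.1 (mem_tanPart.1 h1).1
  have h2 : v.2 (P x β) = 0 := by
    change a + b = P x β at hab
    rw [← hab, map_add, hvV a ha, hvW b hb, add_zero]
  rw [(hg x v).1 hv, hP.skew, h2, neg_zero]

end Poisson
end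
end DiracGeometry

/-! ### Assembly of the three parts. -/

theorem mainTheorem6
    {E : Type*} [NormedAddCommGroup E] [NormedSpace ℝ E] [FiniteDimensional ℝ E]
    {M : Type*} [TopologicalSpace M] [T2Space M] [SecondCountableTopology M]
    [ChartedSpace E M] [IsManifold 𝓘(ℝ, E) ∞ M]
    (D : ∀ x : M, Submodule ℝ (GenTan E x)) (hD : IsDirac D) :
    -- I. The Dirac bracket of an integrable distribution `Φ`
    (∀ Φ : ∀ x : M, Submodule ℝ (Tan E x), IsIntegrable Φ →
      IsSubbundle (induced D (fun x => annPart (Φ x))) →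
      -- `D^{Φ⁰}` is a Dirac structure, and its anchor is tangent to the foliation
      IsDirac (induced D (fun x => annPart (Φ x))) ∧
      (∀ x, ∀ v ∈ induced D (fun x => annPart (Φ x)) x, v.1 ∈ Φ x) ∧
      -- it is Poisson iff `(D + Φ⁰) ∩ Φ = 0`
      (IsPoisson (induced D (fun x => annPart (Φ x))) ↔
        ∀ x, (D x ⊔ annPart (Φ x)) ⊓ tanPart (Φ x) = ⊥) ∧
      -- and then it is given by the classical Dirac bracket if `D` is Poisson
      (∀ P P' : ∀ x : M, Cot E x →ₗ[ℝ] Tan E x,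
        IsPoissonTensor P → IsGraph D P →
        IsPoissonTensor P' → IsGraph (induced D (fun x => annPart (Φ x))) P' →
        ∀ (x : M) (k : ℕ) (φ : Fin k → M → ℝ),
          (∀ a, ContMDiffAt 𝓘(ℝ, E) 𝓘(ℝ, ℝ) ∞ (φ a) x) →
          Submodule.span ℝ (Set.range fun a => mvfderiv 𝓘(ℝ, E) (φ a) x) = ann (Φ x) →
          IsUnit (Matrix.of fun a b => bracket P (φ a) (φ b) x).det →
          ∀ f g : M → ℝ, ContMDiff 𝓘(ℝ, E) 𝓘(ℝ, ℝ) ∞ f → ContMDiff 𝓘(ℝ, E) 𝓘(ℝ, ℝ) ∞ g →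
            bracket P' f g x = bracket P f g x - ∑ a, ∑ b,
              bracket P f (φ a) x * (Matrix.of fun a b => bracket P (φ a) (φ b) x)⁻¹ a b *
                bracket P (φ b) g x) ∧
      -- it restricts to a Dirac structure on each leaf (or other integral manifold) `N` of `Φ`
      (∀ {F : Type*} [NormedAddCommGroup F] [NormedSpace ℝ F] [FiniteDimensional ℝ F]
        {N : Type*} [TopologicalSpace N] [T2Space N] [SecondCountableTopology N]
        [ChartedSpace F N] [IsManifold 𝓘(ℝ, F) ∞ N] (i : N → M),
        IsIntegralManifold (F := F) Φ i →
        IsDirac (pullback (F := F) i (induced D (fun x => annPart (Φ x)))) ∧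
        -- which is Poisson iff `(D|_N + TN⁰) ∩ TN = 0`
        (IsPoisson (pullback (F := F) i (induced D (fun x => annPart (Φ x)))) ↔
          ∀ y, (D (i y) ⊔ annPart (tanRange E F i y)) ⊓ tanPart (tanRange E F i y) = ⊥) ∧
        -- that is, `Π^♯(TN⁰) ∩ TN = 0` if `D` is the graph of `Π^♯`
        (∀ P : ∀ x : M, Cot E x →ₗ[ℝ] Tan E x, IsGraph D P →
          (IsPoisson (pullback (F := F) i (induced D (fun x => annPart (Φ x)))) ↔
            ∀ y, (ann (tanRange E F i y)).map (P (i y)) ⊓ tanRange E F i y = ⊥)))) ∧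
    -- II. Projection along an integrable distribution `S`
    (∀ S : ∀ x : M, Submodule ℝ (Tan E x), IsIntegrable S →
      IsSubbundle (fun x => D x ⊓ orth (tanPart (S x))) →
      IsSubbundle (induced D (fun x => tanPart (S x))) →
      -- the projectable sections of `D^S` are Courant involutive
      (∀ (U : Set M) (σ σ' : ∀ x : M, GenTan E x), IsOpen U →
        IsProjectableOn S (induced D (fun x => tanPart (S x))) σ U →
        IsProjectableOn S (induced D (fun x => tanPart (S x))) σ' U →
        IsProjectableOn S (induced D (fun x => tanPart (S x))) (courant σ σ') U) ∧
      -- if there are enough local projectable sections then `S` is a symmetry of `D^S`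
      ((∀ (p : M), ∀ v ∈ induced D (fun x => tanPart (S x)) p,
          ∃ (U : Set M) (σ : ∀ x : M, GenTan E x), IsOpen U ∧ p ∈ U ∧
            IsProjectableOn S (induced D (fun x => tanPart (S x))) σ U ∧ σ p = v) →
        IsSymmetry S (induced D (fun x => tanPart (S x)))) ∧
      -- if `S` is a symmetry of `D^S` then `D^S` projects to a Dirac structure on `B = M/S`
      (IsSymmetry S (induced D (fun x => tanPart (S x))) →
        ∀ {G : Type*} [NormedAddCommGroup G] [NormedSpace ℝ G] [FiniteDimensional ℝ G]
          {B : Type*} [TopologicalSpace B] [T2Space B] [SecondCountableTopology B]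
          [ChartedSpace G B] [IsManifold 𝓘(ℝ, G) ∞ B] (τ : M → B),
          IsLeafSpace (E := G) S τ →
          ∃ DB : ∀ b : B, Submodule ℝ (GenTan G b),
            IsDirac DB ∧
            (∀ p, DB (τ p) = pushforwardAt (E := G) τ (induced D (fun x => tanPart (S x))) p) ∧
            -- III. Generalized Marsden-Ratiu reduction to `Q = N/(S ∩ TN)`, `N` a leaf of `Φ`
            (∀ Φ : ∀ x : M, Submodule ℝ (Tan E x), IsIntegrable Φ →
              ∀ {F : Type*} [NormedAddCommGroup F] [NormedSpace ℝ F] [FiniteDimensional ℝ F]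
                {N : Type*} [TopologicalSpace N] [T2Space N] [SecondCountableTopology N]
                [ChartedSpace F N] [IsManifold 𝓘(ℝ, F) ∞ N] (i : N → M),
                IsIntegralManifold (F := F) Φ i →
              ∀ {K : Type*} [NormedAddCommGroup K] [NormedSpace ℝ K] [FiniteDimensional ℝ K]
                {Q : Type*} [TopologicalSpace Q] [T2Space Q] [SecondCountableTopology Q]
                [ChartedSpace K Q] [IsManifold 𝓘(ℝ, K) ∞ Q] (ρ : N → Q),
                IsLeafSpace (E := K) (restrictDist (F := F) i S) ρ →
              -- the inclusion of `N` induces an immersion `j` of `Q` into `M/S`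
              ∃ j : Q → B, (∀ y, j (ρ y) = τ (i y)) ∧
                ContMDiff 𝓘(ℝ, K) 𝓘(ℝ, G) ∞ j ∧
                (∀ q, Function.Injective (tanMap G K j q)) ∧
                -- if the subbundles exist, then the reduction of `DB` to `Q` is Dirac
                (IsSubbundle (induced (induced D (fun x => tanPart (S x)))
                    (fun x => annPart (Φ x))) ∨ IsSubbundle (pullback (F := K) j DB) →
                  IsDirac (pullback (F := K) j DB) ∧
                  -- when it is Poisson
                  (IsPoisson (pullback (F := K) j DB) ↔
                    ∀ q, pullback (F := K) j DB q ⊓ tanPart ⊤ = ⊥) ∧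
                  (IsPoisson (pullback (F := K) j DB) ↔
                    ∀ y, ∀ v ∈ D (i y), v.2 ∈ ann (S (i y)) → v.2 ∈ ann (tanRange E F i y) →
                      v.1 ∈ S (i y) ⊔ tanRange E F i y → v.1 ∈ S (i y)) ∧
                  -- the Marsden-Ratiu condition for the reduction of a Poisson structure
                  (IsPoisson D →
                    (∀ y, tanPart ⊤ ⊓ (D (i y) ⊔ annPart (S (i y))) ≤
                      tanPart (S (i y) ⊔ tanRange E F i y)) →
                    IsPoisson (pullback (F := K) j DB)))))) := by
  refine ⟨fun Φ hΦ hsub => ?_, fun S hS _ hsub => ⟨?_, ?_, ?_⟩⟩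
  · have hΦD := isDirac_induced_annPart hD hΦ hsub
    refine ⟨hΦD, fun x v hv => fst_mem_of_mem_induced hv, ?_, ?_, ?_⟩
    · rw [isPoisson_iff hΦD]
      exact forall_congr' fun x => by rw [induced_inf_tanPart]
    · intro P P' _ hP _ hP' x k φ _ hspan hC f g _ _
      exact bracket_induced hP hP' hspan hC f g
    · intro F _ _ _ N _ _ _ _ _ i hi
      have hN := isDirac_pullback_induced hΦD hi
      have hiff := (isPoisson_iff hN).trans
        (forall_congr' fun y => pullback_induced_inf_tanPart (D := D) hi y)
      exact ⟨hN, hiff, fun P hP => hiff.trans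
        (forall_congr' fun y => hP.sup_annPart_inf_tanPart (tanRange E F i y))⟩
  · intro U σ σ' hU hσ hσ'
    exact IsProjectableOn.courant hD hS hsub hU hσ hσ'
  · exact isSymmetry_of_projectable hD hsub
  · intro hsym G _ _ _ B _ _ _ _ _ τ hτ
    have hL := isDirac_induced_tanPart hD hS hsub hsym
    have hLo := orth_eq_of_isDirac hL
    have hSL := le_induced D fun x => tanPart (S x)
    obtain ⟨DB, hDB⟩ := exists_eq_pushforwardAt hτ hSL hS.1 hLo hsub hsym
    have hDBd := isDirac_of_eq_pushforwardAt hτ hSL hDB hL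
    refine ⟨DB, hDBd, hDB, ?_⟩
    intro Φ _ F _ _ _ N _ _ _ _ _ i hi K _ _ _ Q _ _ _ _ _ ρ hρ
    obtain ⟨j, hj⟩ := exists_reducedMap hτ hi.smooth hρ
    refine ⟨j, hj, contMDiff_reducedMap hτ hi.smooth hρ hj,
      injective_tanMap_reducedMap hτ hi.smooth hρ hj, fun h => ?_⟩
    have hQ := isDirac_pullback_reducedMap hτ hi.smooth hρ hj hLo hSL hDB hDBd hi h
    have hiff := isPoisson_iff hQ
    have hiff' := hiff.trans (hρ.surjective.forall.trans
      (forall_congr' fun y => pullback_reducedMap_inf_tanPart hτ hi.smooth hρ hj hDB y))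
    exact ⟨hQ, hiff, hiff', fun hP hcond => hiff'.2 fun y v hv hvS hvN _ =>
      fst_mem_of_isPoisson hP (hcond y) hv hvS hvN⟩
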